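/- Let $M$ be a closed smooth manifold, $\mathcal H$ a complex Hilbert space, and $\{D_x\}_{x\in M}$ a family of (unbounded) self-adjoint operators on $\mathcal H$ with compact resolvent, continuous in the norm resolvent sense. Let $\{U_i\}$ be a finite open cover of $M$ such that every non-empty finite intersection of the $U_i$ is contractible, and let $\lambda_i$ be real numbers with $\lambda_i\notin \mathrm{sp}(D_x)$ for all $x\in U_i$. For $x\in U_i$ let $P_i(x)$ be the orthogonal projection onto the closed span of the eigenspaces of $D_x$ for eigenvalues greater than $\lambda_i$, and let $\alpha_i(x)$ be the quasi-free representation of the CAR algebra over $\mathcal H$ on the Fock space $$\mathcal F_{P_i(x)}(\mathcal H)=\mathcal F(P_i(x)\mathcal H)\otimes\mathcal F(\overline{(1-P_i(x))\mathcal H}),\qquad \alpha_i(x)(a^*(f))=a^*(P_i(x)f)\otimes 1+\Gamma\otimes a(\overline{(1-P_i(x))f}),$$ where $\mathcal F(K)$ is the Hilbert space completion of the exterior algebra of $K$ and $\Gamma$ is the parity operator. For $\lambda_i\le\lambda_j$ and $x\in U_i\cap U_j$ let $\mathcal H_{i,j}(x)=(P_i(x)-P_j(x))\mathcal H$, a finite-dimensional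 space. A *choice of volume elements* is a family of unit vectors $\omega_{ij}(x)\in\Lambda^{\mathrm{top}}\mathcal H_{i,j}(x)$, for $\lambda_i\le\lambda_j$ and $x\in U_i\cap U_j$, continuous in $x$ (in the norm of the exterior algebra of $\mathcal H$), with $\omega_{ij}\,\omega_{ji}=1$ if $\lambda_i=\lambda_j$ (where $\mathcal H_{i,j}=0$ and $\Lambda^{\mathrm{top}}=\mathbb C$). Then: 1. A choice of volume elements exists. 2. For every choice $\omega$ there is a unique family of unitary operators $S_{P_j(x),P_i(x)}:\mathcal F_{P_i(x)}(\mathcal H)\to\mathcal F_{P_j(x)}(\mathcal H)$, for all $i,j$ and all $x\in U_i\cap U_j$, such that $$S_{P_j(x),P_i(x)}\,\alpha_i(x)\,S_{P_j(x),P_i(x)}^{*}=\alpha_j(x),\qquad S_{P_i(x),P_j(x)}=S_{P_j(x),P_i(x)}^{-1},$$ and, for $\lambda_i\le\lambda_j$, $S_{P_j(x),P_i(x)}(\omega_{ij}(x)\otimes 1)=1\otimes 1$ (the vacuum vector of $\mathcal F_{P_j(x)}(\mathcal H)$). 3. For every $\omega$, with $S$ as in 2, there is a unique family $g$ of continuous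 functions $g(U_i,U_j,U_k):U_i\cap U_j\cap U_k\to S^1$ with $$S_{P_j(x),P_i(x)}\circ S_{P_i(x),P_k(x)}\circ S_{P_k(x),P_j(x)}=g(U_i,U_j,U_k)(x)\cdot I ,$$ and $g$ is a Čech 2-cocycle in $C^2(\{U_i\},\underline S^1)$ (continuous $S^1$-valued functions). Hence it defines a class $[g]\in H^2(\{U_i\},\underline S^1)$. This class is the same for all choices of $\omega$. -/

import Mathlib

noncomputable section

open scoped InnerProductSpace TensorProduct ComplexConjugate
open UniformSpace

namespace IndexGerbe

/-! ### The conjugate Hilbert space -/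

/-- The conjugate of a complex inner product space: same vectors, same addition and same norm, but
`c • v` is the old `conj c • v` and the inner product is `⟪v, w⟫_conj = ⟪w, v⟫`. -/
def ConjSpace (K : Type*) : Type _ := K

section ConjSpace

variable {K : Type*} [NormedAddCommGroup K] [InnerProductSpace ℂ K]

instance : NormedAddCommGroup (ConjSpace K) := inferInstanceAs (NormedAddCommGroup K)

instance : Module ℂ (ConjSpace K) := Module.compHom K (starRingEnd ℂ)

/-- The conjugate-linear identity map `v ↦ v̄` from a space to its conjugate. -/
def toConj : K →ₗ⋆[ℂ] ConjSpace K where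
  toFun v := v
  map_add' _ _ := rfl
  map_smul' c v := by
    change c • v = starRingEnd ℂ (starRingEnd ℂ c) • v
    simp

instance : NormedSpace ℂ (ConjSpace K) where
  norm_smul_le c v := by
    refine (norm_smul_le (starRingEnd ℂ c) (β := K) v).trans_eq ?_
    rw [RCLike.norm_conj]
    rfl

instance : InnerProductSpace ℂ (ConjSpace K) where
  inner v w := @inner ℂ K _ w v
  norm_sq_eq_re_inner v := @norm_sq_eq_re_inner ℂ K _ _ _ v
  conj_inner_symm v w := @inner_conj_symm ℂ K _ _ _ w v
  add_left u v w := @inner_add_right ℂ K _ _ _ w u v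
  smul_left v w c := @inner_smul_right ℂ K _ _ _ w v (starRingEnd ℂ c)

end ConjSpace

/-! ### The inner product on the exterior algebra -/

section ExteriorAlgebra

variable {K : Type*} [NormedAddCommGroup K] [InnerProductSpace ℂ K]

/-- Contraction of an element of the exterior algebra with the vector `f`: the antiderivation
that sends a vector `v` to `⟪f, v⟫`. -/
def contract (f : K) : ExteriorAlgebra ℂ K →ₗ[ℂ] ExteriorAlgebra ℂ K :=
  CliffordAlgebra.contractLeft (innerₛₗ ℂ f)

lemma contract_one (f : K) : contract f 1 = 0 := by
  unfold contract; exact CliffordAlgebra.contractLeft_one (Q := 0) _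

lemma contract_algebraMap (f : K) (c : ℂ) : contract f (algebraMap ℂ _ c) = 0 :=
  CliffordAlgebra.contractLeft_algebraMap (Q := 0) _ _

lemma contract_ι_mul (f g : K) (x : ExteriorAlgebra ℂ K) :
    contract f (ExteriorAlgebra.ι ℂ g * x)
      = inner ℂ f g • x - ExteriorAlgebra.ι ℂ g * contract f x :=
  CliffordAlgebra.contractLeft_ι_mul _ _ _

lemma contract_contract (f : K) (x : ExteriorAlgebra ℂ K) : contract f (contract f x) = 0 :=
  CliffordAlgebra.contractLeft_contractLeft _ _

lemma contract_add (f g : K) : contract (f + g) = contract f + contract g := by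
  unfold contract; simp

lemma contract_smul (c : ℂ) (f : K) : contract (c • f) = conj c • contract f := by
  unfold contract; simp

theorem ext_induction {P : ExteriorAlgebra ℂ K → Prop} (h1 : P 1)
    (hsmul : ∀ (c : ℂ) x, P x → P (c • x)) (hadd : ∀ x y, P x → P y → P (x + y))
    (hι : ∀ (f : K) x, P x → P (ExteriorAlgebra.ι ℂ f * x)) (x : ExteriorAlgebra ℂ K) : P x := by
  refine CliffordAlgebra.left_induction _ (fun r => ?_) hadd (fun x m hx => hι m x hx) x
  rw [Algebra.algebraMap_eq_smul_one]
  exact hsmul r 1 h1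

/-- The space of conjugate-linear functionals on the exterior algebra. -/
abbrev ConjDual (K : Type*) [NormedAddCommGroup K] [InnerProductSpace ℂ K] : Type _ :=
  ExteriorAlgebra ℂ K →ₗ⋆[ℂ] ℂ

/-- The sesquilinear form `⟪x, y⟫` on the exterior algebra, conjugate-linear in `x`, determined by
`⟪1, y⟫ = ` scalar part of `y` and `⟪f ∧ x, y⟫ = ⟪x, f ⌟ y⟫`; on products of vectors it is
the determinant of the Gram matrix. It is stored as the linear map `x ↦ (y ↦ conj ⟪x, y⟫)`. -/
def extFormAux : ExteriorAlgebra ℂ K →ₗ[ℂ] ConjDual K :=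
  CliffordAlgebra.foldr (0 : QuadraticForm ℂ K)
    (LinearMap.mk₂ ℂ (fun f φ => φ.comp (contract f))
      (fun f g φ => by ext y; simp [contract_add])
      (fun c f φ => by ext y; simp [contract_smul])
      (fun f φ ψ => by ext y; simp)
      (fun c f φ => by ext y; simp))
    (fun f φ => by ext y; simp [contract_contract])
    { toFun := fun y => conj (ExteriorAlgebra.algebraMapInv (R := ℂ) (M := K) y)
      map_add' := by simp
      map_smul' := by simp }

/-- The inner product of the exterior algebra. -/
def extInner (x y : ExteriorAlgebra ℂ K) : ℂ := conj (extFormAux x y)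

lemma extInner_one (y : ExteriorAlgebra ℂ K) :
    extInner 1 y = ExteriorAlgebra.algebraMapInv y := by
  unfold extInner extFormAux
  rw [CliffordAlgebra.foldr_one]
  simp

lemma extInner_ι_mul (f : K) (x y : ExteriorAlgebra ℂ K) :
    extInner (ExteriorAlgebra.ι ℂ f * x) y = extInner x (contract f y) := by
  unfold extInner extFormAux ExteriorAlgebra.ι
  rw [CliffordAlgebra.foldr_mul, CliffordAlgebra.foldr_ι]
  rfl

lemma extInner_add_left (x y z : ExteriorAlgebra ℂ K) :
    extInner (x + y) z = extInner x z + extInner y z := by simp [extInner]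

lemma extInner_smul_left (c : ℂ) (x y : ExteriorAlgebra ℂ K) :
    extInner (c • x) y = conj c * extInner x y := by simp [extInner]

lemma extInner_add_right (x y z : ExteriorAlgebra ℂ K) :
    extInner x (y + z) = extInner x y + extInner x z := by simp [extInner]

lemma extInner_sub_right (x y z : ExteriorAlgebra ℂ K) :
    extInner x (y - z) = extInner x y - extInner x z := by simp [extInner]

lemma extInner_sub_left (x y z : ExteriorAlgebra ℂ K) :
    extInner (x - y) z = extInner x z - extInner y z := by simp [extInner]

lemma extInner_smul_right (c : ℂ) (x y : ExteriorAlgebra ℂ K) :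
    extInner x (c • y) = c * extInner x y := by simp [extInner]

lemma extInner_zero_left (y : ExteriorAlgebra ℂ K) : extInner 0 y = 0 := by simp [extInner]

lemma extInner_zero_right (x : ExteriorAlgebra ℂ K) : extInner x 0 = 0 := by simp [extInner]

lemma algebraMapInv_ι_mul (f : K) (y : ExteriorAlgebra ℂ K) :
    ExteriorAlgebra.algebraMapInv (ExteriorAlgebra.ι ℂ f * y) = 0 := by
  rw [map_mul]; simp [ExteriorAlgebra.algebraMapInv]

lemma extInner_contract (f : K) (x y : ExteriorAlgebra ℂ K) :
    extInner (contract f x) y = extInner x (ExteriorAlgebra.ι ℂ f * y) := by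
  induction x using ext_induction generalizing y with
  | h1 => rw [contract_one, extInner_zero_left, extInner_one, algebraMapInv_ι_mul]
  | hsmul c x hx => rw [map_smul, extInner_smul_left, extInner_smul_left, hx]
  | hadd x z hx hz => rw [map_add, extInner_add_left, extInner_add_left, hx, hz]
  | hι g x hx =>
    rw [contract_ι_mul, extInner_sub_left, extInner_smul_left, extInner_ι_mul, hx, extInner_ι_mul,
      contract_ι_mul, extInner_sub_right, extInner_smul_right, inner_conj_symm]

lemma extInner_conj_symm (x y : ExteriorAlgebra ℂ K) :
    conj (extInner y x) = extInner x y := by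
  induction x using ext_induction generalizing y with
  | h1 =>
    rw [extInner_one]
    induction y using ext_induction with
    | h1 => simp [extInner_one]
    | hsmul c y hy => rw [extInner_smul_left, map_mul, hy]; simp
    | hadd y z hy hz => rw [extInner_add_left, map_add, hy, hz, map_add]
    | hι f y hy => rw [extInner_ι_mul, contract_one, extInner_zero_right, algebraMapInv_ι_mul,
        map_zero]
  | hsmul c x hx => rw [extInner_smul_right, extInner_smul_left, map_mul, hx]
  | hadd x z hx hz => rw [extInner_add_right, extInner_add_left, map_add, hx, hz]
  | hι f x hx => rw [extInner_ι_mul, ← extInner_contract, hx]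

/-- The span of the products of the vectors of a list, in the order of the list. -/
def wedgeSpan : List K → Submodule ℂ (ExteriorAlgebra ℂ K)
  | [] => Submodule.span ℂ {1}
  | e :: l => wedgeSpan l ⊔ (wedgeSpan l).map (LinearMap.mulLeft ℂ (ExteriorAlgebra.ι ℂ e))

lemma mem_wedgeSpan_cons {e : K} {l : List K} {x : ExteriorAlgebra ℂ K} :
    x ∈ wedgeSpan (e :: l) ↔
      ∃ u ∈ wedgeSpan l, ∃ v ∈ wedgeSpan l, u + ExteriorAlgebra.ι ℂ e * v = x := by
  simp [wedgeSpan, Submodule.mem_sup]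

lemma one_mem_wedgeSpan (l : List K) : (1 : ExteriorAlgebra ℂ K) ∈ wedgeSpan l := by
  induction l with
  | nil => exact Submodule.mem_span_singleton_self _
  | cons e l ih => exact Submodule.mem_sup_left ih

lemma ι_mul_ι_mul_self (e : K) (x : ExteriorAlgebra ℂ K) :
    ExteriorAlgebra.ι ℂ e * (ExteriorAlgebra.ι ℂ e * x) = 0 := by
  rw [← mul_assoc, ExteriorAlgebra.ι_sq_zero, zero_mul]

lemma ι_mul_ι_mul_comm (e f : K) (x : ExteriorAlgebra ℂ K) :
    ExteriorAlgebra.ι ℂ e * (ExteriorAlgebra.ι ℂ f * x)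
      = - (ExteriorAlgebra.ι ℂ f * (ExteriorAlgebra.ι ℂ e * x)) := by
  rw [← mul_assoc, ← mul_assoc, eq_neg_iff_add_eq_zero, ← add_mul,
    ExteriorAlgebra.ι_add_mul_swap, zero_mul]

lemma ι_mul_mem_wedgeSpan {l : List K} {e : K} (he : e ∈ l) {x : ExteriorAlgebra ℂ K}
    (hx : x ∈ wedgeSpan l) : ExteriorAlgebra.ι ℂ e * x ∈ wedgeSpan l := by
  induction l generalizing x with
  | nil => simp at he
  | cons a l ih =>
    obtain ⟨u, hu, v, hv, rfl⟩ := mem_wedgeSpan_cons.1 hx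
    rw [mem_wedgeSpan_cons]
    rcases eq_or_ne e a with rfl | hea
    · exact ⟨0, Submodule.zero_mem _, u, hu, by rw [mul_add, ι_mul_ι_mul_self]; simp⟩
    · have he' : e ∈ l := by simpa [hea] using he
      exact ⟨_, ih he' hu, _, Submodule.neg_mem _ (ih he' hv), by
        rw [mul_add, ι_mul_ι_mul_comm e a, mul_neg]⟩

lemma ι_mul_mem_wedgeSpan_of_span {l : List K} {e : K} (he : e ∈ Submodule.span ℂ {v | v ∈ l})
    {x : ExteriorAlgebra ℂ K} (hx : x ∈ wedgeSpan l) :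
    ExteriorAlgebra.ι ℂ e * x ∈ wedgeSpan l := by
  induction he using Submodule.span_induction with
  | mem v hv => exact ι_mul_mem_wedgeSpan hv hx
  | zero => simp
  | add a b _ _ ha hb => rw [map_add, add_mul]; exact Submodule.add_mem _ ha hb
  | smul c a _ ha => rw [map_smul, smul_mul_assoc]; exact Submodule.smul_mem _ _ ha

lemma contract_wedgeSpan {l : List K} {e : K} (he : ∀ v ∈ l, inner ℂ e v = 0)
    {x : ExteriorAlgebra ℂ K} (hx : x ∈ wedgeSpan l) : contract e x = 0 := by
  induction l generalizing x with
  | nil =>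
    obtain ⟨c, rfl⟩ := Submodule.mem_span_singleton.1 hx
    rw [map_smul, contract_one, smul_zero]
  | cons a l ih =>
    obtain ⟨u, hu, v, hv, rfl⟩ := mem_wedgeSpan_cons.1 hx
    have he' : ∀ v ∈ l, inner ℂ e v = 0 := fun v hv => he v (List.mem_cons_of_mem _ hv)
    rw [map_add, contract_ι_mul, ih he' hu, ih he' hv, he a List.mem_cons_self]
    simp

lemma extInner_self_wedgeSpan {l : List K} (hn : ∀ v ∈ l, ‖v‖ = 1)
    (ho : l.Pairwise fun v w => inner ℂ v w = 0) {x : ExteriorAlgebra ℂ K}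
    (hx : x ∈ wedgeSpan l) :
    0 ≤ (extInner x x).re ∧ ((extInner x x).re = 0 → x = 0) := by
  induction l generalizing x with
  | nil =>
    obtain ⟨c, rfl⟩ := Submodule.mem_span_singleton.1 hx
    rw [extInner_smul_left, extInner_smul_right, extInner_one, map_one, mul_one, ← Complex.normSq_eq_conj_mul_self]
    refine ⟨by simpa using Complex.normSq_nonneg c, fun h => ?_⟩
    have : c = 0 := by simpa using h
    simp [this]
  | cons a l ih =>
    obtain ⟨u, hu, v, hv, rfl⟩ := mem_wedgeSpan_cons.1 hx
    rw [List.pairwise_cons] at ho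
    have hn' : ∀ v ∈ l, ‖v‖ = 1 := fun v hv => hn v (List.mem_cons_of_mem _ hv)
    have hau : contract a u = 0 := contract_wedgeSpan ho.1 hu
    have hav : contract a v = 0 := contract_wedgeSpan ho.1 hv
    have haa : inner ℂ a a = (1 : ℂ) := by
      rw [inner_self_eq_norm_sq_to_K, hn a List.mem_cons_self]; simp
    have key : extInner (u + ExteriorAlgebra.ι ℂ a * v) (u + ExteriorAlgebra.ι ℂ a * v)
        = extInner u u + extInner v v := by
      rw [extInner_add_left, extInner_add_right, ← extInner_contract, hau, extInner_zero_left,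
        extInner_ι_mul, map_add, hau, contract_ι_mul, hav, haa]
      simp
    have h1 := ih hn' ho.2 hu
    have h2 := ih hn' ho.2 hv
    rw [key, Complex.add_re]
    refine ⟨add_nonneg h1.1 h2.1, fun h => ?_⟩
    rw [h1.2 (by linarith [h1.1, h2.1]), h2.2 (by linarith [h1.1, h2.1])]
    simp

lemma exists_wedgeSpan (x : ExteriorAlgebra ℂ K) :
    ∃ W : Submodule ℂ K, FiniteDimensional ℂ W ∧
      ∀ l : List K, W ≤ Submodule.span ℂ {v | v ∈ l} → x ∈ wedgeSpan l := by
  induction x using ext_induction with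
  | h1 => exact ⟨⊥, inferInstance, fun l _ => one_mem_wedgeSpan l⟩
  | hsmul c x hx =>
    obtain ⟨W, hW, h⟩ := hx
    exact ⟨W, hW, fun l hl => Submodule.smul_mem _ _ (h l hl)⟩
  | hadd x y hx hy =>
    obtain ⟨W, hW, h⟩ := hx
    obtain ⟨W', hW', h'⟩ := hy
    exact ⟨W ⊔ W', inferInstance, fun l hl =>
      Submodule.add_mem _ (h l (le_sup_left.trans hl)) (h' l (le_sup_right.trans hl))⟩
  | hι f x hx =>
    obtain ⟨W, hW, h⟩ := hx
    exact ⟨W ⊔ Submodule.span ℂ {f}, inferInstance, fun l hl =>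
      ι_mul_mem_wedgeSpan_of_span
        (hl (Submodule.mem_sup_right (Submodule.mem_span_singleton_self f)))
        (h l (le_sup_left.trans hl))⟩

lemma extInner_self (x : ExteriorAlgebra ℂ K) :
    0 ≤ (extInner x x).re ∧ ((extInner x x).re = 0 → x = 0) := by
  obtain ⟨W, hW, h⟩ := exists_wedgeSpan x
  let b := stdOrthonormalBasis ℂ W
  let l : List K := List.ofFn fun i => (b i : K)
  have hl : {v | v ∈ l} = Set.range fun i => (b i : K) := by
    ext v; simp [l, List.mem_ofFn]
  refine extInner_self_wedgeSpan (l := l) ?_ ?_ (h l ?_)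
  · intro v hv
    obtain ⟨i, rfl⟩ := List.mem_ofFn.1 hv
    exact b.orthonormal.1 i
  · rw [List.pairwise_ofFn]
    intro i j hij
    exact b.orthonormal.2 hij.ne
  · rw [hl]
    have := b.toBasis.span_eq
    have h2 := congrArg (Submodule.map W.subtype) this
    rw [Submodule.map_span, Submodule.map_subtype_top, ← Set.range_comp] at h2
    exact h2.ge

instance : InnerProductSpace.Core ℂ (ExteriorAlgebra ℂ K) where
  inner := extInner
  conj_inner_symm := extInner_conj_symm
  re_inner_nonneg x := (extInner_self x).1
  add_left := extInner_add_left
  smul_left x y c := extInner_smul_left c x y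
  definite x hx := (extInner_self x).2 (by change extInner x x = 0 at hx; rw [hx]; rfl)

instance : NormedAddCommGroup (ExteriorAlgebra ℂ K) :=
  InnerProductSpace.Core.toNormedAddCommGroup (𝕜 := ℂ)

instance : InnerProductSpace ℂ (ExteriorAlgebra ℂ K) :=
  InnerProductSpace.ofCore _

lemma inner_eq_extInner (x y : ExteriorAlgebra ℂ K) : inner ℂ x y = extInner x y := rfl

end ExteriorAlgebra

section Dense

variable {A X G : Type*} [NormedAddCommGroup A] [InnerProductSpace ℂ A] [NormedAddCommGroup X]
  [InnerProductSpace ℂ X] [NormedAddCommGroup G] [InnerProductSpace ℂ G] {j : A →ₗᵢ[ℂ] X}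

/-- Two bounded operators agree if they agree on a dense subspace. -/
lemma dense_ext (hj : DenseRange j) {S T : X →L[ℂ] G} (h : ∀ x, S (j x) = T (j x)) : S = T :=
  DFunLike.coe_injective (hj.equalizer S.continuous T.continuous (funext h))

/-- Two bounded operators are adjoint if they are so on a dense subspace. -/
lemma dense_adjoint [CompleteSpace X] (hj : DenseRange j) {S T : X →L[ℂ] X} {S' T' : A → A}
    (hS : ∀ x, S (j x) = j (S' x)) (hT : ∀ x, T (j x) = j (T' x))
    (h : ∀ x y, inner ℂ (S' x) y = inner ℂ x (T' y)) : ContinuousLinearMap.adjoint S = T := by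
  symm
  rw [ContinuousLinearMap.eq_adjoint_iff]
  intro x y
  induction x, y using hj.induction_on₂ with
  | hp => exact isClosed_eq (by fun_prop) (by fun_prop)
  | h x y =>
    rw [hT, hS, LinearIsometry.inner_map_map, LinearIsometry.inner_map_map, ← inner_conj_symm, ← h,
      inner_conj_symm]

end Dense


/-! ### Fermionic Fock space -/

section Fock

variable {K : Type*} [NormedAddCommGroup K] [InnerProductSpace ℂ K]

/-- The fermionic Fock space `F(K)`: the Hilbert space completion of the exterior algebra of `K`. -/
def Fock (K : Type*) [NormedAddCommGroup K] [InnerProductSpace ℂ K] : Type _ :=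
  Completion (ExteriorAlgebra ℂ K)

instance : NormedAddCommGroup (Fock K) :=
  inferInstanceAs (NormedAddCommGroup (Completion (ExteriorAlgebra ℂ K)))

instance : InnerProductSpace ℂ (Fock K) :=
  inferInstanceAs (InnerProductSpace ℂ (Completion (ExteriorAlgebra ℂ K)))

instance : CompleteSpace (Fock K) :=
  inferInstanceAs (CompleteSpace (Completion (ExteriorAlgebra ℂ K)))

/-- The canonical isometric embedding of the exterior algebra in the Fock space. -/
def toFock : ExteriorAlgebra ℂ K →ₗᵢ[ℂ] Fock K :=
  (Completion.toComplₗᵢ : ExteriorAlgebra ℂ K →ₗᵢ[ℂ] Completion (ExteriorAlgebra ℂ K))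

lemma denseRange_toFock : DenseRange (toFock : ExteriorAlgebra ℂ K → Fock K) :=
  Completion.denseRange_coe

/-- The extension to `F(K)` of a bounded operator on the exterior algebra. -/
def fockExtend (S : ExteriorAlgebra ℂ K →L[ℂ] ExteriorAlgebra ℂ K) : Fock K →L[ℂ] Fock K :=
  (S.completion : Completion (ExteriorAlgebra ℂ K) →L[ℂ] Completion (ExteriorAlgebra ℂ K))

lemma fockExtend_toFock (S : ExteriorAlgebra ℂ K →L[ℂ] ExteriorAlgebra ℂ K)
    (x : ExteriorAlgebra ℂ K) : fockExtend S (toFock x) = toFock (S x) :=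
  ContinuousLinearMap.completion_apply_coe S x

lemma norm_sq_wedge_add (f : K) (x : ExteriorAlgebra ℂ K) :
    ‖ExteriorAlgebra.ι ℂ f * x‖ ^ 2 + ‖contract f x‖ ^ 2 = (‖f‖ * ‖x‖) ^ 2 := by
  have h : inner ℂ (ExteriorAlgebra.ι ℂ f * x) (ExteriorAlgebra.ι ℂ f * x)
      + inner ℂ (contract f x) (contract f x) = inner ℂ f f * inner ℂ x x := by
    simp only [inner_eq_extInner]
    rw [extInner_ι_mul, contract_ι_mul, extInner_sub_right, extInner_smul_right,
      extInner_contract]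
    ring
  simp only [inner_self_eq_norm_sq_to_K] at h
  rw [mul_pow]
  exact_mod_cast h

/-- Exterior multiplication by `f` as a bounded operator on the exterior algebra. -/
def wedgeOp (f : K) : ExteriorAlgebra ℂ K →L[ℂ] ExteriorAlgebra ℂ K :=
  (LinearMap.mulLeft ℂ (ExteriorAlgebra.ι ℂ f)).mkContinuous ‖f‖ fun x => by
    refine le_of_sq_le_sq ?_ (by positivity)
    rw [← norm_sq_wedge_add]
    simp only [LinearMap.mulLeft_apply]
    linarith [sq_nonneg ‖contract f x‖]

/-- Contraction with `f` as a bounded operator on the exterior algebra. -/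
def contractOp (f : K) : ExteriorAlgebra ℂ K →L[ℂ] ExteriorAlgebra ℂ K :=
  (contract f).mkContinuous ‖f‖ fun x => by
    refine le_of_sq_le_sq ?_ (by positivity)
    rw [← norm_sq_wedge_add]
    linarith [sq_nonneg ‖ExteriorAlgebra.ι ℂ f * x‖]

@[simp] lemma wedgeOp_apply (f : K) (x : ExteriorAlgebra ℂ K) :
    wedgeOp f x = ExteriorAlgebra.ι ℂ f * x := rfl

@[simp] lemma contractOp_apply (f : K) (x : ExteriorAlgebra ℂ K) :
    contractOp f x = contract f x := rfl

/-- The creation operators `a*(f)` on `F(K)`, complex linear in `f`: the extension of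
`x ↦ f ∧ x`. -/
def create : K →ₗ[ℂ] (Fock K →L[ℂ] Fock K) where
  toFun f := fockExtend (wedgeOp f)
  map_add' f g := dense_ext denseRange_toFock fun x => by
    simp [fockExtend_toFock, add_mul]
  map_smul' c f := dense_ext denseRange_toFock fun x => by
    simp [fockExtend_toFock]

/-- The annihilation operators `a(f)` on `F(K)`, conjugate-linear in `f`: the extension of
`x ↦ f ⌟ x`. -/
def annihilate : K →ₗ⋆[ℂ] (Fock K →L[ℂ] Fock K) where
  toFun f := fockExtend (contractOp f)
  map_add' f g := dense_ext denseRange_toFock fun x => by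
    simp [fockExtend_toFock, contract_add]
  map_smul' c f := dense_ext denseRange_toFock fun x => by
    simp [fockExtend_toFock, contract_smul]

@[simp] lemma create_toFock (f : K) (x : ExteriorAlgebra ℂ K) :
    create f (toFock x) = toFock (ExteriorAlgebra.ι ℂ f * x) := fockExtend_toFock _ _

@[simp] lemma annihilate_toFock (f : K) (x : ExteriorAlgebra ℂ K) :
    annihilate f (toFock x) = toFock (contract f x) := fockExtend_toFock _ _

lemma adjoint_create (f : K) : ContinuousLinearMap.adjoint (create f) = annihilate f :=
  dense_adjoint denseRange_toFock (create_toFock f) (annihilate_toFock f)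
    fun x y => extInner_ι_mul f x y

lemma adjoint_annihilate (f : K) : ContinuousLinearMap.adjoint (annihilate f) = create f := by
  rw [← adjoint_create, ContinuousLinearMap.adjoint_adjoint]

lemma create_mul_create (f g : K) : create f * create g + create g * create f = 0 :=
  dense_ext denseRange_toFock fun x => by
    simp only [add_apply, mul_apply_eq_comp, create_toFock, zero_apply, ← map_add]
    rw [ι_mul_ι_mul_comm, neg_add_cancel, map_zero]

lemma annihilate_mul_annihilate (f g : K) :
    annihilate f * annihilate g + annihilate g * annihilate f = 0 := by
  have h := congrArg ContinuousLinearMap.adjoint (create_mul_create f g)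
  rw [map_add, map_zero] at h
  rw [ContinuousLinearMap.mul_def, ContinuousLinearMap.mul_def, ContinuousLinearMap.adjoint_comp,
    ContinuousLinearMap.adjoint_comp, adjoint_create, adjoint_create] at h
  rw [add_comm]
  exact h

lemma annihilate_mul_create (f g : K) :
    annihilate f * create g + create g * annihilate f = (inner ℂ f g : ℂ) • 1 :=
  dense_ext denseRange_toFock fun x => by
    simp only [add_apply, mul_apply_eq_comp, create_toFock, annihilate_toFock, smul_apply,
      one_apply_eq_self, ← map_add, ← map_smul, contract_ι_mul, sub_add_cancel]

lemma involute_ι_mul (f : K) (x : ExteriorAlgebra ℂ K) :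
    CliffordAlgebra.involute (ExteriorAlgebra.ι ℂ f * x)
      = -(ExteriorAlgebra.ι ℂ f * CliffordAlgebra.involute x) := by
  rw [map_mul, ExteriorAlgebra.ι, CliffordAlgebra.involute_ι, neg_mul]

lemma contract_involute (f : K) (x : ExteriorAlgebra ℂ K) :
    contract f (CliffordAlgebra.involute x) = - CliffordAlgebra.involute (contract f x) := by
  induction x using ext_induction with
  | h1 => simp [contract_one]
  | hsmul c x hx => simp [hx]
  | hadd x y hx hy => rw [map_add, map_add, map_add, map_add, hx, hy, neg_add]
  | hι g x hx =>
    rw [involute_ι_mul, map_neg, contract_ι_mul, contract_ι_mul, hx, map_sub, involute_ι_mul,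
      map_smul]
    simp

lemma extInner_involute (x y : ExteriorAlgebra ℂ K) :
    extInner (CliffordAlgebra.involute x) y = extInner x (CliffordAlgebra.involute y) := by
  induction x using ext_induction generalizing y with
  | h1 =>
    rw [map_one, extInner_one, extInner_one]
    induction y using ext_induction with
    | h1 => simp
    | hsmul c y hy => rw [map_smul, map_smul, map_smul, hy]
    | hadd y z hy hz => rw [map_add, map_add, map_add, hy, hz]
    | hι f y hy => rw [involute_ι_mul, map_neg, algebraMapInv_ι_mul, algebraMapInv_ι_mul, neg_zero]
  | hsmul c x hx => rw [map_smul, extInner_smul_left, extInner_smul_left, hx]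
  | hadd x z hx hz => rw [map_add, extInner_add_left, extInner_add_left, hx, hz]
  | hι f x hx =>
    rw [involute_ι_mul, extInner_ι_mul, contract_involute, ← neg_one_smul ℂ, extInner_smul_left,
      extInner_ι_mul, hx, ← neg_one_smul ℂ (_ : ExteriorAlgebra ℂ K), extInner_smul_right]
    simp

lemma norm_involute (x : ExteriorAlgebra ℂ K) :
    ‖(CliffordAlgebra.involute x : ExteriorAlgebra ℂ K)‖ = ‖x‖ := by
  have h : (inner ℂ (CliffordAlgebra.involute x : ExteriorAlgebra ℂ K)
      (CliffordAlgebra.involute x : ExteriorAlgebra ℂ K) : ℂ) = inner ℂ x x := by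
    rw [inner_eq_extInner, inner_eq_extInner, extInner_involute, CliffordAlgebra.involute_involute]
  rw [@norm_eq_sqrt_re_inner ℂ, h, ← @norm_eq_sqrt_re_inner ℂ]

/-- The parity involution of the exterior algebra, as a bounded operator. -/
def parityOp : ExteriorAlgebra ℂ K →L[ℂ] ExteriorAlgebra ℂ K :=
  (CliffordAlgebra.involute (Q := (0 : QuadraticForm ℂ K))).toLinearMap.mkContinuous 1 fun x => by
    rw [one_mul]; exact (norm_involute x).le

/-- The parity operator `Γ` on `F(K)`, equal to `(-1)^n` on the `n`-th exterior power. -/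
def parity (K : Type*) [NormedAddCommGroup K] [InnerProductSpace ℂ K] : Fock K →L[ℂ] Fock K :=
  fockExtend parityOp

@[simp] lemma parity_toFock (x : ExteriorAlgebra ℂ K) :
    parity K (toFock x) = toFock (CliffordAlgebra.involute x) := fockExtend_toFock _ _

lemma adjoint_parity : ContinuousLinearMap.adjoint (parity K) = parity K :=
  dense_adjoint denseRange_toFock parity_toFock parity_toFock fun x y => extInner_involute x y

lemma parity_mul_parity : parity K * parity K = 1 :=
  dense_ext denseRange_toFock fun x => by
    simp only [mul_apply_eq_comp, parity_toFock, CliffordAlgebra.involute_involute,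
      one_apply_eq_self]

lemma parity_mul_create (f : K) : parity K * create f = -(create f * parity K) :=
  dense_ext denseRange_toFock fun x => by
    simp only [mul_apply_eq_comp, create_toFock, parity_toFock, involute_ι_mul, neg_apply, map_neg]

lemma parity_mul_annihilate (f : K) : parity K * annihilate f = -(annihilate f * parity K) :=
  dense_ext denseRange_toFock fun x => by
    simp only [mul_apply_eq_comp, annihilate_toFock, parity_toFock, contract_involute, neg_apply,
      map_neg, neg_neg]

end Fock

/-! ### Hilbert space tensor products -/

section HilbertTensor

/-- The Hilbert space tensor product: the completion of the algebraic tensor product. -/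
def HilbertTensor (E G : Type*) [NormedAddCommGroup E] [InnerProductSpace ℂ E]
    [NormedAddCommGroup G] [InnerProductSpace ℂ G] : Type _ :=
  Completion (E ⊗[ℂ] G)

variable {E G : Type*} [NormedAddCommGroup E] [InnerProductSpace ℂ E]
    [NormedAddCommGroup G] [InnerProductSpace ℂ G]

instance : NormedAddCommGroup (HilbertTensor E G) :=
  inferInstanceAs (NormedAddCommGroup (Completion (E ⊗[ℂ] G)))

instance : InnerProductSpace ℂ (HilbertTensor E G) :=
  inferInstanceAs (InnerProductSpace ℂ (Completion (E ⊗[ℂ] G)))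

instance : CompleteSpace (HilbertTensor E G) :=
  inferInstanceAs (CompleteSpace (Completion (E ⊗[ℂ] G)))

/-- The canonical isometric embedding of the algebraic tensor product. -/
def toHilbertTensor : E ⊗[ℂ] G →ₗᵢ[ℂ] HilbertTensor E G :=
  (Completion.toComplₗᵢ : E ⊗[ℂ] G →ₗᵢ[ℂ] Completion (E ⊗[ℂ] G))

lemma denseRange_toHilbertTensor :
    DenseRange (toHilbertTensor : E ⊗[ℂ] G → HilbertTensor E G) :=
  Completion.denseRange_coe

/-- The bounded operator `S ⊗ T` on the Hilbert space tensor product. -/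
def tensorOp (S : E →L[ℂ] E) (T : G →L[ℂ] G) : HilbertTensor E G →L[ℂ] HilbertTensor E G :=
  ((TensorProduct.mapL S T).completion : Completion (E ⊗[ℂ] G) →L[ℂ] Completion (E ⊗[ℂ] G))

lemma tensorOp_apply (S : E →L[ℂ] E) (T : G →L[ℂ] G) (x : E ⊗[ℂ] G) :
    tensorOp S T (toHilbertTensor x) = toHilbertTensor (TensorProduct.mapL S T x) :=
  ContinuousLinearMap.completion_apply_coe (TensorProduct.mapL S T) x

lemma tensorOp_mul (S S' : E →L[ℂ] E) (T T' : G →L[ℂ] G) :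
    tensorOp S T * tensorOp S' T' = tensorOp (S * S') (T * T') :=
  dense_ext denseRange_toHilbertTensor fun x => by
    simp only [tensorOp_apply, mul_apply_eq_comp, TensorProduct.mapL_mul]

lemma tensorOp_add_left (S S' : E →L[ℂ] E) (T : G →L[ℂ] G) :
    tensorOp (S + S') T = tensorOp S T + tensorOp S' T :=
  dense_ext denseRange_toHilbertTensor fun x => by
    simp only [tensorOp_apply, add_apply, TensorProduct.mapL_add_left, map_add]

lemma tensorOp_add_right (S : E →L[ℂ] E) (T T' : G →L[ℂ] G) :
    tensorOp S (T + T') = tensorOp S T + tensorOp S T' :=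
  dense_ext denseRange_toHilbertTensor fun x => by
    simp only [tensorOp_apply, add_apply, TensorProduct.mapL_add_right, map_add]

lemma tensorOp_smul_left (c : ℂ) (S : E →L[ℂ] E) (T : G →L[ℂ] G) :
    tensorOp (c • S) T = c • tensorOp S T :=
  dense_ext denseRange_toHilbertTensor fun x => by
    simp only [tensorOp_apply, smul_apply, TensorProduct.mapL_smul_left, map_smul]

lemma tensorOp_smul_right (c : ℂ) (S : E →L[ℂ] E) (T : G →L[ℂ] G) :
    tensorOp S (c • T) = c • tensorOp S T :=
  dense_ext denseRange_toHilbertTensor fun x => by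
    simp only [tensorOp_apply, smul_apply, TensorProduct.mapL_smul_right, map_smul]

lemma tensorOp_zero_left (T : G →L[ℂ] G) : tensorOp (0 : E →L[ℂ] E) T = 0 := by
  simpa using tensorOp_smul_left 0 (0 : E →L[ℂ] E) T

lemma tensorOp_zero_right (S : E →L[ℂ] E) : tensorOp S (0 : G →L[ℂ] G) = 0 := by
  simpa using tensorOp_smul_right 0 S (0 : G →L[ℂ] G)

lemma tensorOp_neg_left (S : E →L[ℂ] E) (T : G →L[ℂ] G) : tensorOp (-S) T = -tensorOp S T := by
  rw [← neg_one_smul ℂ S, tensorOp_smul_left, neg_one_smul]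

lemma tensorOp_one_one : tensorOp (1 : E →L[ℂ] E) (1 : G →L[ℂ] G) = 1 :=
  dense_ext denseRange_toHilbertTensor fun x => by
    rw [tensorOp_apply, one_apply_eq_self]
    congr 1
    exact congrArg (fun A : (E ⊗[ℂ] G) →L[ℂ] (E ⊗[ℂ] G) => A x) TensorProduct.mapL_id_id

lemma adjoint_tensorOp [CompleteSpace E] [CompleteSpace G] (S : E →L[ℂ] E) (T : G →L[ℂ] G) :
    ContinuousLinearMap.adjoint (tensorOp S T)
      = tensorOp (ContinuousLinearMap.adjoint S) (ContinuousLinearMap.adjoint T) := by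
  refine dense_adjoint denseRange_toHilbertTensor (tensorOp_apply _ _) (tensorOp_apply _ _)
    fun x y => ?_
  induction x using TensorProduct.induction_on with
  | zero => simp
  | add x x' hx hx' => rw [map_add, inner_add_left, inner_add_left, hx, hx']
  | tmul a b =>
    induction y using TensorProduct.induction_on with
    | zero => simp
    | add y y' hy hy' => rw [map_add, inner_add_right, inner_add_right, hy, hy']
    | tmul c d =>
      rw [TensorProduct.mapL_tmul, TensorProduct.mapL_tmul, TensorProduct.inner_tmul,
        TensorProduct.inner_tmul, ContinuousLinearMap.adjoint_inner_right,
        ContinuousLinearMap.adjoint_inner_right]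

/-- If `c, c'` anticommute with `Γ` and `Γ² = 1`, the anticommutator of two operators of the form
`c ⊗ 1 + Γ ⊗ d` is `{c, c'} ⊗ 1 + 1 ⊗ {d, d'}`. -/
lemma anticomm_tensorOp {c c' Γ : E →L[ℂ] E} {d d' : G →L[ℂ] G} (hc : Γ * c = -(c * Γ))
    (hc' : Γ * c' = -(c' * Γ)) (hΓ : Γ * Γ = 1) :
    (tensorOp c 1 + tensorOp Γ d) * (tensorOp c' 1 + tensorOp Γ d')
      + (tensorOp c' 1 + tensorOp Γ d') * (tensorOp c 1 + tensorOp Γ d)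
      = tensorOp (c * c' + c' * c) 1 + tensorOp 1 (d * d' + d' * d) := by
  simp only [mul_add, add_mul, tensorOp_mul, hc, hc', hΓ, one_mul, mul_one, tensorOp_add_left,
    tensorOp_add_right, tensorOp_neg_left]
  abel

end HilbertTensor

/-! ### Quasi-free representations of the CAR algebra -/

/-- A representation of the CAR algebra over `H` on the Hilbert space `F`, given by the images
`a*(f)` of the creation generators: these are complex linear in `f`, and together with their
adjoints `a(f)` they satisfy the canonical anticommutation relations. (The CAR algebra is the
universal C*-algebra generated by such elements, so a *-representation of it is the same thing.) -/
structure CARRep (H F : Type*) [NormedAddCommGroup H] [InnerProductSpace ℂ H]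
    [NormedAddCommGroup F] [InnerProductSpace ℂ F] [CompleteSpace F] where
  creation : H →ₗ[ℂ] (F →L[ℂ] F)
  creation_creation : ∀ f g, creation f * creation g + creation g * creation f = 0
  adjoint_creation : ∀ f g,
    ContinuousLinearMap.adjoint (creation f) * creation g
      + creation g * ContinuousLinearMap.adjoint (creation f) = (inner ℂ f g : ℂ) • 1

section Mixed

variable {K L : Type*} [NormedAddCommGroup K] [InnerProductSpace ℂ K] [NormedAddCommGroup L]
  [InnerProductSpace ℂ L]

/-- The operator `a*(f) ⊗ 1 + Γ ⊗ a(ḡ)` on `F(K) ⊗ F(L̄)`, for `f ∈ K` and `g ∈ L`. -/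
def mixedCreation (f : K) (g : L) :
    HilbertTensor (Fock K) (Fock (ConjSpace L)) →L[ℂ] HilbertTensor (Fock K) (Fock (ConjSpace L)) :=
  tensorOp (create f) 1 + tensorOp (parity K) (annihilate (toConj g))

lemma mixedCreation_add (f f' : K) (g g' : L) :
    mixedCreation (f + f') (g + g') = mixedCreation f g + mixedCreation f' g' := by
  unfold mixedCreation
  rw [map_add, map_add, map_add, tensorOp_add_left, tensorOp_add_right]
  abel

lemma mixedCreation_smul (c : ℂ) (f : K) (g : L) :
    mixedCreation (c • f) (c • g) = c • mixedCreation f g := by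
  unfold mixedCreation
  rw [map_smul, map_smulₛₗ, map_smulₛₗ, Complex.conj_conj, tensorOp_smul_left,
    tensorOp_smul_right, smul_add]

lemma adjoint_mixedCreation (f : K) (g : L) :
    ContinuousLinearMap.adjoint (mixedCreation f g)
      = tensorOp (annihilate f) 1 + tensorOp (parity K) (create (toConj g)) := by
  unfold mixedCreation
  rw [map_add, adjoint_tensorOp, adjoint_tensorOp, adjoint_create, adjoint_parity,
    adjoint_annihilate]
  congr 2
  exact ContinuousLinearMap.adjoint_id

lemma mixedCreation_anticomm (f f' : K) (g g' : L) :
    mixedCreation f g * mixedCreation f' g' + mixedCreation f' g' * mixedCreation f g = 0 := by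
  refine (anticomm_tensorOp (parity_mul_create _) (parity_mul_create _)
    parity_mul_parity).trans ?_
  rw [create_mul_create, annihilate_mul_annihilate, tensorOp_zero_left, tensorOp_zero_right,
    add_zero]

lemma adjoint_mixedCreation_anticomm (f f' : K) (g g' : L) :
    ContinuousLinearMap.adjoint (mixedCreation f g) * mixedCreation f' g'
      + mixedCreation f' g' * ContinuousLinearMap.adjoint (mixedCreation f g)
      = (inner ℂ f f' + inner ℂ g g' : ℂ) • 1 := by
  rw [adjoint_mixedCreation]
  refine (anticomm_tensorOp (parity_mul_annihilate _) (parity_mul_create _)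
    parity_mul_parity).trans ?_
  rw [annihilate_mul_create, add_comm (create _ * annihilate _), annihilate_mul_create,
    tensorOp_smul_left, tensorOp_smul_right, tensorOp_one_one, ← add_smul]
  rfl

end Mixed

section QuasiFree

variable {H : Type*} [NormedAddCommGroup H] [InnerProductSpace ℂ H]

/-- The fermionic Fock space `F_P(H) = F(PH) ⊗ F(conj ((1 - P)H))` of the orthogonal
projection `P` with range `W`. -/
abbrev PolFock (W : Submodule ℂ H) : Type _ := HilbertTensor (Fock W) (Fock (ConjSpace Wᗮ))

/-- The quasi-free representation of the CAR algebra on `F_P(H)`, where `P` is the orthogonal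
projection onto `W`: it sends `a*(f)` to `a*(P f) ⊗ 1 + Γ ⊗ a(conj ((1 - P) f))`. -/
def quasiFree (W : Submodule ℂ H) [W.HasOrthogonalProjection] : CARRep H (PolFock W) where
  creation :=
    { toFun := fun f =>
        mixedCreation (W.orthogonalProjectionOnto f) (Wᗮ.orthogonalProjectionOnto f)
      map_add' := fun f g => by rw [map_add, map_add, mixedCreation_add]
      map_smul' := fun c f => by rw [map_smul, map_smul, mixedCreation_smul, RingHom.id_apply] }
  creation_creation _ _ := mixedCreation_anticomm _ _ _ _
  adjoint_creation f g := by
    refine (adjoint_mixedCreation_anticomm _ _ _ _).trans ?_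
    congr 1
    rw [Submodule.inner_orthogonalProjectionOnto_eq_of_mem_right,
      Submodule.inner_orthogonalProjectionOnto_eq_of_mem_right, ← inner_add_right]
    congr 1
    exact W.starProjection_add_starProjection_orthogonal g

/-- The vacuum vector `1 ⊗ 1` of `F_P(H)`. -/
def vacuum (W : Submodule ℂ H) : PolFock W := toHilbertTensor (toFock 1 ⊗ₜ[ℂ] toFock 1)

end QuasiFree

/-! ### Unbounded operators -/

section Unbounded

variable {H : Type*} [NormedAddCommGroup H] [InnerProductSpace ℂ H]

/-- `R` is the resolvent `(D - z)⁻¹` of the unbounded operator `D`: a bounded everywhere defined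
two-sided inverse of `D - z : dom D → H`. -/
def IsResolventAt (D : H →ₗ.[ℂ] H) (z : ℂ) (R : H →L[ℂ] H) : Prop :=
  (∀ v : H, ∃ h : R v ∈ D.domain, D ⟨R v, h⟩ - z • R v = v) ∧
    ∀ u : D.domain, R (D u - z • (u : H)) = u

/-- The spectrum of an unbounded operator. -/
def opSpectrum (D : H →ₗ.[ℂ] H) : Set ℂ := {z | ¬ ∃ R : H →L[ℂ] H, IsResolventAt D z R}

/-- The operator `D` has compact resolvent. -/
def HasCompactResolvent (D : H →ₗ.[ℂ] H) : Prop :=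
  ∃ (z : ℂ) (R : H →L[ℂ] H), IsResolventAt D z R ∧ IsCompactOperator R

/-- The family `x ↦ D x` is continuous in the norm resolvent sense:
the resolvents `(D x - i)⁻¹` depend norm continuously on `x`. -/
def NormResolventContinuous {M : Type*} [TopologicalSpace M] (D : M → H →ₗ.[ℂ] H) : Prop :=
  ∃ R : M → H →L[ℂ] H, Continuous R ∧ ∀ x, IsResolventAt (D x) Complex.I (R x)

/-- The closed subspace `P H`, for `P` the orthogonal projection onto the span of the eigenspaces of
`D` for (real) eigenvalues greater than `lam`. -/
def upperSpace (D : H →ₗ.[ℂ] H) (lam : ℝ) : Submodule ℂ H :=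
  (Submodule.span ℂ {v : H | ∃ μ : ℝ, lam < μ ∧ ∃ h : v ∈ D.domain,
    D ⟨v, h⟩ = (μ : ℂ) • v}).topologicalClosure

instance [CompleteSpace H] (D : H →ₗ.[ℂ] H) (lam : ℝ) :
    (upperSpace D lam).HasOrthogonalProjection :=
  inferInstanceAs (Submodule.topologicalClosure _).HasOrthogonalProjection

/-- The range `W ⊖ W'` of the difference `P - Q` of the projections onto `W` and `W' ≤ W`. -/
abbrev gapSpace (W W' : Submodule ℂ H) : Submodule ℂ H := W ⊓ W'ᗮ

end Unbounded

/-! ### Čech cohomology of a cover with values in the sheaf of circle-valued functions -/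

section Cech

variable {M ι : Type*} (U : ι → Set M)

lemma face_subset {p : ℕ} (s : Fin (p + 2) → ι) (a : Fin (p + 2)) :
    (⋂ b, U (s b)) ⊆ ⋂ b : Fin (p + 1), U (s (a.succAbove b)) :=
  fun _ hx => Set.mem_iInter.2 fun b => Set.mem_iInter.1 hx (a.succAbove b)

variable [TopologicalSpace M]

/-- The group `C^p(U, S¹)` of Čech cochains: families of continuous functions
`U_{i₀} ∩ ⋯ ∩ U_{iₚ} → S¹`, indexed by all `(i₀, …, iₚ)`. -/
abbrev CechCochain (p : ℕ) : Type _ :=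
  ∀ s : Fin (p + 1) → ι, C(↥(⋂ a, U (s a)), Circle)

/-- The Čech coboundary, `(δ f)_{i₀ … iₚ₊₁} = ∏ₐ (f_{i₀ … îₐ … iₚ₊₁})^((-1)^a)`, restricted to
`U_{i₀} ∩ ⋯ ∩ U_{iₚ₊₁}`. -/
def cechDelta (p : ℕ) : CechCochain U p →* CechCochain U (p + 1) where
  toFun f s := ∏ a : Fin (p + 2),
    ((f fun b => s (a.succAbove b)).comp (ContinuousMap.inclusion (face_subset U s a)))
      ^ ((-1 : ℤ) ^ (a : ℕ))
  map_one' := by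
    funext s
    refine Finset.prod_eq_one fun a _ => ?_
    have : (ContinuousMap.comp ((1 : CechCochain U p) fun b => s (a.succAbove b))
      (ContinuousMap.inclusion (face_subset U s a))) = 1 := rfl
    rw [this, one_zpow]
  map_mul' f g := by
    funext s
    rw [Pi.mul_apply, ← Finset.prod_mul_distrib]
    refine Finset.prod_congr rfl fun a _ => ?_
    rw [← mul_zpow]
    rfl

/-- The group of Čech cocycles `Z^p(U, S¹)`. -/
abbrev cechCocycles (p : ℕ) : Subgroup (CechCochain U p) := (cechDelta U p).ker

/-- The Čech cohomology group `H^(p+1)(U, S¹)` of the cover, in positive degree: cocycles modulo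
coboundaries. -/
abbrev CechCohomology (p : ℕ) : Type _ :=
  ↥(cechCocycles U (p + 1)) ⧸ (cechDelta U p).range.subgroupOf (cechCocycles U (p + 1))

end Cech

/-! ### Intertwining operators over a cover -/

section Gerbe

variable {H : Type*} [NormedAddCommGroup H] [InnerProductSpace ℂ H] [CompleteSpace H]
variable {M ι : Type*} [TopologicalSpace M] (D : M → H →ₗ.[ℂ] H) (U : ι → Set M) (lam : ι → ℝ)

/-- The range `P_{U_i}(x) H` of the spectral projection attached to `U_i` at `x`. -/
abbrev polSpace (i : ι) (x : M) : Submodule ℂ H := upperSpace (D x) (lam i)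

/-- The finite-dimensional difference `H_{i,j}(x) = (P_{U_i}(x) - P_{U_j}(x)) H`,
for `lam i ≤ lam j`. -/
abbrev diffSpace (i j : ι) (x : M) : Submodule ℂ H :=
  gapSpace (polSpace D lam i x) (polSpace D lam j x)

/-- A continuous choice of volume elements: for `lam i ≤ lam j`, a unit vector `ω_{ij}(x)` of the
top exterior power of `H_{i,j}(x)` for each `x ∈ U_i ∩ U_j`, continuous in `x` as an element of the
exterior algebra of `H`. If `lam i = lam j` then `H_{i,j}(x) = 0`, the top exterior power is `ℂ`, and
we require `ω_{ij}(x) ω_{ji}(x) = 1`. -/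
structure VolumeChoice where
  vol : ∀ i j, lam i ≤ lam j → ∀ x, x ∈ U i → x ∈ U j → ExteriorAlgebra ℂ (diffSpace D lam i j x)
  mem_top : ∀ i j h x hi hj,
    vol i j h x hi hj ∈ ⋀[ℂ]^(Module.finrank ℂ (diffSpace D lam i j x)) (diffSpace D lam i j x)
  norm_vol : ∀ i j h x hi hj, ‖vol i j h x hi hj‖ = 1
  continuous_vol : ∀ i j h, Continuous fun x : ↥(U i ∩ U j) =>
    ExteriorAlgebra.map (diffSpace D lam i j x).subtype (vol i j h x x.2.1 x.2.2)
  vol_mul_vol : ∀ i j (h : lam i = lam j) x hi hj,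
    ExteriorAlgebra.map (diffSpace D lam i j x).subtype (vol i j h.le x hi hj)
      * ExteriorAlgebra.map (diffSpace D lam j i x).subtype (vol j i h.ge x hj hi) = 1

/-- Families of unitary operators `S i j x = S_{P_{U_i}(x), P_{U_j}(x)}` from the Fock space of
`P_{U_j}(x)` to the Fock space of `P_{U_i}(x)`, for `x ∈ U_i ∩ U_j`. -/
abbrev UnitaryFamily : Type _ :=
  ∀ i j x, x ∈ U i → x ∈ U j → PolFock (polSpace D lam j x) ≃ₗᵢ[ℂ] PolFock (polSpace D lam i x)

variable {D U lam}

/-- `S` is the family of intertwining operators determined by the volume elements `ω_{ij}` of `w`: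
`S i j x` intertwines the quasi-free representations, `S j i x` is the inverse of `S i j x`, and
for `lam i ≤ lam j` the operator `S j i x` sends `ω_{ij}(x) ⊗ 1 ∈ F(P_{U_i}(x) H) ⊗ 1`
to the vacuum vector. -/
structure IsIntertwinerFamily (w : VolumeChoice D U lam) (S : UnitaryFamily D U lam) : Prop where
  intertwines : ∀ i j x hi hj f v,
    S i j x hi hj ((quasiFree (polSpace D lam j x)).creation f v)
      = (quasiFree (polSpace D lam i x)).creation f (S i j x hi hj v)
  inverse : ∀ i j x hi hj, S j i x hj hi = (S i j x hi hj).symm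
  map_vol : ∀ i j h x hi hj,
    S j i x hj hi (toHilbertTensor
      (toFock (ExteriorAlgebra.map (Submodule.inclusion inf_le_left) (w.vol i j h x hi hj))
        ⊗ₜ[ℂ] toFock 1)) = vacuum (polSpace D lam j x)

/-- The cochain `g` consists of the scalars by which the triple compositions of the operators `S`
act: `S_{P_j, P_i} ∘ S_{P_i, P_k} ∘ S_{P_k, P_j} = g(U_i, U_j, U_k)(x) · 1` for
`x ∈ U_i ∩ U_j ∩ U_k`. -/
def IsTripleScalar (S : UnitaryFamily D U lam) (g : CechCochain U 2) : Prop :=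
  ∀ (s : Fin 3 → ι) (x : ↥(⋂ a, U (s a))) (v : PolFock (polSpace D lam (s 1) x)),
    S (s 1) (s 0) x (Set.mem_iInter.1 x.2 1) (Set.mem_iInter.1 x.2 0)
      (S (s 0) (s 2) x (Set.mem_iInter.1 x.2 0) (Set.mem_iInter.1 x.2 2)
        (S (s 2) (s 1) x (Set.mem_iInter.1 x.2 2) (Set.mem_iInter.1 x.2 1) v))
      = (g s x : ℂ) • v

end Gerbe

end IndexGerbe

end

open IndexGerbe
open scoped Manifold ContDiff

noncomputable section

open scoped InnerProductSpace TensorProduct ComplexConjugate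
open UniformSpace

namespace IndexGerbe

/-! ### Functoriality of the exterior algebra under isometries -/

section Map

variable {K K' : Type*} [NormedAddCommGroup K] [InnerProductSpace ℂ K] [NormedAddCommGroup K']
  [InnerProductSpace ℂ K'] {L : K →ₗ[ℂ] K'}

lemma contract_map (hL : ∀ v w, inner ℂ (L v) (L w) = inner ℂ v w) (f : K)
    (x : ExteriorAlgebra ℂ K) :
    contract (L f) (ExteriorAlgebra.map L x) = ExteriorAlgebra.map L (contract f x) := by
  induction x using ext_induction with
  | h1 => rw [map_one, contract_one, contract_one, map_zero]
  | hsmul c x hx => rw [map_smul, map_smul, map_smul, map_smul, hx]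
  | hadd x y hx hy => rw [map_add, map_add, map_add, map_add, hx, hy]
  | hι g x hx =>
    rw [map_mul, ExteriorAlgebra.map_apply_ι, contract_ι_mul, contract_ι_mul, hx, hL, map_sub,
      map_smul, map_mul, ExteriorAlgebra.map_apply_ι]

lemma algebraMapInv_map (x : ExteriorAlgebra ℂ K) :
    ExteriorAlgebra.algebraMapInv (ExteriorAlgebra.map L x) = ExteriorAlgebra.algebraMapInv x := by
  induction x using ext_induction with
  | h1 => simp
  | hsmul c x hx => rw [map_smul, map_smul, map_smul, hx]
  | hadd x y hx hy => rw [map_add, map_add, map_add, hx, hy]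
  | hι f x hx => rw [map_mul, ExteriorAlgebra.map_apply_ι, algebraMapInv_ι_mul, algebraMapInv_ι_mul]

/-- Contraction is adjoint to exterior multiplication and is natural for isometries. Applied to
subspace inclusions, this allows elements over varying subspaces to be compared in the one exterior
algebra of `H`. -/
lemma inner_map (hL : ∀ v w, inner ℂ (L v) (L w) = inner ℂ v w) (x y : ExteriorAlgebra ℂ K) :
    inner ℂ (ExteriorAlgebra.map L x) (ExteriorAlgebra.map L y) = inner ℂ x y := by
  simp only [inner_eq_extInner]
  induction x using ext_induction generalizing y with
  | h1 => rw [map_one, extInner_one, extInner_one, algebraMapInv_map]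
  | hsmul c x hx => rw [map_smul, extInner_smul_left, extInner_smul_left, hx]
  | hadd x z hx hz => rw [map_add, extInner_add_left, extInner_add_left, hx, hz]
  | hι f x hx =>
    rw [map_mul, ExteriorAlgebra.map_apply_ι, extInner_ι_mul, extInner_ι_mul, contract_map hL, hx]

lemma norm_map (hL : ∀ v w, inner ℂ (L v) (L w) = inner ℂ v w) (x : ExteriorAlgebra ℂ K) :
    ‖ExteriorAlgebra.map L x‖ = ‖x‖ := by
  rw [@norm_eq_sqrt_re_inner ℂ, inner_map hL, ← @norm_eq_sqrt_re_inner ℂ]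

lemma norm_one_exterior : ‖(1 : ExteriorAlgebra ℂ K)‖ = 1 := by
  rw [@norm_eq_sqrt_re_inner ℂ, inner_eq_extInner, extInner_one]
  simp

end Map

/-! ### Vectors of the polarised Fock space -/

section PolVec

variable {H : Type*} [NormedAddCommGroup H] [InnerProductSpace ℂ H] (W : Submodule ℂ H)

/-- The vector `x ⊗ y` of the polarised Fock space. -/
def polVec : ExteriorAlgebra ℂ W →ₗ[ℂ] ExteriorAlgebra ℂ (ConjSpace Wᗮ) →ₗ[ℂ] PolFock W :=
  LinearMap.mk₂ ℂ (fun x y => toHilbertTensor (toFock x ⊗ₜ[ℂ] toFock y))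
    (fun x x' y => by simp only [map_add, TensorProduct.add_tmul])
    (fun c x y => by rw [map_smul, ← TensorProduct.smul_tmul', map_smul])
    (fun x y y' => by simp only [map_add, TensorProduct.tmul_add])
    (fun c x y => by simp only [map_smul, TensorProduct.tmul_smul])

lemma polVec_apply (x : ExteriorAlgebra ℂ W) (y : ExteriorAlgebra ℂ (ConjSpace Wᗮ)) :
    polVec W x y = toHilbertTensor (toFock x ⊗ₜ[ℂ] toFock y) := rfl

lemma vacuum_eq_polVec : vacuum W = polVec W 1 1 := rfl

lemma inner_polVec (x x' : ExteriorAlgebra ℂ W) (y y' : ExteriorAlgebra ℂ (ConjSpace Wᗮ)) :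
    inner ℂ (polVec W x y) (polVec W x' y') = inner ℂ x x' * inner ℂ y y' := by
  rw [polVec_apply, polVec_apply, LinearIsometry.inner_map_map, TensorProduct.inner_tmul,
    LinearIsometry.inner_map_map, LinearIsometry.inner_map_map]

lemma norm_polVec (x : ExteriorAlgebra ℂ W) (y : ExteriorAlgebra ℂ (ConjSpace Wᗮ)) :
    ‖polVec W x y‖ = ‖x‖ * ‖y‖ := by
  rw [polVec_apply, LinearIsometry.norm_map, TensorProduct.norm_tmul, LinearIsometry.norm_map,
    LinearIsometry.norm_map]

lemma norm_vacuum : ‖vacuum W‖ = 1 := by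
  rw [vacuum_eq_polVec, norm_polVec, norm_one_exterior, norm_one_exterior, one_mul]

/-- The isometric embedding of the algebraic tensor product of exterior algebras. -/
def polEmb : ExteriorAlgebra ℂ W ⊗[ℂ] ExteriorAlgebra ℂ (ConjSpace Wᗮ) →ₗ[ℂ] PolFock W :=
  TensorProduct.lift (polVec W)

lemma polEmb_tmul (x : ExteriorAlgebra ℂ W) (y : ExteriorAlgebra ℂ (ConjSpace Wᗮ)) :
    polEmb W (x ⊗ₜ[ℂ] y) = polVec W x y := TensorProduct.lift.tmul _ _

/-- The continuous bilinear map `(a, b) ↦ a ⊗ b` into the Hilbert tensor product. -/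
def tmulL (E G : Type*) [NormedAddCommGroup E] [InnerProductSpace ℂ E] [NormedAddCommGroup G]
    [InnerProductSpace ℂ G] : E →L[ℂ] G →L[ℂ] HilbertTensor E G :=
  LinearMap.mkContinuous₂ ((TensorProduct.mk ℂ E G).compr₂ toHilbertTensor.toLinearMap) 1
    fun x y => by
      change ‖toHilbertTensor (x ⊗ₜ[ℂ] y)‖ ≤ _
      rw [LinearIsometry.norm_map, TensorProduct.norm_tmul, one_mul]

/-- A closed subspace containing all the vectors `x ⊗ y` is everything. -/
lemma mem_of_polVec_mem {N : Submodule ℂ (PolFock W)} (hN : IsClosed (N : Set (PolFock W)))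
    (h : ∀ x y, polVec W x y ∈ N) (v : PolFock W) : v ∈ N := by
  have h1 : ∀ (a : Fock W) (b : Fock (ConjSpace Wᗮ)), tmulL _ _ a b ∈ N := by
    intro a b
    induction b using denseRange_toFock.induction_on with
    | hp => exact hN.preimage (by fun_prop)
    | ih y =>
      induction a using denseRange_toFock.induction_on with
      | hp => exact hN.preimage (by fun_prop)
      | ih x => exact h x y
  induction v using denseRange_toHilbertTensor.induction_on with
  | hp => exact hN
  | ih t =>
    induction t using TensorProduct.induction_on with
    | zero => rw [map_zero]; exact N.zero_mem
    | tmul a b => exact h1 a b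
    | add s t hs ht => rw [map_add]; exact N.add_mem hs ht

lemma denseRange_polEmb : DenseRange (polEmb W) := by
  intro v
  refine mem_of_polVec_mem W (N := (LinearMap.range (polEmb W)).topologicalClosure)
    (Submodule.isClosed_topologicalClosure _) (fun x y => ?_) v
  exact Submodule.le_topologicalClosure _ ⟨_, polEmb_tmul W x y⟩

variable [W.HasOrthogonalProjection]

/-- On `W` and on `Wᗮ` only one summand of `mixedCreation` survives. This and the next three
formulas are the model that `gnsVec` has to reproduce in an arbitrary representation. -/
lemma creation_polVec (f : W) (x : ExteriorAlgebra ℂ W) (y : ExteriorAlgebra ℂ (ConjSpace Wᗮ)) :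
    (quasiFree W).creation f (polVec W x y) = polVec W (ExteriorAlgebra.ι ℂ f * x) y := by
  change mixedCreation _ _ _ = _
  rw [Submodule.orthogonalProjectionOnto_mem_subspace_eq_self,
    Submodule.orthogonalProjectionOnto_orthogonal_apply_eq_zero f.2, mixedCreation, map_zero,
    map_zero, tensorOp_zero_right, add_zero, polVec_apply, tensorOp_apply, TensorProduct.mapL_tmul,
    create_toFock]
  rfl

lemma adjoint_creation_polVec (f : W) (x : ExteriorAlgebra ℂ W)
    (y : ExteriorAlgebra ℂ (ConjSpace Wᗮ)) :
    ContinuousLinearMap.adjoint ((quasiFree W).creation f) (polVec W x y)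
      = polVec W (contract f x) y := by
  change ContinuousLinearMap.adjoint (mixedCreation _ _) _ = _
  rw [Submodule.orthogonalProjectionOnto_mem_subspace_eq_self,
    Submodule.orthogonalProjectionOnto_orthogonal_apply_eq_zero f.2, adjoint_mixedCreation,
    map_zero, map_zero, tensorOp_zero_right, add_zero, polVec_apply, tensorOp_apply,
    TensorProduct.mapL_tmul, annihilate_toFock]
  rfl

lemma creation_polVec_orthogonal (g : Wᗮ) (x : ExteriorAlgebra ℂ W)
    (y : ExteriorAlgebra ℂ (ConjSpace Wᗮ)) :
    (quasiFree W).creation g (polVec W x y)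
      = polVec W (CliffordAlgebra.involute x) (contract (toConj g) y) := by
  change mixedCreation _ _ _ = _
  rw [Submodule.orthogonalProjectionOnto_mem_subspace_eq_self,
    Submodule.orthogonalProjectionOnto_apply_of_mem_orthogonal g.2, mixedCreation,
    map_zero, tensorOp_zero_left, zero_add, polVec_apply, tensorOp_apply, TensorProduct.mapL_tmul,
    annihilate_toFock, parity_toFock]
  rfl

lemma adjoint_creation_polVec_orthogonal (g : Wᗮ) (x : ExteriorAlgebra ℂ W)
    (y : ExteriorAlgebra ℂ (ConjSpace Wᗮ)) :
    ContinuousLinearMap.adjoint ((quasiFree W).creation g) (polVec W x y)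
      = polVec W (CliffordAlgebra.involute x) (ExteriorAlgebra.ι ℂ (toConj g) * y) := by
  change ContinuousLinearMap.adjoint (mixedCreation _ _) _ = _
  rw [Submodule.orthogonalProjectionOnto_mem_subspace_eq_self,
    Submodule.orthogonalProjectionOnto_apply_of_mem_orthogonal g.2, adjoint_mixedCreation,
    map_zero, tensorOp_zero_left, zero_add, polVec_apply, tensorOp_apply, TensorProduct.mapL_tmul,
    create_toFock, parity_toFock]
  rfl

/-- A closed subspace containing the vacuum and stable under the quasi-free representation is
everything. -/
lemma mem_of_vacuum_mem {N : Submodule ℂ (PolFock W)} (hN : IsClosed (N : Set (PolFock W)))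
    (hvac : vacuum W ∈ N) (h : ∀ f, ∀ v ∈ N, (quasiFree W).creation f v ∈ N)
    (h' : ∀ f, ∀ v ∈ N, ContinuousLinearMap.adjoint ((quasiFree W).creation f) v ∈ N)
    (v : PolFock W) : v ∈ N := by
  refine mem_of_polVec_mem W hN (fun x y => ?_) v
  induction y using ext_induction generalizing x with
  | h1 =>
    induction x using ext_induction with
    | h1 => exact hvac
    | hsmul c x hx => rw [map_smul, LinearMap.smul_apply]; exact N.smul_mem c hx
    | hadd x x' hx hx' => rw [map_add, LinearMap.add_apply]; exact N.add_mem hx hx'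
    | hι f x hx => rw [← creation_polVec]; exact h _ _ hx
  | hsmul c y hy => rw [map_smul]; exact N.smul_mem c (hy x)
  | hadd y y' hy hy' => rw [map_add]; exact N.add_mem (hy x) (hy' x)
  | hι g y hy =>
    obtain ⟨g, rfl⟩ : ∃ g' : Wᗮ, toConj g' = g := ⟨g, rfl⟩
    -- The parity operator acts on the first factor; starting from the involuted `x` cancels it.
    -- This is why `x` is generalised in the induction.
    have h2 := h' g _ (hy (CliffordAlgebra.involute x))
    rw [adjoint_creation_polVec_orthogonal W g, CliffordAlgebra.involute_involute] at h2
    exact h2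

end PolVec

/-! ### Uniqueness of the GNS representation -/

section GNS

variable {H F : Type*} [NormedAddCommGroup H] [InnerProductSpace ℂ H]
    [NormedAddCommGroup F] [InnerProductSpace ℂ F] [CompleteSpace F]

omit [CompleteSpace F] in
lemma eq_zero_of_add_self {A : F →L[ℂ] F} (h : A + A = 0) : A = 0 := by
  rw [← two_smul ℂ] at h
  exact (smul_eq_zero.1 h).resolve_left two_ne_zero

namespace CARRep

variable (R : CARRep H F)

/-- The annihilation operators of a representation of the CAR algebra. -/
def annih (f : H) : F →L[ℂ] F := ContinuousLinearMap.adjoint (R.creation f)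

lemma creation_apply_comm (f g : H) (v : F) :
    R.creation f (R.creation g v) = -R.creation g (R.creation f v) :=
  eq_neg_of_add_eq_zero_left (congrArg (fun A : F →L[ℂ] F => A v) (R.creation_creation f g))

lemma annih_creation_apply (f g : H) (v : F) :
    R.annih f (R.creation g v) = (inner ℂ f g : ℂ) • v - R.creation g (R.annih f v) :=
  eq_sub_of_add_eq (congrArg (fun A : F →L[ℂ] F => A v) (R.adjoint_creation f g))

lemma creation_annih_apply (f g : H) (v : F) :
    R.creation g (R.annih f v) = (inner ℂ f g : ℂ) • v - R.annih f (R.creation g v) := by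
  rw [annih_creation_apply, sub_sub_cancel]

lemma annih_mul_annih (f g : H) : R.annih f * R.annih g = -(R.annih g * R.annih f) := by
  have h := congrArg ContinuousLinearMap.adjoint (R.creation_creation g f)
  rw [map_add, map_zero] at h
  rw [ContinuousLinearMap.mul_def, ContinuousLinearMap.mul_def, ContinuousLinearMap.adjoint_comp,
    ContinuousLinearMap.adjoint_comp] at h
  exact eq_neg_of_add_eq_zero_left h

lemma annih_apply_comm (f g : H) (v : F) :
    R.annih f (R.annih g v) = -R.annih g (R.annih f v) :=
  congrArg (fun A : F →L[ℂ] F => A v) (R.annih_mul_annih f g)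

lemma inner_creation_left (f : H) (u v : F) :
    inner ℂ (R.creation f u) v = inner ℂ u (R.annih f v) :=
  (ContinuousLinearMap.adjoint_inner_right _ _ _).symm

lemma inner_annih_left (f : H) (u v : F) :
    inner ℂ (R.annih f u) v = inner ℂ u (R.creation f v) :=
  ContinuousLinearMap.adjoint_inner_left _ _ _

/-- The homomorphism from the exterior algebra extending the creation operators. -/
def creationAlg (W : Submodule ℂ H) : ExteriorAlgebra ℂ W →ₐ[ℂ] (F →L[ℂ] F) :=
  ExteriorAlgebra.lift ℂ ⟨R.creation ∘ₗ W.subtype, fun f =>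
    eq_zero_of_add_self (R.creation_creation f f)⟩

lemma creationAlg_ι_mul (W : Submodule ℂ H) (f : W) (x : ExteriorAlgebra ℂ W) (v : F) :
    R.creationAlg W (ExteriorAlgebra.ι ℂ f * x) v = R.creation f (R.creationAlg W x v) := by
  rw [map_mul, creationAlg, ExteriorAlgebra.lift_ι_apply]
  rfl

/-- The homomorphism from the exterior algebra extending the annihilation operators. -/
def annihAlg (W : Submodule ℂ H) : ExteriorAlgebra ℂ (ConjSpace W) →ₐ[ℂ] (F →L[ℂ] F) :=
  ExteriorAlgebra.lift ℂ ⟨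
    { toFun := fun f => R.annih ((show W from f : W) : H)
      map_add' := fun f g => by
        change ContinuousLinearMap.adjoint (R.creation ((_ : H) + _)) = _
        rw [map_add, map_add]; rfl
      map_smul' := fun c f => by
        change ContinuousLinearMap.adjoint (R.creation (starRingEnd ℂ c • (_ : H))) = _
        rw [map_smul, map_smulₛₗ, Complex.conj_conj]; rfl },
    fun f => eq_zero_of_add_self
      (eq_neg_iff_add_eq_zero.1 (R.annih_mul_annih ((show W from f : W) : H) _))⟩

lemma annihAlg_ι_mul (W : Submodule ℂ H) (f : W) (x : ExteriorAlgebra ℂ (ConjSpace W)) (v : F) :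
    R.annihAlg W (ExteriorAlgebra.ι ℂ (toConj f) * x) v = R.annih f (R.annihAlg W x v) := by
  rw [map_mul, annihAlg, ExteriorAlgebra.lift_ι_apply]
  rfl

/-- The unit vector `Ω` behaves in the representation `R` as the vacuum of the quasi-free
representation defined by `W`. -/
structure IsVacuum (W : Submodule ℂ H) (Ω : F) : Prop where
  norm_eq : ‖Ω‖ = 1
  annih_eq : ∀ f ∈ W, R.annih f Ω = 0
  creation_eq : ∀ g ∈ Wᗮ, R.creation g Ω = 0

variable (W : Submodule ℂ H) (Ω : F)

/-- The vector obtained from `Ω` by applying creation operators from `W` and annihilation operators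
from the orthogonal complement of `W`. -/
def gnsVec : ExteriorAlgebra ℂ W →ₗ[ℂ] ExteriorAlgebra ℂ (ConjSpace Wᗮ) →ₗ[ℂ] F :=
  LinearMap.mk₂ ℂ (fun x y => R.creationAlg W x (R.annihAlg Wᗮ y Ω))
    (fun x x' y => by rw [map_add]; rfl)
    (fun c x y => by rw [map_smul]; rfl)
    (fun x y y' => by rw [map_add, add_apply, map_add])
    (fun c x y => by rw [map_smul, smul_apply, map_smul])

lemma gnsVec_apply (x : ExteriorAlgebra ℂ W) (y : ExteriorAlgebra ℂ (ConjSpace Wᗮ)) :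
    R.gnsVec W Ω x y = R.creationAlg W x (R.annihAlg Wᗮ y Ω) := rfl

lemma creation_gnsVec (f : W) (x : ExteriorAlgebra ℂ W) (y : ExteriorAlgebra ℂ (ConjSpace Wᗮ)) :
    R.creation f (R.gnsVec W Ω x y) = R.gnsVec W Ω (ExteriorAlgebra.ι ℂ f * x) y := by
  rw [gnsVec_apply, gnsVec_apply, creationAlg_ι_mul]

/-- Since `g` is orthogonal to `W`, `a(g)` anticommutes with every creation operator from `W`. Each
factor costs a sign, and `involute` records the signs. -/
lemma annih_creationAlg_orthogonal (g : Wᗮ) (x : ExteriorAlgebra ℂ W) (v : F) :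
    R.annih g (R.creationAlg W x v)
      = R.creationAlg W (CliffordAlgebra.involute x) (R.annih g v) := by
  induction x using ext_induction with
  | h1 => simp
  | hsmul c x hx => simp only [map_smul, smul_apply, hx]
  | hadd x y hx hy => simp only [map_add, add_apply, hx, hy]
  | hι f x hx =>
    rw [creationAlg_ι_mul, annih_creation_apply, hx, involute_ι_mul, map_neg, neg_apply,
      creationAlg_ι_mul, Submodule.inner_left_of_mem_orthogonal f.2 g.2, zero_smul, zero_sub]

lemma creation_creationAlg (g : H) (x : ExteriorAlgebra ℂ W) (v : F) :
    R.creation g (R.creationAlg W x v)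
      = R.creationAlg W (CliffordAlgebra.involute x) (R.creation g v) := by
  induction x using ext_induction with
  | h1 => simp
  | hsmul c x hx => simp only [map_smul, smul_apply, hx]
  | hadd x y hx hy => simp only [map_add, add_apply, hx, hy]
  | hι f x hx =>
    rw [creationAlg_ι_mul, creation_apply_comm, hx, involute_ι_mul, map_neg, neg_apply,
      creationAlg_ι_mul]

lemma annih_gnsVec_orthogonal (g : Wᗮ) (x : ExteriorAlgebra ℂ W)
    (y : ExteriorAlgebra ℂ (ConjSpace Wᗮ)) :
    R.annih g (R.gnsVec W Ω x y)
      = R.gnsVec W Ω (CliffordAlgebra.involute x) (ExteriorAlgebra.ι ℂ (toConj g) * y) := by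
  rw [gnsVec_apply, gnsVec_apply, annih_creationAlg_orthogonal, annihAlg_ι_mul]

lemma annih_gnsVec_one (g : Wᗮ) (y : ExteriorAlgebra ℂ (ConjSpace Wᗮ)) :
    R.annih g (R.gnsVec W Ω 1 y) = R.gnsVec W Ω 1 (ExteriorAlgebra.ι ℂ (toConj g) * y) := by
  simpa using R.annih_gnsVec_orthogonal W Ω g 1 y

variable {R W Ω} (h : R.IsVacuum W Ω)
include h

lemma IsVacuum.annih_annihAlg (f : W) (y : ExteriorAlgebra ℂ (ConjSpace Wᗮ)) :
    R.annih f (R.annihAlg Wᗮ y Ω) = 0 := by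
  induction y using ext_induction with
  | h1 => simpa using h.annih_eq f f.2
  | hsmul c x hx => simp only [map_smul, smul_apply, hx, smul_zero]
  | hadd x y hx hy => simp only [map_add, add_apply, hx, hy, add_zero]
  | hι g x hx =>
    obtain ⟨g, rfl⟩ : ∃ g' : Wᗮ, toConj g' = g := ⟨g, rfl⟩
    rw [annihAlg_ι_mul, annih_apply_comm, hx, map_zero, neg_zero]

lemma IsVacuum.annih_gnsVec (f : W) (x : ExteriorAlgebra ℂ W)
    (y : ExteriorAlgebra ℂ (ConjSpace Wᗮ)) :
    R.annih f (R.gnsVec W Ω x y) = R.gnsVec W Ω (contract f x) y := by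
  simp only [gnsVec_apply]
  induction x using ext_induction with
  | h1 => simpa [contract_one] using h.annih_annihAlg f y
  | hsmul c x hx => simp only [map_smul, smul_apply, hx]
  | hadd x y hx hy => simp only [map_add, add_apply, hx, hy]
  | hι g x hx =>
    rw [creationAlg_ι_mul, annih_creation_apply, hx, contract_ι_mul, map_sub, sub_apply,
      creationAlg_ι_mul, map_smul]
    rfl

/-- Moving `a*(g)` to the right until it kills `Ω` leaves the scalars `⟪f, g⟫` of the
anticommutators. In the conjugate space these are `⟪toConj g, toConj f⟫`, hence the contraction. -/
lemma IsVacuum.creation_annihAlg (g : Wᗮ) (y : ExteriorAlgebra ℂ (ConjSpace Wᗮ)) :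
    R.creation g (R.annihAlg Wᗮ y Ω) = R.annihAlg Wᗮ (contract (toConj g) y) Ω := by
  induction y using ext_induction with
  | h1 => simpa [contract_one] using h.creation_eq g g.2
  | hsmul c x hx => simp only [map_smul, smul_apply, hx]
  | hadd x y hx hy => simp only [map_add, add_apply, hx, hy]
  | hι f x hx =>
    obtain ⟨f, rfl⟩ : ∃ f' : Wᗮ, toConj f' = f := ⟨f, rfl⟩
    rw [annihAlg_ι_mul, creation_annih_apply, hx, contract_ι_mul, map_sub, sub_apply,
      annihAlg_ι_mul, map_smul]
    rfl

lemma IsVacuum.creation_gnsVec_orthogonal (g : Wᗮ) (x : ExteriorAlgebra ℂ W)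
    (y : ExteriorAlgebra ℂ (ConjSpace Wᗮ)) :
    R.creation g (R.gnsVec W Ω x y)
      = R.gnsVec W Ω (CliffordAlgebra.involute x) (contract (toConj g) y) := by
  rw [gnsVec_apply, gnsVec_apply, creation_creationAlg, h.creation_annihAlg]

/-- Moving a generator to the other side of the inner product turns it into its adjoint, which acts
as a contraction by the vacuum conditions. This is the recursion defining `extInner`, and it ends at
`‖Ω‖ = 1`. -/
lemma IsVacuum.inner_gnsVec (x x' : ExteriorAlgebra ℂ W)
    (y y' : ExteriorAlgebra ℂ (ConjSpace Wᗮ)) :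
    inner ℂ (R.gnsVec W Ω x y) (R.gnsVec W Ω x' y') = extInner x x' * extInner y y' := by
  induction x using ext_induction generalizing x' y' with
  | hsmul c x hx =>
    rw [map_smul, LinearMap.smul_apply, inner_smul_left, extInner_smul_left, hx, mul_assoc]
  | hadd x z hx hz =>
    rw [map_add, LinearMap.add_apply, inner_add_left, extInner_add_left, hx, hz, add_mul]
  | hι f x hx =>
    rw [← creation_gnsVec, inner_creation_left, h.annih_gnsVec, hx, extInner_ι_mul]
  | h1 =>
    induction y using ext_induction generalizing x' y' with
    | hsmul c x hx => rw [map_smul, inner_smul_left, extInner_smul_left, hx]; ring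
    | hadd x z hx hz => rw [map_add, inner_add_left, extInner_add_left, hx, hz, mul_add]
    | hι g y hy =>
      obtain ⟨g, rfl⟩ : ∃ g' : Wᗮ, toConj g' = g := ⟨g, rfl⟩
      -- The parity sign falls on `x'` and is moved to the left argument, which is `1` at this stage
      -- of the induction and is fixed by `involute`.
      rw [← annih_gnsVec_one, inner_annih_left, h.creation_gnsVec_orthogonal, hy,
        extInner_ι_mul, ← extInner_involute, map_one]
    | h1 =>
      induction x' using ext_induction with
      | hsmul c x hx =>
        rw [map_smul, LinearMap.smul_apply, inner_smul_right, extInner_smul_right, hx, mul_assoc]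
      | hadd x z hx hz =>
        rw [map_add, LinearMap.add_apply, inner_add_right, extInner_add_right, hx, hz, add_mul]
      | hι f x hx =>
        rw [← creation_gnsVec, ← inner_annih_left, h.annih_gnsVec, contract_one,
          extInner_one, algebraMapInv_ι_mul]
        simp
      | h1 =>
        induction y' using ext_induction with
        | hsmul c x hx => rw [map_smul, inner_smul_right, extInner_smul_right, hx]; ring
        | hadd x z hx hz => rw [map_add, inner_add_right, extInner_add_right, hx, hz, mul_add]
        | hι g y hy =>
          obtain ⟨g, rfl⟩ : ∃ g' : Wᗮ, toConj g' = g := ⟨g, rfl⟩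
          rw [← annih_gnsVec_one, ← inner_creation_left, h.creation_gnsVec_orthogonal, contract_one,
            extInner_one (_ * y), algebraMapInv_ι_mul]
          simp
        | h1 =>
          rw [gnsVec_apply, map_one, map_one, one_apply_eq_self, one_apply_eq_self,
            inner_self_eq_norm_sq_to_K, extInner_one, extInner_one, h.norm_eq]
          simp

lemma IsVacuum.inner_lift_gnsVec (s t : ExteriorAlgebra ℂ W ⊗[ℂ] ExteriorAlgebra ℂ (ConjSpace Wᗮ)) :
    inner ℂ (TensorProduct.lift (R.gnsVec W Ω) s) (TensorProduct.lift (R.gnsVec W Ω) t)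
      = inner ℂ (polEmb W s) (polEmb W t) := by
  induction s using TensorProduct.induction_on with
  | zero => simp
  | add s s' hs hs' => rw [map_add, map_add, inner_add_left, inner_add_left, hs, hs']
  | tmul x y =>
    induction t using TensorProduct.induction_on with
    | zero => simp
    | add t t' ht ht' => rw [map_add, map_add, inner_add_right, inner_add_right, ht, ht']
    | tmul x' y' =>
      rw [TensorProduct.lift.tmul, TensorProduct.lift.tmul, polEmb_tmul, polEmb_tmul, inner_polVec,
        h.inner_gnsVec]
      rfl

lemma IsVacuum.norm_lift_gnsVec (s : ExteriorAlgebra ℂ W ⊗[ℂ] ExteriorAlgebra ℂ (ConjSpace Wᗮ)) :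
    ‖TensorProduct.lift (R.gnsVec W Ω) s‖ = ‖polEmb W s‖ := by
  rw [@norm_eq_sqrt_re_inner ℂ, h.inner_lift_gnsVec, ← @norm_eq_sqrt_re_inner ℂ]

/-- The lift of `gnsVec` and `polEmb` have equal norms on the algebraic tensor product, and `polEmb`
has dense range, so the assignment is well defined and extends by continuity. -/
lemma IsVacuum.exists_isometry : ∃ T : PolFock W →ₗᵢ[ℂ] F,
    ∀ x y, T (polVec W x y) = R.gnsVec W Ω x y := by
  have hT := LinearMap.extendOfNorm_eq (f := TensorProduct.lift (R.gnsVec W Ω)) (e := polEmb W)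
    (denseRange_polEmb W) ⟨1, fun s => by rw [one_mul, h.norm_lift_gnsVec]⟩
  refine ⟨⟨((TensorProduct.lift (R.gnsVec W Ω)).extendOfNorm (polEmb W)).toLinearMap,
    fun v => ?_⟩, fun x y => ?_⟩
  · induction v using (denseRange_polEmb W).induction_on with
    | hp =>
      refine isClosed_eq (f := fun v =>
        ‖(TensorProduct.lift (R.gnsVec W Ω)).extendOfNorm (polEmb W) v‖) ?_ ?_ <;> fun_prop
    | ih s =>
      change ‖(TensorProduct.lift (R.gnsVec W Ω)).extendOfNorm (polEmb W) _‖ = _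
      rw [hT, h.norm_lift_gnsVec]
  · have := hT (x ⊗ₜ[ℂ] y)
    rwa [polEmb_tmul, TensorProduct.lift.tmul] at this

/-- A vacuum vector yields an isometric intertwining operator from the quasi-free
representation. -/
theorem IsVacuum.exists_intertwiner [W.HasOrthogonalProjection] :
    ∃ T : PolFock W →ₗᵢ[ℂ] F, T (vacuum W) = Ω ∧
      (∀ f v, T ((quasiFree W).creation f v) = R.creation f (T v)) ∧
      ∀ f v, T ((quasiFree W).annih f v) = R.annih f (T v) := by
  obtain ⟨T, hT⟩ := h.exists_isometry
  refine ⟨T, ?_, fun f v => ?_, fun f v => ?_⟩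
  · rw [vacuum_eq_polVec, hT, gnsVec_apply, map_one, map_one]; rfl
  · induction v using (denseRange_polEmb W).induction_on with
    | hp => exact isClosed_eq (by fun_prop) (by fun_prop)
    | ih s =>
      induction s using TensorProduct.induction_on with
      | zero => simp
      | add s t hs ht => simp only [map_add, hs, ht]
      | tmul x y =>
        rw [polEmb_tmul, hT]
        have hf := W.starProjection_add_starProjection_orthogonal f
        rw [← hf, map_add, map_add, add_apply, add_apply, map_add]
        congr 1
        · exact (congrArg T (creation_polVec W _ x y)).trans
            ((hT _ _).trans (R.creation_gnsVec W Ω _ x y).symm)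
        · exact (congrArg T (creation_polVec_orthogonal W _ x y)).trans
            ((hT _ _).trans (h.creation_gnsVec_orthogonal _ x y).symm)
  · induction v using (denseRange_polEmb W).induction_on with
    | hp => exact isClosed_eq (by fun_prop) (by fun_prop)
    | ih s =>
      induction s using TensorProduct.induction_on with
      | zero => simp
      | add s t hs ht => simp only [map_add, hs, ht]
      | tmul x y =>
        rw [polEmb_tmul, hT]
        have hf := W.starProjection_add_starProjection_orthogonal f
        rw [← hf, annih, annih, map_add, map_add, map_add, map_add, add_apply, add_apply, map_add]
        congr 1
        · exact (congrArg T (adjoint_creation_polVec W _ x y)).trans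
            ((hT _ _).trans (h.annih_gnsVec _ x y).symm)
        · exact (congrArg T (adjoint_creation_polVec_orthogonal W _ x y)).trans
            ((hT _ _).trans (R.annih_gnsVec_orthogonal W Ω _ x y).symm)

/-- If moreover the vacuum vector is cyclic, the intertwining operator is unitary. -/
theorem IsVacuum.exists_unitary [W.HasOrthogonalProjection]
    (hcyc : ∀ N : Submodule ℂ F, IsClosed (N : Set F) → Ω ∈ N →
      (∀ f, ∀ v ∈ N, R.creation f v ∈ N) → (∀ f, ∀ v ∈ N, R.annih f v ∈ N) → N = ⊤) :
    ∃ T : PolFock W ≃ₗᵢ[ℂ] F, T (vacuum W) = Ω ∧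
      ∀ f v, T ((quasiFree W).creation f v) = R.creation f (T v) := by
  obtain ⟨T, h1, h2, h3⟩ := h.exists_intertwiner
  have hr : LinearMap.range T.toLinearMap = ⊤ := by
    refine hcyc _ ?_ ⟨_, h1⟩ ?_ ?_
    · have := T.isometry.isClosedEmbedding.isClosed_range
      convert! this
    · rintro f _ ⟨v, rfl⟩
      exact ⟨_, h2 f v⟩
    · rintro f _ ⟨v, rfl⟩
      exact ⟨_, h3 f v⟩
  exact ⟨LinearIsometryEquiv.ofSurjective T (LinearMap.range_eq_top.1 hr), h1, h2⟩

omit h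

/-- A unitary intertwining operator intertwines the annihilation operators. -/
lemma map_annih {F' : Type*} [NormedAddCommGroup F'] [InnerProductSpace ℂ F'] [CompleteSpace F']
    {R' : CARRep H F'} {T : F ≃ₗᵢ[ℂ] F'} (hT : ∀ f v, T (R.creation f v) = R'.creation f (T v))
    (f : H) (v : F) : T (R.annih f v) = R'.annih f (T v) := by
  refine ext_inner_left ℂ fun u => ?_
  obtain ⟨u, rfl⟩ := T.surjective u
  rw [LinearIsometryEquiv.inner_map_map, ← inner_creation_left, ← inner_creation_left, ← hT,
    LinearIsometryEquiv.inner_map_map]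

lemma symm_creation {F' : Type*} [NormedAddCommGroup F'] [InnerProductSpace ℂ F'] [CompleteSpace F']
    {R' : CARRep H F'} {T : F ≃ₗᵢ[ℂ] F'} (hT : ∀ f v, T (R.creation f v) = R'.creation f (T v))
    (f : H) (v : F') : T.symm (R'.creation f v) = R.creation f (T.symm v) := by
  rw [LinearIsometryEquiv.symm_apply_eq, hT, LinearIsometryEquiv.apply_symm_apply]

/-- Unitary intertwining operators which agree up to a scalar on the vacuum agree up to that
scalar. -/
lemma eq_smul_of_vacuum [W.HasOrthogonalProjection] {T T' : PolFock W ≃ₗᵢ[ℂ] F}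
    (hT : ∀ f v, T ((quasiFree W).creation f v) = R.creation f (T v))
    (hT' : ∀ f v, T' ((quasiFree W).creation f v) = R.creation f (T' v)) {c : ℂ}
    (hvac : T (vacuum W) = c • T' (vacuum W)) (v : PolFock W) : T v = c • T' v := by
  let N : Submodule ℂ (PolFock W) := LinearMap.eqLocus T.toLinearEquiv.toLinearMap
    (c • T'.toLinearEquiv.toLinearMap)
  have hN : ∀ v, v ∈ N ↔ T v = c • T' v := fun v => Iff.rfl
  rw [← hN]
  refine mem_of_vacuum_mem W (isClosed_eq (f := T) (g := fun v => c • T' v) (by fun_prop)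
    (by fun_prop)) hvac (fun f v hv => ?_) (fun f v hv => ?_) v
  · rw [hN] at hv ⊢
    rw [hT, hT', hv, map_smul]
  · rw [hN] at hv ⊢
    have h1 := map_annih hT f v
    have h2 := map_annih hT' f v
    rw [hv, map_smul, ← h2] at h1
    exact h1

lemma isVacuum_vacuum [W.HasOrthogonalProjection] : (quasiFree W).IsVacuum W (vacuum W) where
  norm_eq := norm_vacuum W
  annih_eq f hf := by
    have := adjoint_creation_polVec W ⟨f, hf⟩ 1 1
    rwa [contract_one, map_zero] at this
  creation_eq g hg := by
    have := creation_polVec_orthogonal W ⟨g, hg⟩ 1 1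
    rwa [contract_one, map_zero] at this

/-- The vacuum vector of the quasi-free representation is unique up to a scalar. -/
lemma IsVacuum.eq_smul_vacuum [W.HasOrthogonalProjection] {Ω : PolFock W}
    (h : (quasiFree W).IsVacuum W Ω) : Ω = (inner ℂ (vacuum W) Ω : ℂ) • vacuum W := by
  rw [← sub_eq_zero]
  set v := Ω - (inner ℂ (vacuum W) Ω : ℂ) • vacuum W with hv
  have h1 : ∀ f ∈ W, (quasiFree W).annih f v = 0 := fun f hf => by
    rw [hv, map_sub, map_smul, h.annih_eq f hf, isVacuum_vacuum.annih_eq f hf, smul_zero, sub_zero]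
  have h2 : ∀ f ∈ Wᗮ, (quasiFree W).creation f v = 0 := fun f hf => by
    rw [hv, map_sub, map_smul, h.creation_eq f hf, isVacuum_vacuum.creation_eq f hf, smul_zero,
      sub_zero]
  have h3 : inner ℂ v (vacuum W) = 0 := by
    rw [← inner_conj_symm, hv, inner_sub_right, inner_smul_right, inner_self_eq_norm_sq_to_K,
      norm_vacuum]
    simp
  -- The difference `v` is killed by the adjoints of all operators that build the Fock space from
  -- the vacuum, and it is orthogonal to the vacuum. So it is orthogonal to a total set, hence to
  -- itself.
  have h4 : v ∈ (ℂ ∙ v)ᗮ := by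
    refine mem_of_polVec_mem W (Submodule.isClosed_orthogonal _) (fun x y => ?_) v
    rw [Submodule.mem_orthogonal_singleton_iff_inner_right]
    induction x using ext_induction generalizing y with
    | hsmul c x hx => rw [map_smul, LinearMap.smul_apply, inner_smul_right, hx, mul_zero]
    | hadd x z hx hz => rw [map_add, LinearMap.add_apply, inner_add_right, hx, hz, add_zero]
    | hι f x hx =>
      rw [← creation_polVec, ← inner_annih_left, h1 f f.2, inner_zero_left]
    | h1 =>
      induction y using ext_induction with
      | hsmul c x hx => rw [map_smul, inner_smul_right, hx, mul_zero]
      | hadd x z hx hz => rw [map_add, inner_add_right, hx, hz, add_zero]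
      | h1 => exact h3
      | hι g y hy =>
        obtain ⟨g, rfl⟩ : ∃ g' : Wᗮ, toConj g' = g := ⟨g, rfl⟩
        have := adjoint_creation_polVec_orthogonal W g 1 y
        rw [map_one CliffordAlgebra.involute] at this
        rw [← this, ContinuousLinearMap.adjoint_inner_right, h2 g g.2, inner_zero_left]
  exact inner_self_eq_zero.1 ((Submodule.mem_orthogonal_singleton_iff_inner_right (𝕜 := ℂ)).1 h4)

lemma IsVacuum.map {F' : Type*} [NormedAddCommGroup F'] [InnerProductSpace ℂ F'] [CompleteSpace F']
    {R' : CARRep H F'} {T : F ≃ₗᵢ[ℂ] F'} (hT : ∀ f v, T (R.creation f v) = R'.creation f (T v))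
    (h : R.IsVacuum W Ω) : R'.IsVacuum W (T Ω) where
  norm_eq := by rw [LinearIsometryEquiv.norm_map, h.norm_eq]
  annih_eq f hf := by rw [← map_annih hT, h.annih_eq f hf, map_zero]
  creation_eq f hf := by rw [← hT, h.creation_eq f hf, map_zero]

/-- Two unitary intertwining operators from a quasi-free representation differ by a phase. -/
theorem exists_phase [W.HasOrthogonalProjection] {T T' : PolFock W ≃ₗᵢ[ℂ] F}
    (hT : ∀ f v, T ((quasiFree W).creation f v) = R.creation f (T v))
    (hT' : ∀ f v, T' ((quasiFree W).creation f v) = R.creation f (T' v)) :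
    ∃ c : Circle, ∀ v, T v = (c : ℂ) • T' v := by
  have h1 := (isVacuum_vacuum (W := W)).map hT
  -- Pulled back along `T'`, the vector `T (vacuum W)` is again a vacuum for `W` in the quasi-free
  -- representation, hence a multiple of the standard one.
  have h2 := h1.map (symm_creation hT')
  have h3 := h2.eq_smul_vacuum
  set c : ℂ := inner ℂ (vacuum W) (T'.symm (T (vacuum W)))
  have hc : ‖c‖ = 1 := by
    have := congrArg norm h3
    rw [h2.norm_eq, norm_smul, norm_vacuum, mul_one] at this
    exact this.symm
  refine ⟨⟨c, by simpa [Submonoid.unitSphere] using hc⟩, fun v => ?_⟩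
  refine eq_smul_of_vacuum hT hT' ?_ v
  rw [LinearIsometryEquiv.symm_apply_eq, map_smul] at h3
  exact h3

end CARRep

end GNS

/-! ### Volume elements as vacuum vectors -/

section Top

variable {K : Type*} [NormedAddCommGroup K] [InnerProductSpace ℂ K]

lemma contract_map_of_orthogonal {K' : Type*} [NormedAddCommGroup K'] [InnerProductSpace ℂ K']
    {L : K →ₗ[ℂ] K'} {f : K'} (hf : ∀ v, inner ℂ f (L v) = 0) (x : ExteriorAlgebra ℂ K) :
    contract f (ExteriorAlgebra.map L x) = 0 := by
  induction x using ext_induction with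
  | h1 => rw [map_one, contract_one]
  | hsmul c x hx => rw [map_smul, map_smul, hx, smul_zero]
  | hadd x y hx hy => rw [map_add, map_add, hx, hy, add_zero]
  | hι g x hx =>
    rw [map_mul, ExteriorAlgebra.map_apply_ι, contract_ι_mul, hx, hf, zero_smul, mul_zero, sub_zero]

lemma exteriorPower_succ_induction {n : ℕ} {P : ExteriorAlgebra ℂ K → Prop}
    (hadd : ∀ x y, P x → P y → P (x + y))
    (hι : ∀ (f : K), ∀ x ∈ ⋀[ℂ]^n K, P (ExteriorAlgebra.ι ℂ f * x)) {x : ExteriorAlgebra ℂ K}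
    (hx : x ∈ ⋀[ℂ]^(n + 1) K) : P x := by
  rw [ExteriorAlgebra.exteriorPower, pow_succ'] at hx
  induction hx using Submodule.mul_induction_on' with
  | mem_mul_mem a ha b hb =>
    obtain ⟨f, rfl⟩ := ha
    exact hι f b hb
  | add x _ y _ hx hy => exact hadd x y hx hy

lemma ι_mul_mem_exteriorPower {n : ℕ} (f : K) {x : ExteriorAlgebra ℂ K} (hx : x ∈ ⋀[ℂ]^n K) :
    ExteriorAlgebra.ι ℂ f * x ∈ ⋀[ℂ]^(n + 1) K := by
  rw [ExteriorAlgebra.exteriorPower, pow_succ']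
  exact Submodule.mul_mem_mul ⟨f, rfl⟩ hx

lemma mem_exteriorPower_zero {x : ExteriorAlgebra ℂ K} (hx : x ∈ ⋀[ℂ]^0 K) :
    ∃ c : ℂ, x = c • 1 := by
  rw [ExteriorAlgebra.exteriorPower, pow_zero, Submodule.mem_one] at hx
  obtain ⟨c, rfl⟩ := hx
  exact ⟨c, Algebra.algebraMap_eq_smul_one c⟩

lemma contract_mem_exteriorPower {n : ℕ} (f : K) {x : ExteriorAlgebra ℂ K}
    (hx : x ∈ ⋀[ℂ]^(n + 1) K) : contract f x ∈ ⋀[ℂ]^n K := by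
  induction n generalizing x with
  | zero =>
    refine exteriorPower_succ_induction (P := fun x => contract f x ∈ _)
      (fun x y hx hy => ?_) (fun g y hy => ?_) hx
    · rw [map_add]; exact Submodule.add_mem _ hx hy
    · obtain ⟨c, rfl⟩ := mem_exteriorPower_zero hy
      rw [contract_ι_mul, map_smul, contract_one, smul_zero, mul_zero, sub_zero]
      exact Submodule.smul_mem _ _ hy
  | succ n ih =>
    refine exteriorPower_succ_induction (P := fun x => contract f x ∈ _)
      (fun x y hx hy => ?_) (fun g y hy => ?_) hx
    · rw [map_add]; exact Submodule.add_mem _ hx hy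
    · rw [contract_ι_mul]
      exact Submodule.sub_mem _ (Submodule.smul_mem _ _ hy) (ι_mul_mem_exteriorPower g (ih hy))

/-- A subspace stable under contractions which contains a non-zero homogeneous element contains
the unit. -/
lemma one_mem_of_contract_mem {P : Submodule ℂ (ExteriorAlgebra ℂ K)}
    (hP : ∀ f, ∀ x ∈ P, contract f x ∈ P) {n : ℕ} {x : ExteriorAlgebra ℂ K} (hx : x ∈ ⋀[ℂ]^n K)
    (hx0 : x ≠ 0) (hxP : x ∈ P) : (1 : ExteriorAlgebra ℂ K) ∈ P := by
  induction n generalizing x with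
  | zero =>
    obtain ⟨c, rfl⟩ := mem_exteriorPower_zero hx
    have hc : c ≠ 0 := fun h => hx0 (by rw [h, zero_smul])
    exact (P.smul_mem_iff hc).1 hxP
  | succ n ih =>
    by_cases h : ∀ f, contract f x = 0
    · refine absurd ?_ hx0
      -- If all contractions of `x` vanish, `x` is orthogonal to every product `f ∧ y`; having
      -- positive degree, `x` is itself a sum of such products.
      have : extInner x x = 0 := by
        refine exteriorPower_succ_induction (P := fun y => extInner y x = 0)
          (fun y z hy hz => ?_) (fun g y hy => ?_) hx
        · rw [extInner_add_left, hy, hz, add_zero]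
        · rw [extInner_ι_mul, h, extInner_zero_right]
      exact (extInner_self x).2 (by rw [this]; rfl)
    · push Not at h
      obtain ⟨f, hf⟩ := h
      exact ih (contract_mem_exteriorPower f hx) hf (hP f x hxP)

lemma ι_mul_eq_zero_of_top [FiniteDimensional ℂ K] (f : K) {x : ExteriorAlgebra ℂ K}
    (hx : x ∈ ⋀[ℂ]^(Module.finrank ℂ K) K) : ExteriorAlgebra.ι ℂ f * x = 0 := by
  have h1 := ι_mul_mem_exteriorPower f hx
  have h2 : Module.finrank ℂ (⋀[ℂ]^(Module.finrank ℂ K + 1) K) = 0 := by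
    rw [exteriorPower.finrank_eq, Nat.choose_succ_self]
  rw [Submodule.finrank_eq_zero.1 h2] at h1
  exact (Submodule.mem_bot ℂ).1 h1

lemma ne_zero_of_norm_eq_one {x : ExteriorAlgebra ℂ K} (hx : ‖x‖ = 1) : x ≠ 0 := by
  rintro rfl
  rw [@norm_eq_sqrt_re_inner ℂ, inner_eq_extInner, extInner_zero_left] at hx
  simp at hx

end Top

/-! ### The intertwining operator attached to a volume element -/

section Volume

variable {H : Type*} [NormedAddCommGroup H] [InnerProductSpace ℂ H] {W W' : Submodule ℂ H}
  [W.HasOrthogonalProjection]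

/-- The vector `τ ⊗ 1` of `F_P(H)`, for `τ` in the exterior algebra of a subspace of `P H`. -/
def volVec (W W' : Submodule ℂ H) : ExteriorAlgebra ℂ (gapSpace W W') →ₗ[ℂ] PolFock W :=
  ((polVec W).flip 1) ∘ₗ (ExteriorAlgebra.map (Submodule.inclusion inf_le_left)).toLinearMap

omit [W.HasOrthogonalProjection] in
lemma volVec_apply (τ : ExteriorAlgebra ℂ (gapSpace W W')) :
    volVec W W' τ
      = polVec W (ExteriorAlgebra.map (Submodule.inclusion inf_le_left) τ) 1 := rfl

/-- Vectors of `W'` are orthogonal to the gap, so contracting with them kills `τ`. A vector of `W'ᗮ`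
has its `W`-component in the gap, where the wedge with the top element `τ` vanishes, and its
`Wᗮ`-component contracts the scalar second factor to zero. -/
lemma isVacuum_volVec [FiniteDimensional ℂ (gapSpace W W')] (hW : W' ≤ W)
    {τ : ExteriorAlgebra ℂ (gapSpace W W')}
    (hτ : τ ∈ ⋀[ℂ]^(Module.finrank ℂ (gapSpace W W')) (gapSpace W W')) (hn : ‖τ‖ = 1) :
    (quasiFree W).IsVacuum W' (volVec W W' τ) where
  norm_eq := by
    rw [volVec_apply, norm_polVec, norm_one_exterior, mul_one, norm_map, hn]
    exact fun v w => rfl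
  annih_eq f hf := by
    refine (adjoint_creation_polVec W ⟨f, hW hf⟩ _ 1).trans ?_
    have h1 : ∀ v : gapSpace W W', inner ℂ (⟨f, hW hf⟩ : W) (Submodule.inclusion inf_le_left v) = 0 :=
      fun v => Submodule.inner_right_of_mem_orthogonal (K := W') hf v.2.2
    have h2 := contract_map_of_orthogonal h1 τ
    exact (congrArg (fun z => polVec W z 1) h2).trans (by rw [map_zero, LinearMap.zero_apply])
  creation_eq g hg := by
    have h1 := W.starProjection_add_starProjection_orthogonal g
    have h2 : Wᗮ.starProjection g ∈ W'ᗮ :=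
      Submodule.orthogonal_le hW (Submodule.starProjection_apply_mem _ _)
    have h3 : W.starProjection g ∈ gapSpace W W' :=
      ⟨Submodule.starProjection_apply_mem _ _, by
        rw [eq_sub_of_add_eq h1]; exact Submodule.sub_mem _ hg h2⟩
    rw [← h1, map_add, add_apply]
    have h4 := creation_polVec W ⟨W.starProjection g, h3.1⟩
      (ExteriorAlgebra.map (Submodule.inclusion inf_le_left) τ) 1
    have h5 := creation_polVec_orthogonal W
      ⟨Wᗮ.starProjection g, Submodule.starProjection_apply_mem _ _⟩
      (ExteriorAlgebra.map (Submodule.inclusion inf_le_left) τ) 1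
    rw [contract_one, map_zero] at h5
    have h6 : ExteriorAlgebra.ι ℂ (⟨W.starProjection g, h3.1⟩ : W)
        * ExteriorAlgebra.map (Submodule.inclusion inf_le_left) τ = 0 := by
      rw [← map_zero (ExteriorAlgebra.map (Submodule.inclusion (inf_le_left : gapSpace W W' ≤ W))),
        ← ι_mul_eq_zero_of_top ⟨_, h3⟩ hτ, map_mul, ExteriorAlgebra.map_apply_ι]
      rfl
    rw [h6, map_zero, LinearMap.zero_apply] at h4
    rw [volVec_apply]
    exact (congrArg₂ (· + ·) h4 h5).trans (add_zero 0)

/-- Annihilation operators from the gap act as contractions, and these take a nonzero homogeneous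
`τ` down to a nonzero scalar. So `N` contains the vacuum of `W`, which is cyclic. -/
lemma volVec_cyclic {τ : ExteriorAlgebra ℂ (gapSpace W W')} {n : ℕ}
    (hτ : τ ∈ ⋀[ℂ]^n (gapSpace W W')) (hn : τ ≠ 0)
    (N : Submodule ℂ (PolFock W)) (hN : IsClosed (N : Set (PolFock W))) (hτN : volVec W W' τ ∈ N)
    (h : ∀ f, ∀ v ∈ N, (quasiFree W).creation f v ∈ N)
    (h' : ∀ f, ∀ v ∈ N, (quasiFree W).annih f v ∈ N) : N = ⊤ := by
  refine Submodule.eq_top_iff'.2 (mem_of_vacuum_mem W hN ?_ h h')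
  have := one_mem_of_contract_mem (P := N.comap (volVec W W')) (fun f x hx => ?_) hτ hn hτN
  · rw [Submodule.mem_comap, volVec_apply, map_one (ExteriorAlgebra.map _)] at this
    exact this
  · rw [Submodule.mem_comap] at hx ⊢
    have h1 := h' f _ hx
    have h2 := adjoint_creation_polVec W (Submodule.inclusion inf_le_left f)
      (ExteriorAlgebra.map (Submodule.inclusion inf_le_left) x) 1
    rw [contract_map (fun v w => rfl)] at h2
    rw [volVec_apply, ← h2]
    exact h1

/-- The intertwining operator defined by a volume element. -/
theorem exists_unitary_volVec [W'.HasOrthogonalProjection]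
    [FiniteDimensional ℂ (gapSpace W W')] (hW : W' ≤ W)
    {τ : ExteriorAlgebra ℂ (gapSpace W W')}
    (hτ : τ ∈ ⋀[ℂ]^(Module.finrank ℂ (gapSpace W W')) (gapSpace W W')) (hn : ‖τ‖ = 1) :
    ∃ T : PolFock W' ≃ₗᵢ[ℂ] PolFock W, T (vacuum W') = volVec W W' τ ∧
      ∀ f v, T ((quasiFree W').creation f v) = (quasiFree W).creation f (T v) :=
  (isVacuum_volVec hW hτ hn).exists_unitary
    (volVec_cyclic hτ (ne_zero_of_norm_eq_one hn))

/-- The vector on the left is built from the vacuum by creation operators, which `T` carries over to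
`W`; there they multiply the image `τ` of the vacuum. For three nested subspaces this makes
composition of intertwiners the wedge product of volume elements. -/
lemma creation_volVec {W'' : Submodule ℂ H} (hW : W' ≤ W) [W'.HasOrthogonalProjection]
    {T : PolFock W' ≃ₗᵢ[ℂ] PolFock W}
    (hT : ∀ f v, T ((quasiFree W').creation f v) = (quasiFree W).creation f (T v))
    {τ : ExteriorAlgebra ℂ (gapSpace W W')} (hτ : T (vacuum W') = volVec W W' τ)
    (y : ExteriorAlgebra ℂ (gapSpace W' W'')) :
    T (volVec W' W'' y) = polVec W
      (ExteriorAlgebra.map (Submodule.inclusion (inf_le_left.trans hW)) y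
        * ExteriorAlgebra.map (Submodule.inclusion inf_le_left) τ) 1 := by
  induction y using ext_induction with
  | h1 => 
    rw [map_one (ExteriorAlgebra.map _), one_mul, ← volVec_apply, ← hτ, volVec_apply,
      map_one (ExteriorAlgebra.map _)]
    rfl
  | hsmul c y hy =>
    rw [map_smul, map_smul, map_smul, hy, smul_mul_assoc, map_smul, LinearMap.smul_apply]
  | hadd y z hy hz =>
    rw [map_add, map_add, map_add, hy, hz, add_mul, map_add, LinearMap.add_apply]
  | hι f y hy =>
    rw [volVec_apply] at hy
    rw [volVec_apply, map_mul (ExteriorAlgebra.map _), map_mul (ExteriorAlgebra.map _),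
      ExteriorAlgebra.map_apply_ι, ExteriorAlgebra.map_apply_ι,
      ← creation_polVec, hT, hy, mul_assoc, ← creation_polVec]
    rfl

end Volume

/-! ### Spectral projections of operators with compact resolvent -/

section CFC

variable {H : Type*} [NormedAddCommGroup H] [InnerProductSpace ℂ H] [CompleteSpace H]

/-- The functional calculus acts on an eigenvector by the value at the eigenvalue. -/
lemma cfc_apply_eigenvector {S : H →L[ℂ] H} (hS : IsSelfAdjoint S) {f : ℝ → ℝ} (hf : Continuous f)
    {ν : ℝ} {v : H} (hv : S v = (ν : ℂ) • v) : cfc f S v = (f ν : ℂ) • v := by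
  rcases eq_or_ne v 0 with rfl | hv0
  · simp
  have hν : ν ∈ spectrum ℝ S := by
    rw [spectrum.mem_iff]
    rintro ⟨u, hu⟩
    refine hv0 ?_
    have h1 : (u : H →L[ℂ] H) v = 0 := by
      rw [hu, sub_apply, hv, Algebra.algebraMap_eq_smul_one]
      exact sub_self _
    have h2 : ((↑u⁻¹ : H →L[ℂ] H) * u) v = v := by rw [Units.inv_mul]; rfl
    rw [← h2, mul_apply_eq_comp, h1, map_zero]
  have key : ∀ g : C(spectrum ℝ S, ℝ), cfcHom hS g v = (g ⟨ν, hν⟩ : ℂ) • v := by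
    intro g
    -- Both sides are additive, multiplicative and continuous in `g`, so by Stone–Weierstrass
    -- constants and the identity function suffice.
    induction g using ContinuousMap.induction_on_of_compact with
    | const r =>
      have : ContinuousMap.const (spectrum ℝ S) r = algebraMap ℝ C(spectrum ℝ S, ℝ) r := rfl
      rw [this, AlgHomClass.commutes, Algebra.algebraMap_eq_smul_one]
      rfl
    | id => rw [cfcHom_id]; exact hv
    | star_id => rw [map_star, cfcHom_id, hS.star_eq]; exact hv
    | add g g' hg hg' =>
      rw [map_add, add_apply, hg, hg', ← add_smul, ContinuousMap.add_apply, Complex.ofReal_add]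
    | mul g g' hg hg' =>
      rw [map_mul, mul_apply_eq_comp, hg', map_smul, hg, smul_smul, ContinuousMap.mul_apply,
        Complex.ofReal_mul, mul_comm]
    | frequently g hg =>
      have hcl : IsClosed {g : C(spectrum ℝ S, ℝ) | cfcHom hS g v = (g ⟨ν, hν⟩ : ℂ) • v} := by
        have h1 := cfcHom_continuous hS (R := ℝ)
        refine isClosed_eq ?_ ?_
        · exact (ContinuousLinearMap.apply ℂ H v).continuous.comp h1
        · exact (Complex.continuous_ofReal.comp (continuous_eval_const _)).smul
            continuous_const
      exact hcl.closure_subset (mem_closure_iff_frequently.2 hg)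
  rw [cfc_apply f S hS]
  exact key _

/-- A closed subspace containing all the eigenvectors of a compact self-adjoint operator is
everything. -/
lemma mem_of_eigenvector_mem {S : H →L[ℂ] H} (hS : IsSelfAdjoint S) (hc : IsCompactOperator S)
    {N : Submodule ℂ H} (hN : IsClosed (N : Set H))
    (h : ∀ (ν : ℝ) v, S v = (ν : ℂ) • v → v ∈ N) (v : H) : v ∈ N := by
  have hsymm : (S : H →ₗ[ℂ] H).IsSymmetric := ContinuousLinearMap.isSelfAdjoint_iff_isSymmetric.1 hS
  have h1 : (⨆ μ, Module.End.eigenspace (S : Module.End ℂ H) μ) ≤ N := by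
    refine iSup_le fun μ v hv => ?_
    rcases eq_or_ne v 0 with rfl | hv0
    · exact N.zero_mem
    have hμ : conj μ = μ := hsymm.conj_eigenvalue_eq_self
      (Module.End.hasEigenvalue_of_hasEigenvector ⟨hv, hv0⟩)
    obtain ⟨ν, rfl⟩ := Complex.conj_eq_iff_real.1 hμ
    exact h ν v (Module.End.mem_eigenspace_iff.1 hv)
  have h2 := Submodule.orthogonal_le h1
  rw [ContinuousLinearMap.orthogonalComplement_iSup_eigenspaces_eq_bot hc hsymm, le_bot_iff] at h2
  have := hN.completeSpace_coe
  rw [Submodule.orthogonal_eq_bot_iff.1 h2]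
  trivial

omit [CompleteSpace H] in
-- The compact operator `p` restricts to the identity of the closed subspace `V`, and a space with
-- compact identity is finite-dimensional.
lemma finiteDimensional_of_compact_eq {p : H →L[ℂ] H} (hp : IsCompactOperator p)
    {V : Submodule ℂ H} (hV : IsClosed (V : Set H)) (h : ∀ v ∈ V, p v = v) :
    FiniteDimensional ℂ V := by
  rw [← isCompactOperator_id_iff_finiteDimensional (𝕜 := ℂ)]
  have h1 : ∀ v ∈ V, (p : H →ₗ[ℂ] H) v ∈ V := fun v hv => (h v hv).symm ▸ hv
  have h2 := IsCompactOperator.restrict (f := (p : H →ₗ[ℂ] H)) hp h1 hV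
  convert! h2 using 1
  ext v
  exact (h v v.2).symm

end CFC

/-! ### Resolvents of unbounded operators and projections onto spectral gaps -/

section Resolvent

variable {H : Type*} [NormedAddCommGroup H] [InnerProductSpace ℂ H]
  {D : H →ₗ.[ℂ] H} {z w : ℂ} {R S : H →L[ℂ] H}

/-- The resolvent identity: apply `S (D - w) = 1` to the vector `R v` of the domain. -/
lemma IsResolventAt.eq_add (hR : IsResolventAt D z R) (hS : IsResolventAt D w S) :
    R = S + (z - w) • (S * R) := by
  ext v
  obtain ⟨h, hv⟩ := hR.1 v
  have h1 := hS.2 ⟨R v, h⟩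
  have h2 : D ⟨R v, h⟩ - w • R v = v + (z - w) • R v := by
    rw [sub_eq_iff_eq_add.1 hv, sub_smul]
    abel
  simp only [h2, map_add, map_smul] at h1
  rw [← h1]
  simp

/-- The factors are `(D - w)(D - z)⁻¹` and `(D - z)(D - w)⁻¹`. Being mutually inverse, they express
one resolvent through the other by inversion of a bounded operator, which transports compactness and
continuity between spectral parameters. -/
lemma IsResolventAt.inv_mul (hR : IsResolventAt D z R) (hS : IsResolventAt D w S) :
    (1 + (z - w) • R) * (1 + (w - z) • S) = 1 := by
  have h := hS.eq_add hR
  have h' : S - R = (w - z) • (R * S) := by rw [sub_eq_iff_eq_add', ← h]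
  have : (1 + (z - w) • R) * (1 + (w - z) • S)
      = 1 + (w - z) • (S - R - (w - z) • (R * S)) := by
    simp only [mul_add, add_mul, one_mul, mul_one, smul_mul_assoc, mul_smul_comm, smul_sub,
      smul_smul]
    module
  rw [this, h', sub_self, smul_zero, add_zero]

lemma IsResolventAt.eq_mul_inverse (hR : IsResolventAt D z R) (hS : IsResolventAt D w S) :
    S = R * Ring.inverse (1 + (z - w) • R) := by
  have h1 := hR.inv_mul hS
  have h2 := hS.inv_mul hR
  have h3 : Ring.inverse (1 + (z - w) • R) = 1 + (w - z) • S :=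
    Ring.inverse_unit (⟨_, _, h1, h2⟩ : (H →L[ℂ] H)ˣ)
  rw [h3, mul_add, mul_one, mul_smul_comm]
  exact hS.eq_add hR

lemma IsResolventAt.isUnit (hR : IsResolventAt D z R) (hS : IsResolventAt D w S) :
    IsUnit (1 + (z - w) • R) :=
  ⟨⟨_, _, hR.inv_mul hS, hS.inv_mul hR⟩, rfl⟩

lemma IsResolventAt.compact (hR : IsResolventAt D z R) (hc : IsCompactOperator R)
    (hS : IsResolventAt D w S) : IsCompactOperator S := by
  rw [hR.eq_mul_inverse hS]
  exact hc.comp_clm _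

lemma IsResolventAt.eigenvector_of_resolvent (hS : IsResolventAt D w S) {ν : ℂ} (hν : ν ≠ 0)
    {v : H} (hv : S v = ν • v) : ∃ h : v ∈ D.domain, D ⟨v, h⟩ = (w + ν⁻¹) • v := by
  obtain ⟨h, hv'⟩ := hS.1 v
  have h1 : v ∈ D.domain := by
    have := D.domain.smul_mem ν⁻¹ h
    rwa [hv, smul_smul, inv_mul_cancel₀ hν, one_smul] at this
  refine ⟨h1, ?_⟩
  have h2 : D ⟨S v, h⟩ = ν • D ⟨v, h1⟩ := by
    rw [← LinearPMap.map_smul]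
    congr 1
    exact Subtype.ext hv
  rw [h2, hv, sub_eq_iff_eq_add] at hv'
  rw [← one_smul ℂ (D ⟨v, h1⟩), ← inv_mul_cancel₀ hν, mul_smul, hv']
  rw [smul_add, add_smul, smul_smul, smul_smul, add_comm]
  congr 2
  field_simp

lemma IsResolventAt.resolvent_eigenvector (hS : IsResolventAt D w S) {μ : ℂ} {v : H}
    (h : v ∈ D.domain) (hv : D ⟨v, h⟩ = μ • v) : (μ - w) • S v = v := by
  have := hS.2 ⟨v, h⟩
  rwa [hv, ← sub_smul, map_smul] at this

variable [CompleteSpace H]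

lemma inner_apply_of_isSelfAdjoint (hD : IsSelfAdjoint D) (u v : D.domain) :
    inner ℂ (D u) (v : H) = inner ℂ (u : H) (D v) := by
  have h := LinearPMap.adjoint_isFormalAdjoint hD.dense_domain
  rw [LinearPMap.isSelfAdjoint_def.1 hD] at h
  exact h u v

lemma IsResolventAt.isSelfAdjoint (hD : IsSelfAdjoint D) {a : ℝ} (hS : IsResolventAt D a S) :
    IsSelfAdjoint S := by
  rw [ContinuousLinearMap.isSelfAdjoint_iff_isSymmetric]
  intro u v
  obtain ⟨hu, hu'⟩ := hS.1 u
  obtain ⟨hv, hv'⟩ := hS.1 v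
  change inner ℂ (S u) v = inner ℂ u (S v)
  have h := inner_apply_of_isSelfAdjoint hD ⟨S u, hu⟩ ⟨S v, hv⟩
  have e1 := sub_eq_iff_eq_add.1 hu'
  have e2 := sub_eq_iff_eq_add.1 hv'
  rw [e1, e2] at h
  simp only [inner_add_left, inner_add_right, inner_smul_left, inner_smul_right,
    Complex.conj_ofReal] at h
  exact (add_right_cancel h).symm

lemma inner_eq_zero_of_eigenvectors (hD : IsSelfAdjoint D) {u v : H} (hu : u ∈ D.domain)
    (hv : v ∈ D.domain) {μ ν : ℝ} (hu' : D ⟨u, hu⟩ = (μ : ℂ) • u) (hv' : D ⟨v, hv⟩ = (ν : ℂ) • v)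
    (hne : μ ≠ ν) : inner ℂ u v = 0 := by
  have h := inner_apply_of_isSelfAdjoint hD ⟨u, hu⟩ ⟨v, hv⟩
  rw [hu', hv'] at h
  simp only [inner_smul_left, inner_smul_right, Complex.conj_ofReal] at h
  have h2 : ((μ : ℂ) - ν) * inner ℂ u v = 0 := by rw [sub_mul, h, sub_self]
  refine (mul_eq_zero.1 h2).resolve_left ?_
  exact sub_ne_zero.2 (by exact_mod_cast hne)

omit [CompleteSpace H] in
lemma mem_upperSpace {v : H} (h : v ∈ D.domain) {a μ : ℝ} (hμ : a < μ)
    (hv : D ⟨v, h⟩ = (μ : ℂ) • v) : v ∈ upperSpace D a :=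
  Submodule.le_topologicalClosure _ (Submodule.subset_span ⟨μ, hμ, h, hv⟩)

lemma mem_upperSpace_orthogonal (hD : IsSelfAdjoint D) {v : H} (h : v ∈ D.domain) {a μ : ℝ}
    (hμ : μ ≤ a) (hv : D ⟨v, h⟩ = (μ : ℂ) • v) : v ∈ (upperSpace D a)ᗮ := by
  rw [upperSpace, Submodule.orthogonal_closure]
  rw [Submodule.mem_orthogonal]
  intro u hu
  induction hu using Submodule.span_induction with
  | zero => exact inner_zero_left _
  | add x y _ _ hx hy => rw [inner_add_left, hx, hy, add_zero]
  | smul c x _ hx => rw [inner_smul_left, hx, mul_zero]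
  | mem u hu =>
    obtain ⟨ν, hν, hu, hu'⟩ := hu
    exact inner_eq_zero_of_eigenvectors hD hu h hu' hv (hμ.trans_lt hν).ne'

omit [CompleteSpace H] in
lemma upperSpace_mono {a b : ℝ} (hab : a ≤ b) : upperSpace D b ≤ upperSpace D a :=
  Submodule.topologicalClosure_mono (Submodule.span_mono fun _ ⟨μ, hμ, h⟩ =>
    ⟨μ, hab.trans_lt hμ, h⟩)

omit [CompleteSpace H] in
lemma isClosed_gapSpace (a b : ℝ) : IsClosed (gapSpace (upperSpace D a) (upperSpace D b) : Set H) :=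
  (Submodule.isClosed_topologicalClosure _).inter (Submodule.isClosed_orthogonal _)

/-- The continuous cut-off function which is `0` on `(-∞, c]` and `1` on `[c + 1/K, ∞)`. -/
def ramp (c K : ℝ) (t : ℝ) : ℝ := max 0 (min 1 (K * (t - c)))

lemma continuous_ramp (c K : ℝ) : Continuous (ramp c K) := by unfold ramp; fun_prop

lemma ramp_of_le {c K t : ℝ} (hK : 0 ≤ K) (h : t ≤ c) : ramp c K t = 0 :=
  max_eq_left ((min_le_right _ _).trans (mul_nonpos_of_nonneg_of_nonpos hK (sub_nonpos.2 h)))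

lemma ramp_of_ge {c K t : ℝ} (h : 1 ≤ K * (t - c)) : ramp c K t = 1 := by
  rw [ramp, min_eq_left h, max_eq_right zero_le_one]

/-- The spectral projection onto the gap between two points outside the spectrum is a continuous
function of the resolvent. -/
theorem cfc_resolvent_projection (hD : IsSelfAdjoint D) {a b : ℝ} (hab : a < b)
    {T : H →L[ℂ] H} (hS : IsResolventAt D a S) (hc : IsCompactOperator S)
    (hT : IsResolventAt D b T) {C : ℝ} (hC : ‖T‖ ≤ C) :
    IsCompactOperator ⇑(cfc (ramp (b - a)⁻¹ (C * (b - a) ^ 2)) S : H →L[ℂ] H) ∧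
      ∀ v, cfc (ramp (b - a)⁻¹ (C * (b - a) ^ 2)) S v
          ∈ gapSpace (upperSpace D a) (upperSpace D b) ∧
        v - cfc (ramp (b - a)⁻¹ (C * (b - a) ^ 2)) S v
          ∈ (gapSpace (upperSpace D a) (upperSpace D b))ᗮ := by
  have hba : 0 < b - a := sub_pos.2 hab
  have hC0 : 0 ≤ C := (norm_nonneg T).trans hC
  -- An eigenvalue `μ` of `D` corresponds to the eigenvalue `ν = (μ - a)⁻¹` of `S`, so `a < μ < b`
  -- means `ν > (b - a)⁻¹`.
  set c : ℝ := (b - a)⁻¹ with hcdef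
  have hcpos : 0 < c := inv_pos.2 hba
  -- The bound on `T` gives `C |μ - b| ≥ 1`. For `a < μ < b` this makes `ν - c = (b - μ) / ((μ -
  -- a)(b - a))` at least `1 / K`, so no eigenvalue of `S` lies on the slope of the ramp.
  set K : ℝ := C * (b - a) ^ 2 with hK
  have hK0 : 0 ≤ K := by positivity
  have hSA := hS.isSelfAdjoint hD
  set p := cfc (ramp c K) S with hp
  have hcompact : IsCompactOperator p := by
    -- The ramp vanishes up to `c > 0`, so it is `t` times a continuous function. Hence `p` is `S`
    -- times a bounded operator, and it inherits compactness.
    have hg : Continuous fun t => ramp c K t / max t c :=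
      (continuous_ramp c K).div (by fun_prop) fun t => (lt_max_of_lt_right hcpos).ne'
    have h1 : ramp c K = fun t => id t * (ramp c K t / max t c) := by
      funext t
      rcases le_total t c with h | h
      · rw [ramp_of_le hK0 h]; simp
      · rw [max_eq_left h, id]
        have : t ≠ 0 := (hcpos.trans_le h).ne'
        field_simp
    rw [hp, h1, cfc_mul id _ S continuous_id.continuousOn hg.continuousOn, cfc_id ℝ S]
    exact hc.comp_clm _
  -- The eigenvectors of `S` span a dense subspace, so the claims about `p` need only be checked on
  -- them.
  have hdich : ∀ (ν : ℝ) v, S v = (ν : ℂ) • v →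
      (v ∈ gapSpace (upperSpace D a) (upperSpace D b) ∧ p v = v) ∨
      (v ∈ (gapSpace (upperSpace D a) (upperSpace D b))ᗮ ∧ p v = 0) := by
    intro ν v hv
    have hpv := cfc_apply_eigenvector hSA (continuous_ramp c K) hv
    rcases eq_or_ne v 0 with rfl | hv0
    · exact Or.inl ⟨Submodule.zero_mem _, map_zero _⟩
    rcases eq_or_ne ν 0 with rfl | hν0
    · refine absurd ?_ hv0
      obtain ⟨h, h'⟩ := hS.1 v
      rw [Complex.ofReal_zero, zero_smul] at hv
      have : (⟨S v, h⟩ : D.domain) = 0 := Subtype.ext hv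
      rw [this, hv, LinearPMap.map_zero, smul_zero, sub_zero] at h'
      exact h'.symm
    obtain ⟨hd, hDv⟩ := hS.eigenvector_of_resolvent (Complex.ofReal_ne_zero.2 hν0) hv
    have hDv' : D ⟨v, hd⟩ = ((a + ν⁻¹ : ℝ) : ℂ) • v := by
      rw [hDv]; push_cast; rfl
    have hgap : 1 ≤ C * |a + ν⁻¹ - b| := by
      have h1 := hT.resolvent_eigenvector hd hDv'
      have h2 : ‖v‖ ≤ |a + ν⁻¹ - b| * (C * ‖v‖) := by
        calc ‖v‖ = ‖((a + ν⁻¹ : ℝ) - (b : ℝ) : ℂ) • T v‖ := by rw [h1]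
          _ = |a + ν⁻¹ - b| * ‖T v‖ := by
            rw [norm_smul, ← Complex.ofReal_sub, Complex.norm_real, Real.norm_eq_abs]
          _ ≤ _ := by gcongr; exact T.le_of_opNorm_le hC v
      have h3 : 0 < ‖v‖ := norm_pos_iff.2 hv0
      by_contra hlt
      push Not at hlt
      nlinarith
    by_cases hνc : ν ≤ c
    · right
      refine ⟨?_, by rw [hpv, ramp_of_le hK0 hνc]; simp⟩
      rcases hν0.lt_or_gt with hneg | hpos
      · have h1 : a + ν⁻¹ ≤ a := by linarith [inv_lt_zero.2 hneg]
        exact Submodule.orthogonal_le inf_le_left (mem_upperSpace_orthogonal hD hd h1 hDv')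
      · have h1 : b ≤ a + ν⁻¹ := by
          have : b - a ≤ ν⁻¹ := by
            rw [le_inv_comm₀ hba hpos]; exact hνc
          linarith
        -- `upperSpace D b` takes only eigenvalues strictly above `b`; equality is excluded because
        -- `b` is in the resolvent set.
        have h2 : b ≠ a + ν⁻¹ := by
          intro h
          rw [← h, sub_self, abs_zero, mul_zero] at hgap
          linarith
        have h3 : v ∈ upperSpace D b := mem_upperSpace hd (lt_of_le_of_ne h1 h2) hDv'
        exact Submodule.orthogonal_le inf_le_right (Submodule.le_orthogonal_orthogonal _ h3)
    · left
      push Not at hνc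
      have hνpos : 0 < ν := hcpos.trans hνc
      have hinv : 0 < ν⁻¹ := inv_pos.2 hνpos
      have h1 : ν⁻¹ < b - a := by rw [inv_lt_comm₀ hνpos hba]; exact hνc
      refine ⟨⟨mem_upperSpace hd (by linarith) hDv',
        mem_upperSpace_orthogonal hD hd (by linarith) hDv'⟩, ?_⟩
      have h2 : 1 ≤ K * (ν - c) := by
        rw [abs_of_neg (by linarith)] at hgap
        have h3 : K * (ν - c) = C * -(a + ν⁻¹ - b) * ((b - a) * ν) := by
          rw [hK, hcdef]
          field_simp
          ring
        have h4 : 1 ≤ (b - a) * ν := by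
          rw [hcdef, inv_lt_iff_one_lt_mul₀ hba] at hνc
          linarith
        rw [h3]
        exact one_le_mul_of_one_le_of_one_le hgap h4
      rw [hpv, ramp_of_ge h2]; simp
  refine ⟨hcompact, fun v => ⟨?_, ?_⟩⟩
  · refine mem_of_eigenvector_mem hSA hc
      (N := (gapSpace (upperSpace D a) (upperSpace D b)).comap (p : H →ₗ[ℂ] H))
      ((isClosed_gapSpace a b).preimage p.continuous) (fun ν u hu => ?_) v
    rw [Submodule.mem_comap]
    rcases hdich ν u hu with ⟨h1, h2⟩ | ⟨h1, h2⟩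
    · exact h2.symm ▸ h1
    · exact h2.symm ▸ Submodule.zero_mem _
  · refine mem_of_eigenvector_mem hSA hc
      (N := (gapSpace (upperSpace D a) (upperSpace D b))ᗮ.comap ((1 - p : H →L[ℂ] H) : H →ₗ[ℂ] H))
      ((Submodule.isClosed_orthogonal _).preimage (1 - p).continuous) (fun ν u hu => ?_) v
    rw [Submodule.mem_comap]
    change u - p u ∈ _
    rcases hdich ν u hu with ⟨h1, h2⟩ | ⟨h1, h2⟩
    · rw [h2, sub_self]; exact Submodule.zero_mem _
    · rw [h2, sub_zero]; exact h1

end Resolvent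

/-! ### Continuity of the spectral projections -/

section Continuity

variable {H : Type*} [NormedAddCommGroup H] [InnerProductSpace ℂ H] [CompleteSpace H]

/-- Continuity is assumed at `i` only. At `w` the resolvent is `R (1 + (i - w) R)⁻¹`, and inversion
is continuous at units. -/
lemma continuous_resolvent {X : Type*} [TopologicalSpace X] {D : X → H →ₗ.[ℂ] H}
    (hcont : NormResolventContinuous D) {w : ℂ} {S : X → H →L[ℂ] H}
    (hS : ∀ x, IsResolventAt (D x) w (S x)) : Continuous S := by
  obtain ⟨R, hR, hRx⟩ := hcont
  have h1 : S = fun x => R x * Ring.inverse (1 + (Complex.I - w) • R x) :=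
    funext fun x => (hRx x).eq_mul_inverse (hS x)
  rw [h1, continuous_iff_continuousAt]
  intro x
  obtain ⟨u, hu⟩ := (hRx x).isUnit (hS x)
  have h2 : ContinuousAt Ring.inverse (1 + (Complex.I - w) • R x) :=
    hu ▸ NormedRing.inverse_continuousAt u
  exact hR.continuousAt.mul (ContinuousAt.comp (f := fun x => 1 + (Complex.I - w) • R x) h2
    (by fun_prop))

/-- The cut-off function depends on a bound `C` for `‖T x‖`, but the resulting operator does not,
being the orthogonal projection onto the gap. Near a given `x` the constant bound `‖T x‖ + 1` works,
and for a fixed function the functional calculus is continuous in the operator. -/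
theorem exists_continuous_projection {X : Type*} [TopologicalSpace X] {D : X → H →ₗ.[ℂ] H}
    (hself : ∀ x, IsSelfAdjoint (D x)) (hcomp : ∀ x, HasCompactResolvent (D x))
    (hcont : NormResolventContinuous D) {a b : ℝ} (hab : a < b)
    (ha : ∀ x, (a : ℂ) ∉ opSpectrum (D x)) (hb : ∀ x, (b : ℂ) ∉ opSpectrum (D x)) :
    ∃ p : X → H →L[ℂ] H, Continuous p ∧
      (∀ x v, p x v ∈ gapSpace (upperSpace (D x) a) (upperSpace (D x) b)) ∧
      (∀ x, ∀ v ∈ gapSpace (upperSpace (D x) a) (upperSpace (D x) b), p x v = v) ∧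
      ∀ x, FiniteDimensional ℂ (gapSpace (upperSpace (D x) a) (upperSpace (D x) b)) := by
  have ha' : ∀ x, ∃ S, IsResolventAt (D x) a S := fun x => not_not.1 (ha x)
  have hb' : ∀ x, ∃ S, IsResolventAt (D x) b S := fun x => not_not.1 (hb x)
  choose S hS using ha'
  choose T hT using hb'
  have hSc : ∀ x, IsCompactOperator (S x) := fun x => by
    obtain ⟨z, R, hR, hc⟩ := hcomp x
    exact hR.compact hc (hS x)
  have hScont := continuous_resolvent hcont hS
  have hTcont := continuous_resolvent hcont hT
  let P : ℝ → X → H →L[ℂ] H := fun C x => cfc (ramp (b - a)⁻¹ (C * (b - a) ^ 2)) (S x)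
  have hP : ∀ C x, ‖T x‖ ≤ C → _ := fun C x hC =>
    cfc_resolvent_projection (hself x) hab (hS x) (hSc x) (hT x) hC
  have huniq : ∀ C C' x, ‖T x‖ ≤ C → ‖T x‖ ≤ C' → P C x = P C' x := by
    intro C C' x hC hC'
    ext v
    have h1 := (hP C x hC).2 v
    have h2 := (hP C' x hC').2 v
    have h3 := Submodule.sub_mem _ h1.1 h2.1
    have h4 := Submodule.sub_mem _ h2.2 h1.2
    rw [sub_sub_sub_cancel_left] at h4
    have := Submodule.inner_right_of_mem_orthogonal h3 h4
    exact sub_eq_zero.1 (inner_self_eq_zero.1 this)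
  have hid : ∀ x, ∀ v ∈ gapSpace (upperSpace (D x) a) (upperSpace (D x) b), P ‖T x‖ x v = v := by
    intro x v hv
    have h1 := (hP _ x le_rfl).2 v
    have h3 := Submodule.sub_mem _ hv h1.1
    have := Submodule.inner_right_of_mem_orthogonal h3 h1.2
    exact (sub_eq_zero.1 (inner_self_eq_zero.1 this)).symm
  refine ⟨fun x => P ‖T x‖ x, ?_, fun x v => ((hP _ x le_rfl).2 v).1, hid, fun x =>
    finiteDimensional_of_compact_eq (hP _ x le_rfl).1 (isClosed_gapSpace a b) (hid x)⟩
  rw [continuous_iff_continuousAt]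
  intro x
  have h1 : Continuous (P (‖T x‖ + 1)) :=
    Continuous.cfc_of_mem_nhdsSet (s := Set.univ) _ Filter.univ_mem hScont
      (fun x => (hS x).isSelfAdjoint (hself x)) (continuous_ramp _ _).continuousOn
  refine h1.continuousAt.congr ?_
  have h2 : ∀ᶠ y in nhds x, ‖T y‖ < ‖T x‖ + 1 :=
    hTcont.norm.continuousAt.eventually_lt continuousAt_const (by simp)
  filter_upwards [h2] with y hy
  exact huniq _ _ y hy.le le_rfl

end Continuity

/-! ### Frames of families of projections over contractible spaces -/

section Frame

variable {H : Type*} [NormedAddCommGroup H] [NormedSpace ℂ H]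

lemma eq_zero_of_norm_sub_lt_one {p q : H →L[ℂ] H} (h : ‖p - q‖ < 1) {w : H} (hp : p w = w)
    (hq : q w = 0) : w = 0 := by
  by_contra hw
  have h1 : (p - q) w = w := by rw [sub_apply, hp, hq, sub_zero]
  have h2 := (p - q).le_opNorm w
  rw [h1] at h2
  have h3 : 0 < ‖w‖ := norm_pos_iff.2 hw
  nlinarith

/-- `q` is injective on `V`: a vector fixed by `p` and killed by `q` would be fixed by `p - q`, of
norm less than one. -/
lemma finrank_le_of_norm_sub_lt_one {p q : H →L[ℂ] H} (h : ‖p - q‖ < 1) {V W : Submodule ℂ H}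
    [FiniteDimensional ℂ W] (hp : ∀ v ∈ V, p v = v) (hq : ∀ v, q v ∈ W) :
    Module.finrank ℂ V ≤ Module.finrank ℂ W := by
  let f : V →ₗ[ℂ] W := (q.toLinearMap ∘ₗ V.subtype).codRestrict W fun v => hq v
  refine LinearMap.finrank_le_finrank_of_injective (f := f) ?_
  rw [← LinearMap.ker_eq_bot, LinearMap.ker_eq_bot']
  intro v hv
  exact Subtype.ext (eq_zero_of_norm_sub_lt_one h (hp v v.2) (congrArg Subtype.val hv))

/-- Successive application of the operators `q (δ), q (2δ), …`. -/
def transport (q : ℝ → H →L[ℂ] H) (δ : ℝ) : ℕ → H →L[ℂ] H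
  | 0 => 1
  | n + 1 => q ((n + 1 : ℕ) * δ) * transport q δ n

/-- Each path `c x` is uniformly continuous, and a step for `1/4` at `x` works for the bound `1` at
nearby points, by three estimates of `1/4`. Admissible steps form a convex set, so a partition of
unity glues local constants. -/
lemma exists_continuous_step {X E : Type*} [TopologicalSpace X] [ParacompactSpace X] [T2Space X]
    [NormedAddCommGroup E] (c : C(X, C(unitInterval, E))) :
    ∃ δ : C(X, ℝ), ∀ x, 0 < δ x ∧ ∀ s t : ℝ, |s - t| ≤ δ x →
      ‖c x (Set.projIcc 0 1 zero_le_one s) - c x (Set.projIcc 0 1 zero_le_one t)‖ < 1 := by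
  refine exists_continuous_forall_mem_convex_of_local_const
    (t := fun x => {d : ℝ | 0 < d ∧ ∀ s t : ℝ, |s - t| ≤ d →
      ‖c x (Set.projIcc 0 1 zero_le_one s) - c x (Set.projIcc 0 1 zero_le_one t)‖ < 1})
    (fun x => ?_) (fun x => ?_)
  · refine Set.OrdConnected.convex ⟨fun d hd d' hd' e he => ⟨hd.1.trans_le he.1, fun s t hst =>
      hd'.2 s t (hst.trans he.2)⟩⟩
  · have hu := CompactSpace.uniformContinuous_of_continuous (c x).continuous
    rw [Metric.uniformContinuous_iff] at hu
    obtain ⟨d, hd, hd'⟩ := hu (1 / 4) (by norm_num)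
    refine ⟨d / 2, ?_⟩
    have h1 : ∀ᶠ y in nhds x, dist (c y) (c x) < 1 / 4 :=
      (Metric.tendsto_nhds.1 c.continuous.continuousAt) (1 / 4) (by norm_num)
    filter_upwards [h1] with y hy
    refine ⟨by positivity, fun s t hst => ?_⟩
    set s' := Set.projIcc (0 : ℝ) 1 zero_le_one s
    set t' := Set.projIcc (0 : ℝ) 1 zero_le_one t
    have h2 : dist s' t' < d := by
      rw [Subtype.dist_eq, Real.dist_eq]
      exact ((Set.abs_projIcc_sub_projIcc zero_le_one).trans hst).trans_lt (by linarith)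
    have h3 := hd' h2
    have h4 := (ContinuousMap.dist_apply_le_dist (f := c y) (g := c x) s').trans_lt hy
    have h5 := (ContinuousMap.dist_apply_le_dist (f := c y) (g := c x) t').trans_lt hy
    have h6 := dist_triangle4 (c y s') (c x s') (c x t') (c y t')
    rw [dist_comm (c x t')] at h6
    rw [← dist_eq_norm]
    linarith

/-- A basis at the centre `y` of the contraction is carried along the path from `y` to `x` by
applying the projections at times `δ x, 2 δ x, …`. Consecutive projections differ by less than one
in norm, so every step is injective and preserves the rank. Beyond time `1` the path rests at `x`
and further steps change nothing. -/
theorem exists_continuous_frame {X : Type*} [TopologicalSpace X] [ContractibleSpace X]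
    [ParacompactSpace X] [T2Space X] {V : X → Submodule ℂ H} [∀ x, FiniteDimensional ℂ (V x)]
    {p : X → H →L[ℂ] H} (hp : Continuous p) (hpV : ∀ x v, p x v ∈ V x)
    (hpid : ∀ x, ∀ v ∈ V x, p x v = v) :
    ∃ (k : ℕ) (v : Fin k → X → H), (∀ i, Continuous (v i)) ∧ ∀ x, Module.finrank ℂ (V x) = k ∧
      (∀ i, v i x ∈ V x) ∧ LinearIndependent ℂ fun i => v i x := by
  obtain ⟨y, ⟨G'⟩⟩ := id_nullhomotopic X
  let G := G'.symm
  have hG0 : ∀ x, G (0, x) = y := fun x => G.map_zero_left x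
  have hG1 : ∀ x, G (1, x) = x := fun x => G.map_one_left x
  let c : C(X, C(unitInterval, H →L[ℂ] H)) :=
    ContinuousMap.curry ⟨fun z : X × unitInterval => p (G (z.2, z.1)), by fun_prop⟩
  have hc : ∀ x s, c x s = p (G (s, x)) := fun x s => rfl
  obtain ⟨δ, hδ⟩ := exists_continuous_step c
  let pt : ℝ → X → X := fun t x => G (Set.projIcc 0 1 zero_le_one t, x)
  have hpt0 : ∀ x, pt 0 x = y := fun x => by
    simp only [pt, Set.projIcc_left]; exact hG0 x
  have hpt1 : ∀ t x, 1 ≤ t → pt t x = x := fun t x ht => by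
    simp only [pt, Set.projIcc_of_right_le _ ht]; exact hG1 x
  have hclose : ∀ (n : ℕ) x, ‖p (pt (n * δ x) x) - p (pt ((n + 1 : ℕ) * δ x) x)‖ < 1 := by
    intro n x
    refine (hδ x).2 _ _ ?_
    push_cast
    rw [show (n : ℝ) * δ x - (n + 1) * δ x = -δ x by ring, abs_neg, abs_of_pos (hδ x).1]
  let τ : ℕ → X → H →L[ℂ] H := fun n x => transport (fun t => p (pt t x)) (δ x) n
  have hτs : ∀ n x, τ (n + 1) x = p (pt ((n + 1 : ℕ) * δ x) x) * τ n x := fun n x => rfl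
  have hτcont : ∀ n, Continuous (τ n) := by
    intro n
    induction n with
    | zero => exact continuous_const
    | succ n ih =>
      have : Continuous fun x => p (pt ((n + 1 : ℕ) * δ x) x) := by
        simp only [pt]
        have := continuous_projIcc (a := (0 : ℝ)) (b := 1) (h := zero_le_one)
        fun_prop
      exact this.mul ih
  have hτmem : ∀ (n : ℕ) x, ∀ w ∈ V y, τ n x w ∈ V (pt (n * δ x) x) := by
    intro n x w hw
    cases n with
    | zero => rw [Nat.cast_zero, zero_mul, hpt0]; exact hw
    | succ n => exact hpV _ _
  have hτinj : ∀ n x, ∀ w ∈ V y, τ n x w = 0 → w = 0 := by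
    intro n x w hw
    induction n with
    | zero => exact id
    | succ n ih =>
      intro h
      exact ih (eq_zero_of_norm_sub_lt_one (hclose n x) (hpid _ _ (hτmem n x w hw)) h)
  have hrank : ∀ (n : ℕ) x, Module.finrank ℂ (V (pt (n * δ x) x)) = Module.finrank ℂ (V y) := by
    intro n x
    induction n with
    | zero => rw [Nat.cast_zero, zero_mul, hpt0]
    | succ n ih =>
      rw [← ih]
      refine le_antisymm ?_ ?_
      · refine finrank_le_of_norm_sub_lt_one ?_ (hpid _) (hpV _)
        rw [norm_sub_rev]
        exact hclose n x
      · exact finrank_le_of_norm_sub_lt_one (hclose n x) (hpid _) (hpV _)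
  have hstab : ∀ (n m : ℕ) x, 1 ≤ n * δ x → n ≤ m → ∀ w ∈ V y, τ m x w = τ n x w := by
    intro n m x hn hnm w hw
    induction m, hnm using Nat.le_induction with
    | base => rfl
    | succ m hnm ih =>
      have h1 : 1 ≤ (m : ℝ) * δ x := hn.trans (by have := (hδ x).1; gcongr)
      have h2 : 1 ≤ ((m + 1 : ℕ) : ℝ) * δ x :=
        h1.trans (by have := (hδ x).1; push_cast; gcongr; linarith)
      have h3 := hτmem m x w hw
      rw [hpt1 _ _ h1] at h3
      rw [hτs, mul_apply_eq_comp, hpt1 _ _ h2, hpid _ _ h3, ih]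
  let N : X → ℕ := fun x => ⌈(δ x)⁻¹⌉₊
  have hN : ∀ x (n : ℕ), (δ x)⁻¹ ≤ n → 1 ≤ n * δ x := fun x n h => by
    rwa [inv_le_iff_one_le_mul₀ (hδ x).1] at h
  have hN' : ∀ x, 1 ≤ N x * δ x := fun x => hN x _ (Nat.le_ceil _)
  let b := Module.finBasis ℂ (V y)
  refine ⟨_, fun i x => τ (N x) x (b i), fun i => ?_, fun x => ⟨?_, fun i => ?_, ?_⟩⟩
  · rw [continuous_iff_continuousAt]
    intro x
    -- The number of steps `N` jumps with the point. One `n` suffices for all points near `x`, and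
    -- by `hstab` it gives the same vectors.
    obtain ⟨n, hn⟩ := exists_nat_gt (δ x)⁻¹
    have h1 : ContinuousAt (fun z => τ n z (b i)) x := by
      have := hτcont n
      fun_prop
    refine h1.congr ?_
    have h2 : ∀ᶠ z in nhds x, (δ z)⁻¹ < n :=
      (δ.continuous.continuousAt.inv₀ (hδ x).1.ne').eventually_lt continuousAt_const hn
    filter_upwards [h2] with z hz
    exact hstab (N z) n z (hN' z) (Nat.ceil_le.2 hz.le) _ (b i).2
  · have := hrank (N x) x
    rwa [hpt1 _ _ (hN' x)] at this
  · have := hτmem (N x) x _ (b i).2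
    rwa [hpt1 _ _ (hN' x)] at this
  · refine b.linearIndependent.map' ((τ (N x) x).toLinearMap ∘ₗ (V y).subtype) ?_
    rw [LinearMap.ker_eq_bot']
    exact fun w hw => Subtype.ext (hτinj _ x w w.2 hw)

end Frame

/-! ### Continuity of products in the exterior algebra -/

section Product

variable {K : Type*} [NormedAddCommGroup K] [InnerProductSpace ℂ K]

lemma norm_smul_exterior (c : ℂ) (x : ExteriorAlgebra ℂ K) : ‖c • x‖ = ‖c‖ * ‖x‖ :=
  norm_smul c x

lemma norm_ι_mul_le (f : K) (x : ExteriorAlgebra ℂ K) :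
    ‖ExteriorAlgebra.ι ℂ f * x‖ ≤ ‖f‖ * ‖x‖ := by
  refine le_of_sq_le_sq ?_ (by positivity)
  rw [← norm_sq_wedge_add]
  linarith [sq_nonneg ‖contract f x‖]

/-- The exterior multiplication as a continuous bilinear map. -/
def wedgeL : K →L[ℂ] ExteriorAlgebra ℂ K →L[ℂ] ExteriorAlgebra ℂ K :=
  LinearMap.mkContinuous₂ (LinearMap.mk₂ ℂ (fun f x => ExteriorAlgebra.ι ℂ f * x)
    (fun f g x => by rw [map_add, add_mul])
    (fun c f x => by rw [map_smul, smul_mul_assoc])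
    (fun f x y => by rw [mul_add])
    (fun c f x => by rw [mul_smul_comm])) 1
    fun f x => by rw [one_mul]; exact norm_ι_mul_le f x

lemma continuous_ιMulti {X : Type*} [TopologicalSpace X] {k : ℕ} {v : Fin k → X → K}
    (hv : ∀ i, Continuous (v i)) :
    Continuous fun x => ExteriorAlgebra.ιMulti ℂ k fun i => v i x := by
  induction k with
  | zero => simp only [ExteriorAlgebra.ιMulti_zero_apply]; exact continuous_const
  | succ k ih =>
    simp only [ExteriorAlgebra.ιMulti_succ_apply]
    have h1 := ih (v := fun i => v i.succ) fun i => hv _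
    have h2 := hv 0
    have h3 : Continuous fun x => wedgeL (v 0 x) (ExteriorAlgebra.ιMulti ℂ k fun i => v i.succ x) := by
      fun_prop
    exact h3

lemma mul_ι (x : ExteriorAlgebra ℂ K) (f : K) :
    x * ExteriorAlgebra.ι ℂ f = ExteriorAlgebra.ι ℂ f * CliffordAlgebra.involute x := by
  induction x using ext_induction with
  | h1 => rw [map_one, one_mul, mul_one]
  | hsmul c x hx => rw [map_smul, smul_mul_assoc, mul_smul_comm, hx]
  | hadd x y hx hy => rw [map_add, mul_add, add_mul, hx, hy]
  | hι g x hx => rw [mul_assoc, hx, involute_ι_mul, mul_neg, ι_mul_ι_mul_comm]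

/-- Right multiplication by a vector is parity followed by left multiplication, both bounded. The
argument is for fixed `b`; when both factors vary, `continuous_mul_of_contraction` is used. -/
lemma continuous_mul_right (b : ExteriorAlgebra ℂ K) :
    Continuous fun x : ExteriorAlgebra ℂ K => x * b := by
  induction b using ext_induction with
  | h1 => simpa using! continuous_id
  | hsmul c b hb =>
    simp only [mul_smul_comm]
    exact hb.const_smul c
  | hadd a b ha hb =>
    simp only [mul_add]
    exact ha.add hb
  | hι f b hb =>
    simp only [← mul_assoc, mul_ι]
    have h1 : Continuous fun x : ExteriorAlgebra ℂ K => wedgeOp f (parityOp x) := by fun_prop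
    exact hb.comp h1

lemma norm_ιMulti_mul_le {k : ℕ} {v : Fin k → K} (hv : ∀ i, ‖v i‖ ≤ 1) (x : ExteriorAlgebra ℂ K) :
    ‖ExteriorAlgebra.ιMulti ℂ k v * x‖ ≤ ‖x‖ := by
  induction k with
  | zero => rw [ExteriorAlgebra.ιMulti_zero_apply, one_mul]
  | succ k ih =>
    rw [ExteriorAlgebra.ιMulti_succ_apply, mul_assoc]
    refine (norm_ι_mul_le _ _).trans ?_
    refine (mul_le_of_le_one_left (norm_nonneg _) (hv 0)).trans ?_
    exact ih (v := Matrix.vecTail v) fun i => hv _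

lemma contract_ιMulti_of_orthogonal {k : ℕ} {v : Fin k → K} {f : K}
    (hv : ∀ i, inner ℂ f (v i) = 0) : contract f (ExteriorAlgebra.ιMulti ℂ k v) = 0 := by
  induction k with
  | zero => rw [ExteriorAlgebra.ιMulti_zero_apply, contract_one]
  | succ k ih =>
    rw [ExteriorAlgebra.ιMulti_succ_apply, contract_ι_mul, hv, ih (v := Matrix.vecTail v) fun i => hv _,
      zero_smul, mul_zero, sub_zero]

lemma norm_ιMulti_orthonormal {k : ℕ} {v : Fin k → K} (hv : Orthonormal ℂ v) :
    ‖ExteriorAlgebra.ιMulti ℂ k v‖ = 1 := by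
  induction k with
  | zero => rw [ExteriorAlgebra.ιMulti_zero_apply, norm_one_exterior]
  | succ k ih =>
    rw [ExteriorAlgebra.ιMulti_succ_apply]
    have h1 := norm_sq_wedge_add (v 0) (ExteriorAlgebra.ιMulti ℂ k (Matrix.vecTail v))
    have h2 : contract (v 0) (ExteriorAlgebra.ιMulti ℂ k (Matrix.vecTail v)) = 0 :=
      contract_ιMulti_of_orthogonal fun i => hv.2 (Fin.succ_ne_zero i).symm
    have h3 := ih (v := Matrix.vecTail v) (hv.comp _ (Fin.succ_injective k))
    rw [h2, h3, hv.1 0] at h1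
    have h4 : ‖(0 : ExteriorAlgebra ℂ K)‖ = 0 := norm_zero
    rw [h4] at h1
    refine (pow_eq_one_iff_of_nonneg (norm_nonneg _) two_ne_zero).1 ?_
    exact (eq_sub_of_add_eq h1).trans (by norm_num)

lemma ιMulti_mem_top (k : ℕ) (v : Fin k → K) : ExteriorAlgebra.ιMulti ℂ k v ∈ ⋀[ℂ]^k K :=
  (exteriorPower.ιMulti ℂ k v).2

/-- The determinant relative to the basis `v`, as a linear form on the top power, takes the value
`1`. -/
lemma ιMulti_ne_zero {k : ℕ} (hk : Module.finrank ℂ K = k) {v : Fin k → K}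
    (hv : LinearIndependent ℂ v) : ExteriorAlgebra.ιMulti ℂ k v ≠ 0 := by
  cases k with
  | zero => rw [ExteriorAlgebra.ιMulti_zero_apply]; exact one_ne_zero
  | succ k =>
    intro h
    let b := basisOfLinearIndependentOfCardEqFinrank hv (by simp [hk])
    have h1 : exteriorPower.alternatingMapLinearEquiv b.det (exteriorPower.ιMulti ℂ _ v)
        = b.det v := exteriorPower.alternatingMapLinearEquiv_apply_ιMulti _ _
    have h2 : exteriorPower.ιMulti ℂ (k + 1) v = 0 := Subtype.ext h
    have h3 : ⇑b = v := coe_basisOfLinearIndependentOfCardEqFinrank hv _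
    rw [h2, map_zero, ← h3, b.det_self] at h1
    exact zero_ne_one h1

/-- The product with a volume element of a subspace does not increase the norm. -/
lemma norm_top_mul_le {L : Type*} [NormedAddCommGroup L] [InnerProductSpace ℂ L]
    [FiniteDimensional ℂ L] (j : L →ₗ[ℂ] K) (hj : ∀ v w, inner ℂ (j v) (j w) = inner ℂ v w)
    {a : ExteriorAlgebra ℂ L} (ha : a ∈ ⋀[ℂ]^(Module.finrank ℂ L) L) (hn : ‖a‖ = 1)
    (x : ExteriorAlgebra ℂ K) : ‖ExteriorAlgebra.map j a * x‖ ≤ ‖x‖ := by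
  let e := stdOrthonormalBasis ℂ L
  have h0 := norm_ιMulti_orthonormal e.orthonormal
  have h1 : exteriorPower.ιMulti ℂ (Module.finrank ℂ L) e ≠ 0 := fun h =>
    ne_zero_of_norm_eq_one h0 (congrArg Subtype.val h)
  -- The top power is a line, so `a` is a phase times the product of an orthonormal basis, and each
  -- unit vector multiplies with norm at most one.
  have h2 : Module.finrank ℂ (⋀[ℂ]^(Module.finrank ℂ L) L) = 1 := by
    rw [exteriorPower.finrank_eq, Nat.choose_self]
  obtain ⟨c, hc⟩ := (finrank_eq_one_iff_of_nonzero' _ h1).1 h2 ⟨a, ha⟩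
  have hc' : a = c • ExteriorAlgebra.ιMulti ℂ _ e := (congrArg Subtype.val hc).symm
  have hc1 : ‖c‖ = 1 := by
    have h3 := norm_smul_exterior c (ExteriorAlgebra.ιMulti ℂ _ e)
    rw [← hc', h0, hn, mul_one] at h3
    exact h3.symm
  rw [hc', map_smul, ExteriorAlgebra.map_apply_ιMulti, smul_mul_assoc]
  refine (norm_smul_exterior _ _).le.trans ?_
  rw [hc1, one_mul]
  refine norm_ιMulti_mul_le (fun i => ?_) x
  have : ‖j (e i)‖ = ‖e i‖ := by
    rw [@norm_eq_sqrt_re_inner ℂ, hj, ← @norm_eq_sqrt_re_inner ℂ]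
  exact (this.trans (e.orthonormal.1 i)).le

/-- Split `a y * b y` as `a y * (b y - b x) + a y * b x`. The contraction bound controls the first
term, and right multiplication by the fixed `b x` the second. -/
lemma continuous_mul_of_contraction {X : Type*} [TopologicalSpace X]
    {a b : X → ExteriorAlgebra ℂ K} (ha : Continuous a) (hb : Continuous b)
    (h : ∀ x y, ‖a x * y‖ ≤ ‖y‖) : Continuous fun x => a x * b x := by
  rw [continuous_iff_continuousAt]
  intro x
  have h1 : Filter.Tendsto (fun y => a y * b x) (nhds x) (nhds (a x * b x)) :=
    ((continuous_mul_right (b x)).comp ha).continuousAt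
  have h2 : Filter.Tendsto (fun y => a y * (b y - b x)) (nhds x) (nhds 0) := by
    refine squeeze_zero_norm (a := fun y => ‖b y - b x‖) (fun y => h y _) ?_
    exact tendsto_iff_norm_sub_tendsto_zero.1 hb.continuousAt
  have h3 := h2.add h1
  rw [zero_add] at h3
  refine h3.congr fun y => ?_
  rw [mul_sub, sub_add_cancel]

end Product

/-! ### Existence of volume elements -/

section Existence

variable {H : Type*} [NormedAddCommGroup H] [InnerProductSpace ℂ H]

theorem exists_continuous_top {X : Type*} [TopologicalSpace X] [ContractibleSpace X]
    [ParacompactSpace X] [T2Space X] {V : X → Submodule ℂ H} [∀ x, FiniteDimensional ℂ (V x)]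
    {p : X → H →L[ℂ] H} (hp : Continuous p) (hpV : ∀ x v, p x v ∈ V x)
    (hpid : ∀ x, ∀ v ∈ V x, p x v = v) :
    ∃ τ : ∀ x, ExteriorAlgebra ℂ (V x),
      (∀ x, τ x ∈ ⋀[ℂ]^(Module.finrank ℂ (V x)) (V x)) ∧ (∀ x, ‖τ x‖ = 1) ∧
      Continuous fun x => ExteriorAlgebra.map (V x).subtype (τ x) := by
  obtain ⟨k, v, hv, h⟩ := exists_continuous_frame hp hpV hpid
  let v' : ∀ x, Fin k → V x := fun x i => ⟨v i x, (h x).2.1 i⟩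
  have hli : ∀ x, LinearIndependent ℂ (v' x) := fun x =>
    LinearIndependent.of_comp (V x).subtype (h x).2.2
  let η : ∀ x, ExteriorAlgebra ℂ (V x) := fun x => ExteriorAlgebra.ιMulti ℂ k (v' x)
  have hη : ∀ x, η x ≠ 0 := fun x => ιMulti_ne_zero (h x).1 (hli x)
  have hmap : ∀ x, ExteriorAlgebra.map (V x).subtype (η x)
      = ExteriorAlgebra.ιMulti ℂ k fun i => v i x := fun x =>
    ExteriorAlgebra.map_apply_ιMulti _ _
  have hnorm : ∀ x, ‖η x‖ = ‖ExteriorAlgebra.ιMulti ℂ k fun i => v i x‖ := fun x => by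
    rw [← hmap, norm_map (L := (V x).subtype) fun v w => rfl]
  have hpos : ∀ x, ‖η x‖ ≠ 0 := fun x h0 => hη x (norm_eq_zero.1 h0)
  have hc := continuous_ιMulti hv
  refine ⟨fun x => ((‖η x‖⁻¹ : ℝ) : ℂ) • η x, fun x => ?_, fun x => ?_, ?_⟩
  · refine Submodule.smul_mem _ _ ?_
    rw [(h x).1]
    exact ιMulti_mem_top k _
  · refine (norm_smul_exterior _ _).trans ?_
    rw [Complex.norm_real, Real.norm_eq_abs, abs_of_nonneg (inv_nonneg.2 (norm_nonneg _)),
      inv_mul_cancel₀ (hpos x)]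
  · simp only [map_smul, hmap]
    refine Continuous.smul (Complex.continuous_ofReal.comp (Continuous.inv₀ ?_ hpos)) hc
    simp only [hnorm]
    exact hc.norm

lemma gapSpace_self (W : Submodule ℂ H) : gapSpace W W = ⊥ := W.inf_orthogonal_eq_bot

variable [CompleteSpace H]

lemma finiteDimensional_gapSpace {D : H →ₗ.[ℂ] H} (hself : IsSelfAdjoint D)
    (hcomp : HasCompactResolvent D) (hcont : ∃ R, IsResolventAt D Complex.I R) {a b : ℝ}
    (hab : a ≤ b) (ha : (a : ℂ) ∉ opSpectrum D) (hb : (b : ℂ) ∉ opSpectrum D) :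
    FiniteDimensional ℂ (gapSpace (upperSpace D a) (upperSpace D b)) := by
  rcases hab.eq_or_lt with rfl | hab
  · rw [gapSpace_self]; infer_instance
  · obtain ⟨R, hR⟩ := hcont
    -- A single operator is treated as a family over a point.
    obtain ⟨p, -, -, -, h⟩ := exists_continuous_projection (X := Unit) (D := fun _ => D)
      (fun _ => hself) (fun _ => hcomp) ⟨fun _ => R, continuous_const, fun _ => hR⟩ hab
      (fun _ => ha) fun _ => hb
    exact h ()

theorem nonempty_volumeChoice {M : Type*} [TopologicalSpace M] [T2Space M]
    [LocallyCompactSpace M] [SecondCountableTopology M]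
    {D : M → H →ₗ.[ℂ] H} (hself : ∀ x, IsSelfAdjoint (D x))
    (hcomp : ∀ x, HasCompactResolvent (D x)) (hcont : NormResolventContinuous D)
    {ι : Type*} {U : ι → Set M} {lam : ι → ℝ} (hopen : ∀ i, IsOpen (U i))
    (hcontr : ∀ s : Finset ι, s.Nonempty → (⋂ i ∈ s, U i).Nonempty →
      ContractibleSpace ↥(⋂ i ∈ s, U i))
    (hlam : ∀ i, ∀ x ∈ U i, (lam i : ℂ) ∉ opSpectrum (D x)) :
    Nonempty (VolumeChoice D U lam) := by
  classical
  have key : ∀ i j, lam i ≤ lam j →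
      ∃ τ : ∀ x : ↥(U i ∩ U j), ExteriorAlgebra ℂ (diffSpace D lam i j x),
      (∀ x : ↥(U i ∩ U j),
        τ x ∈ ⋀[ℂ]^(Module.finrank ℂ (diffSpace D lam i j x)) (diffSpace D lam i j x)) ∧
      (∀ x, ‖τ x‖ = 1) ∧
      (Continuous fun x : ↥(U i ∩ U j) => ExteriorAlgebra.map (diffSpace D lam i j x).subtype (τ x)) ∧
      (lam i = lam j → τ = fun _ => 1) := by
    intro i j hij
    rcases hij.eq_or_lt with heq | hlt
    -- For equal cut-offs the gap is zero; the constant `1` for both orders satisfies `ω_ij ω_ji =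
    -- 1`.
    · refine ⟨fun _ => 1, fun x => ?_, fun x => norm_one_exterior, ?_, fun _ => rfl⟩
      · have h1 : diffSpace D lam i j x = ⊥ := by
          rw [diffSpace, polSpace, polSpace, heq]; exact gapSpace_self _
        have h2 : Module.finrank ℂ (diffSpace D lam i j x) = 0 := by rw [h1]; exact finrank_bot ℂ H
        rw [h2, ExteriorAlgebra.exteriorPower, pow_zero]
        exact Submodule.one_le.1 le_rfl
      · simp only [map_one]; exact continuous_const
    · rcases isEmpty_or_nonempty ↥(U i ∩ U j) with hemp | hne
      · exact ⟨fun x => isEmptyElim x, fun x => isEmptyElim x, fun x => isEmptyElim x,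
          continuous_iff_continuousAt.2 fun x => isEmptyElim x, fun h => absurd h hlt.ne⟩
      · have hset : (⋂ k ∈ ({i, j} : Finset ι), U k) = U i ∩ U j := by
          ext x; simp
        have h1 := hcontr {i, j} ⟨i, by simp⟩
        rw [hset] at h1
        have := h1 (Set.nonempty_coe_sort.1 hne)
        -- Together with second countability this makes the overlap paracompact, as the construction
        -- of frames requires.
        have := ((hopen i).inter (hopen j)).locallyCompactSpace
        obtain ⟨R, hR, hRx⟩ := hcont
        obtain ⟨p, hp, hpV, hpid, hfin⟩ := exists_continuous_projection (X := ↥(U i ∩ U j))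
          (D := fun x => D x) (fun x => hself x) (fun x => hcomp x)
          ⟨fun x => R x, hR.comp continuous_subtype_val, fun x => hRx x⟩ hlt
          (fun x => hlam i x x.2.1) fun x => hlam j x x.2.2
        obtain ⟨τ, h2, h3, h4⟩ := exists_continuous_top hp hpV hpid
        exact ⟨τ, h2, h3, h4, fun h => absurd h hlt.ne⟩
  choose τ h1 h2 h3 h4 using key
  exact ⟨{
    vol := fun i j h x hi hj => τ i j h ⟨x, hi, hj⟩
    mem_top := fun i j h x hi hj => h1 i j h ⟨x, hi, hj⟩
    norm_vol := fun i j h x hi hj => h2 i j h ⟨x, hi, hj⟩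
    continuous_vol := fun i j h => h3 i j h
    vol_mul_vol := fun i j h x hi hj => by
      rw [h4 i j h.le h, h4 j i h.ge h.symm, map_one, map_one, one_mul] }⟩

end Existence

/-! ### The family of intertwining operators -/

section Family

variable {H : Type*} [NormedAddCommGroup H] [InnerProductSpace ℂ H] [CompleteSpace H]
variable {M ι : Type*} [TopologicalSpace M] {D : M → H →ₗ.[ℂ] H} {U : ι → Set M} {lam : ι → ℝ}

omit [CompleteSpace H] in
lemma map_subtype_map_inclusion {V W : Submodule ℂ H} (h : V ≤ W) (x : ExteriorAlgebra ℂ V) :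
    ExteriorAlgebra.map W.subtype (ExteriorAlgebra.map (Submodule.inclusion h) x)
      = ExteriorAlgebra.map V.subtype x := by
  rw [← AlgHom.comp_apply, ExteriorAlgebra.map_comp_map]
  rfl

/-- The volume element as an element of the exterior algebra of the whole Hilbert space. -/
def VolumeChoice.ambient (w : VolumeChoice D U lam) (i j : ι) (h : lam i ≤ lam j) (x : M)
    (hi : x ∈ U i) (hj : x ∈ U j) : ExteriorAlgebra ℂ H :=
  ExteriorAlgebra.map (diffSpace D lam i j x).subtype (w.vol i j h x hi hj)

/-- For `lam i ≤ lam j` the volume condition prescribes the image of the vacuum and hence the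
operator; the opposite direction must be its inverse. The two prescriptions overlap when `lam i =
lam j`, and there `ω_ij ω_ji = 1` makes them agree. -/
theorem existsUnique_intertwinerFamily
    (hfin : ∀ i j x, lam i ≤ lam j → x ∈ U i → x ∈ U j →
      FiniteDimensional ℂ (diffSpace D lam i j x))
    (w : VolumeChoice D U lam) : ∃! S : UnitaryFamily D U lam, IsIntertwinerFamily w S := by
  classical
  have hT : ∀ i j x (h : lam i ≤ lam j) (hi : x ∈ U i) (hj : x ∈ U j),
      ∃ T : PolFock (polSpace D lam j x) ≃ₗᵢ[ℂ] PolFock (polSpace D lam i x),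
        T (vacuum _) = volVec (polSpace D lam i x) (polSpace D lam j x) (w.vol i j h x hi hj) ∧
        ∀ f v, T ((quasiFree (polSpace D lam j x)).creation f v)
          = (quasiFree (polSpace D lam i x)).creation f (T v) := by
    intro i j x h hi hj
    have := hfin i j x h hi hj
    exact exists_unitary_volVec (upperSpace_mono h) (w.mem_top i j h x hi hj)
      (w.norm_vol i j h x hi hj)
  choose T hTvac hTint using hT
  have hTT : ∀ i j x (h : lam i = lam j) (hi : x ∈ U i) (hj : x ∈ U j),
      T j i x h.ge hj hi = (T i j x h.le hi hj).symm := by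
    intro i j x h hi hj
    have h1 : ∀ v, T i j x h.le hi hj (T j i x h.ge hj hi v) = (1 : ℂ) • v := by
      intro v
      refine CARRep.eq_smul_of_vacuum (R := quasiFree (polSpace D lam i x))
        (T := (T j i x h.ge hj hi).trans (T i j x h.le hi hj))
        (T' := LinearIsometryEquiv.refl ℂ _) (fun f v => ?_) (fun f v => rfl) ?_ v
      · rw [LinearIsometryEquiv.trans_apply, hTint, hTint]; rfl
      · rw [LinearIsometryEquiv.trans_apply, hTvac, creation_volVec (upperSpace_mono h.le)
          (hTint i j x h.le hi hj) (hTvac i j x h.le hi hj)]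
        -- The normalisation `ω_ij ω_ji = 1` lives in the exterior algebra of `H`; injectivity of
        -- the map induced by the inclusion brings it back.
        have h2 : ExteriorAlgebra.map (polSpace D lam i x).subtype
            (ExteriorAlgebra.map (Submodule.inclusion (inf_le_left.trans (upperSpace_mono h.le)))
              (w.vol j i h.ge x hj hi) *
            ExteriorAlgebra.map (Submodule.inclusion inf_le_left) (w.vol i j h.le x hi hj)) = 
            ExteriorAlgebra.map (polSpace D lam i x).subtype 1 := by
          rw [map_mul, map_subtype_map_inclusion, map_subtype_map_inclusion, map_one]
          exact w.vol_mul_vol j i h.symm x hj hi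
        have h3 := ExteriorAlgebra.map_injective_field
          (Submodule.ker_subtype (polSpace D lam i x)) h2
        rw [h3, one_smul]
        rfl
    ext1 v
    rw [LinearIsometryEquiv.eq_symm_apply, h1, one_smul]
  refine ⟨fun i j x hi hj => if h : lam i ≤ lam j then T i j x h hi hj
    else (T j i x (le_of_not_ge h) hj hi).symm, ⟨?_, ?_, ?_⟩, ?_⟩
  · intro i j x hi hj f v
    split_ifs with h
    · exact hTint i j x h hi hj f v
    · exact CARRep.symm_creation (hTint j i x _ hj hi) f v
  · intro i j x hi hj
    rcases lt_trichotomy (lam i) (lam j) with h | h | h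
    · simp only [dif_pos h.le, dif_neg h.not_ge]
    · simp only [dif_pos h.le, dif_pos h.ge, hTT i j x h hi hj]
    · simp only [dif_pos h.le, dif_neg h.not_ge, LinearIsometryEquiv.symm_symm]
  · intro i j h x hi hj
    have h1 : (if h : lam j ≤ lam i then T j i x h hj hi
        else (T i j x (le_of_not_ge h) hi hj).symm) = (T i j x h hi hj).symm := by
      split_ifs with h'
      · exact hTT i j x (le_antisymm h h') hi hj
      · rfl
    rw [h1, LinearIsometryEquiv.symm_apply_eq, hTvac]
    rfl
  · intro S hS
    have h1 : ∀ i j x hi hj (h : lam i ≤ lam j), S i j x hi hj = T i j x h hi hj := by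
      intro i j x hi hj h
      ext1 v
      rw [CARRep.eq_smul_of_vacuum (R := quasiFree (polSpace D lam i x)) (T := S i j x hi hj)
        (hS.intertwines i j x hi hj) (hTint i j x h hi hj) (c := 1) ?_ v, one_smul]
      rw [one_smul, hTvac, ← LinearIsometryEquiv.eq_symm_apply, ← hS.inverse]
      exact (hS.map_vol i j h x hi hj).symm
    funext i j x hi hj
    split_ifs with h
    · exact h1 i j x hi hj h
    · rw [hS.inverse j i x hj hi, h1 j i x hj hi (le_of_not_ge h)]

end Family

/-! ### Phases of triple compositions: symmetries, cocycle identity, continuity -/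

section Phase

variable {H : Type*} [NormedAddCommGroup H] [InnerProductSpace ℂ H] [CompleteSpace H]
variable {M ι : Type*} [TopologicalSpace M] {D : M → H →ₗ.[ℂ] H} {U : ι → Set M} {lam : ι → ℝ}
  {w w' : VolumeChoice D U lam} {S S' : UnitaryFamily D U lam}

omit [CompleteSpace H] in
lemma circle_eq_of_smul_eq {W : Submodule ℂ H} {c d : Circle} {v : PolFock W} (hv : v ≠ 0)
    (h : (c : ℂ) • v = (d : ℂ) • v) : c = d :=
  Circle.coe_injective (smul_left_injective ℂ hv h)

lemma IsIntertwinerFamily.map_vacuum (hS : IsIntertwinerFamily w S) {i j : ι} (h : lam i ≤ lam j)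
    {x : M} (hi : x ∈ U i) (hj : x ∈ U j) :
    S i j x hi hj (vacuum _)
      = volVec (polSpace D lam i x) (polSpace D lam j x) (w.vol i j h x hi hj) := by
  rw [← LinearIsometryEquiv.eq_symm_apply, ← hS.inverse]
  exact (hS.map_vol i j h x hi hj).symm

lemma IsIntertwinerFamily.apply_apply (hS : IsIntertwinerFamily w S) {i j : ι}
    {x : M} (hi : x ∈ U i) (hj : x ∈ U j) (v : PolFock (polSpace D lam i x)) :
    S i j x hi hj (S j i x hj hi v) = v := by
  rw [hS.inverse i j, LinearIsometryEquiv.apply_symm_apply]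

lemma IsIntertwinerFamily.exists_phase (hS : IsIntertwinerFamily w S) (i j k : ι) (x : M)
    (hi : x ∈ U i) (hj : x ∈ U j) (hk : x ∈ U k) :
    ∃ c : Circle, ∀ v, S i j x hi hj (S j k x hj hk v) = (c : ℂ) • S i k x hi hk v := by
  refine CARRep.exists_phase (R := quasiFree (polSpace D lam i x))
    (T := (S j k x hj hk).trans (S i j x hi hj)) (fun f v => ?_) (hS.intertwines i k x hi hk)
  rw [LinearIsometryEquiv.trans_apply, hS.intertwines, hS.intertwines]
  rfl

/-- The phase `c` with `S_{ij} S_{jk} = c S_{ik}`. -/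
def IsIntertwinerFamily.phase (hS : IsIntertwinerFamily w S) (i j k : ι) (x : M)
    (hi : x ∈ U i) (hj : x ∈ U j) (hk : x ∈ U k) : Circle :=
  (hS.exists_phase i j k x hi hj hk).choose

lemma IsIntertwinerFamily.phase_spec (hS : IsIntertwinerFamily w S) (i j k : ι) (x : M)
    (hi : x ∈ U i) (hj : x ∈ U j) (hk : x ∈ U k) (v : PolFock (polSpace D lam k x)) :
    S i j x hi hj (S j k x hj hk v) = (hS.phase i j k x hi hj hk : ℂ) • S i k x hi hk v :=
  (hS.exists_phase i j k x hi hj hk).choose_spec v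

omit [CompleteSpace H] in
lemma vacuum_ne_zero (W : Submodule ℂ H) : vacuum W ≠ 0 := fun h => by
  simpa [norm_vacuum] using congrArg norm h

lemma IsIntertwinerFamily.phase_eq_iff (hS : IsIntertwinerFamily w S) (i j k : ι) (x : M)
    (hi : x ∈ U i) (hj : x ∈ U j) (hk : x ∈ U k) (c : Circle) :
    hS.phase i j k x hi hj hk = c ↔
      ∀ v, S i j x hi hj (S j k x hj hk v) = (c : ℂ) • S i k x hi hk v := by
  constructor
  · rintro rfl
    exact hS.phase_spec i j k x hi hj hk
  · intro h
    have h1 := (hS.phase_spec i j k x hi hj hk (vacuum _)).symm.trans (h _)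
    exact circle_eq_of_smul_eq ((map_ne_zero_iff _ (S i k x hi hk).injective).2
      (vacuum_ne_zero _)) h1

/-- The phase is the scalar of a closed loop of three operators, and conjugating a scalar to another
starting point leaves it unchanged. -/
lemma IsIntertwinerFamily.phase_cyclic (hS : IsIntertwinerFamily w S) (i j k : ι) (x : M)
    (hi : x ∈ U i) (hj : x ∈ U j) (hk : x ∈ U k) :
    hS.phase j k i x hj hk hi = hS.phase i j k x hi hj hk := by
  rw [phase_eq_iff]
  intro v
  have h1 := hS.phase_spec i j k x hi hj hk (S k i x hk hi v)
  rw [hS.apply_apply] at h1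
  have h2 := congrArg (S j i x hj hi) h1
  rwa [hS.apply_apply, map_smul] at h2

/-- Traversing the loop backwards inverts its scalar, since `S j i` is inverse to `S i j`. -/
lemma IsIntertwinerFamily.phase_reverse (hS : IsIntertwinerFamily w S) (i j k : ι) (x : M)
    (hi : x ∈ U i) (hj : x ∈ U j) (hk : x ∈ U k) :
    hS.phase k j i x hk hj hi = (hS.phase i j k x hi hj hk)⁻¹ := by
  rw [phase_eq_iff]
  intro v
  have h1 := hS.phase_spec i j k x hi hj hk (S k j x hk hj (S j i x hj hi v))
  rw [hS.apply_apply, hS.apply_apply] at h1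
  have h2 := congrArg (S k i x hk hi) h1
  rw [map_smul, hS.apply_apply] at h2
  rw [h2, smul_smul, Circle.coe_inv, inv_mul_cancel₀ (Circle.coe_ne_zero _), one_smul]

/-- Associativity: the composite `S_ij S_jk S_kl`, applied to the vacuum, is reduced to a multiple
of `S_il` in two ways. -/
lemma IsIntertwinerFamily.phase_cocycle (hS : IsIntertwinerFamily w S) (i j k l : ι) (x : M)
    (hi : x ∈ U i) (hj : x ∈ U j) (hk : x ∈ U k) (hl : x ∈ U l) :
    hS.phase i j k x hi hj hk * hS.phase i k l x hi hk hl
      = hS.phase j k l x hj hk hl * hS.phase i j l x hi hj hl := by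
  have h1 := congrArg (S i j x hi hj) (hS.phase_spec j k l x hj hk hl (vacuum _))
  rw [hS.phase_spec i j k, hS.phase_spec i k l, map_smul, hS.phase_spec i j l, smul_smul,
    smul_smul, ← Circle.coe_mul, ← Circle.coe_mul] at h1
  exact circle_eq_of_smul_eq ((map_ne_zero_iff _ (S i l x hi hl).injective).2
    (vacuum_ne_zero _)) h1

omit [CompleteSpace H] in
lemma inner_volVec {W W' : Submodule ℂ H} (y : ExteriorAlgebra ℂ (gapSpace W W'))
    (z : ExteriorAlgebra ℂ W) :
    inner ℂ (volVec W W' y) (polVec W z 1)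
      = inner ℂ (ExteriorAlgebra.map (gapSpace W W').subtype y)
        (ExteriorAlgebra.map W.subtype z) := by
  rw [volVec_apply, inner_polVec, ← map_subtype_map_inclusion (inf_le_left : gapSpace W W' ≤ W),
    inner_map (L := W.subtype) fun v w => rfl]
  have : (inner ℂ (1 : ExteriorAlgebra ℂ (ConjSpace Wᗮ)) 1 : ℂ) = 1 := by
    rw [inner_eq_extInner, extInner_one, map_one]
  rw [this, mul_one]

omit [CompleteSpace H] in
lemma norm_volVec {W W' : Submodule ℂ H} (y : ExteriorAlgebra ℂ (gapSpace W W')) :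
    ‖volVec W W' y‖ = ‖y‖ := by
  rw [volVec_apply, norm_polVec, norm_one_exterior, mul_one, norm_map]
  exact fun v w => rfl

/-- On the vacuum, `S_ij S_jk` gives `(ω_jk ∧ ω_ij) ⊗ 1` and `S_ik` gives the unit vector `ω_ik ⊗
1`; pair with the latter. All terms lie in the exterior algebra of `H`, which does not depend on
`x`. -/
lemma IsIntertwinerFamily.coe_phase (hS : IsIntertwinerFamily w S) {i j k : ι} {x : M}
    (hi : x ∈ U i) (hj : x ∈ U j) (hk : x ∈ U k) (hij : lam i ≤ lam j) (hjk : lam j ≤ lam k) :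
    (hS.phase i j k x hi hj hk : ℂ) = inner ℂ (w.ambient i k (hij.trans hjk) x hi hk)
      (w.ambient j k hjk x hj hk * w.ambient i j hij x hi hj) := by
  have h1 := hS.phase_spec i j k x hi hj hk (vacuum _)
  rw [hS.map_vacuum hjk, hS.map_vacuum (hij.trans hjk), creation_volVec (upperSpace_mono hij)
    (hS.intertwines i j x hi hj) (hS.map_vacuum hij hi hj)] at h1
  have h2 := congrArg (fun v => inner ℂ (volVec (polSpace D lam i x) (polSpace D lam k x)
    (w.vol i k (hij.trans hjk) x hi hk)) v) h1
  simp only [inner_volVec, inner_smul_right, inner_self_eq_norm_sq_to_K] at h2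
  rw [norm_volVec, w.norm_vol, map_mul, map_subtype_map_inclusion, map_subtype_map_inclusion] at h2
  simpa using! h2.symm

omit [CompleteSpace H] in
lemma VolumeChoice.continuous_ambient (w : VolumeChoice D U lam) {Y : Type*} [TopologicalSpace Y]
    {e : Y → M} (he : Continuous e) {i j : ι} (h : lam i ≤ lam j) (hi : ∀ y, e y ∈ U i)
    (hj : ∀ y, e y ∈ U j) : Continuous fun y => w.ambient i j h (e y) (hi y) (hj y) := by
  have h1 : Continuous fun x : ↥(U i ∩ U j) => w.ambient i j h x x.2.1 x.2.2 :=
    w.continuous_vol i j h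
  have h2 : Continuous fun y => (⟨e y, hi y, hj y⟩ : ↥(U i ∩ U j)) := he.subtype_mk _
  generalize hF : (fun x : ↥(U i ∩ U j) => w.ambient i j h x x.2.1 x.2.2) = F at h1
  have h3 := h1.comp h2
  subst hF
  exact h3

lemma IsIntertwinerFamily.continuous_phase_of_le
    (hfin : ∀ i j x, lam i ≤ lam j → x ∈ U i → x ∈ U j →
      FiniteDimensional ℂ (diffSpace D lam i j x))
    (hS : IsIntertwinerFamily w S) {Y : Type*} [TopologicalSpace Y]
    {e : Y → M} (he : Continuous e) {i j k : ι} (hi : ∀ y, e y ∈ U i) (hj : ∀ y, e y ∈ U j)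
    (hk : ∀ y, e y ∈ U k) (hij : lam i ≤ lam j) (hjk : lam j ≤ lam k) :
    Continuous fun y => hS.phase i j k (e y) (hi y) (hj y) (hk y) := by
  refine continuous_induced_rng.2 ?_
  change Continuous fun y => (hS.phase i j k (e y) (hi y) (hj y) (hk y) : ℂ)
  simp only [hS.coe_phase _ _ _ hij hjk]
  refine Continuous.inner (w.continuous_ambient he _ hi hk) ?_
  refine continuous_mul_of_contraction (w.continuous_ambient he _ hj hk)
    (w.continuous_ambient he _ hi hj) fun y z => ?_
  have := hfin j k (e y) hjk (hj y) (hk y)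
  exact norm_top_mul_le _ (fun v w => rfl) (w.mem_top j k hjk _ _ _) (w.norm_vol j k hjk _ _ _) z

/-- Rotation and reversal generate all permutations of three indices, so every order of the cut-offs
reduces to the increasing one. -/
lemma IsIntertwinerFamily.continuous_phase
    (hfin : ∀ i j x, lam i ≤ lam j → x ∈ U i → x ∈ U j →
      FiniteDimensional ℂ (diffSpace D lam i j x))
    (hS : IsIntertwinerFamily w S) {Y : Type*} [TopologicalSpace Y]
    {e : Y → M} (he : Continuous e) {i j k : ι} (hi : ∀ y, e y ∈ U i) (hj : ∀ y, e y ∈ U j)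
    (hk : ∀ y, e y ∈ U k) :
    Continuous fun y => hS.phase i j k (e y) (hi y) (hj y) (hk y) := by
  have hrot : ∀ {i j k : ι} (hi : ∀ y, e y ∈ U i) (hj : ∀ y, e y ∈ U j) (hk : ∀ y, e y ∈ U k),
      (Continuous fun y => hS.phase i j k (e y) (hi y) (hj y) (hk y)) →
      Continuous fun y => hS.phase j k i (e y) (hj y) (hk y) (hi y) := by
    intro i j k hi hj hk h
    exact h.congr fun y => (hS.phase_cyclic i j k _ _ _ _).symm
  have hrev : ∀ {i j k : ι} (hi : ∀ y, e y ∈ U i) (hj : ∀ y, e y ∈ U j) (hk : ∀ y, e y ∈ U k),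
      (Continuous fun y => hS.phase i j k (e y) (hi y) (hj y) (hk y)) →
      Continuous fun y => hS.phase k j i (e y) (hk y) (hj y) (hi y) := by
    intro i j k hi hj hk h
    simp only [hS.phase_reverse i j k]
    exact h.inv
  have main := fun {i j k : ι} (hi : ∀ y, e y ∈ U i) (hj : ∀ y, e y ∈ U j)
    (hk : ∀ y, e y ∈ U k) (hij : lam i ≤ lam j) (hjk : lam j ≤ lam k) =>
    hS.continuous_phase_of_le hfin he hi hj hk hij hjk
  rcases le_total (lam i) (lam j) with h1 | h1 <;> rcases le_total (lam j) (lam k) with h2 | h2 <;>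
    rcases le_total (lam i) (lam k) with h3 | h3
  · exact main hi hj hk h1 h2
  · exact main hi hj hk h1 h2
  · exact hrot _ _ _ (hrot _ _ _ (hrev _ _ _ (main hi hk hj h3 h2)))
  · exact hrot _ _ _ (main hk hi hj h3 h1)
  · exact hrot _ _ _ (hrev _ _ _ (main hj hi hk h1 h3))
  · exact hrot _ _ _ (hrot _ _ _ (main hj hk hi h2 h3))
  · exact hrev _ _ _ (main hk hj hi h2 h1)
  · exact hrev _ _ _ (main hk hj hi h2 h1)

end Phase

/-! ### The Čech cocycle of the family -/

section Cocycle

variable {H : Type*} [NormedAddCommGroup H] [InnerProductSpace ℂ H] [CompleteSpace H]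
variable {M ι : Type*} [TopologicalSpace M] {D : M → H →ₗ.[ℂ] H} {U : ι → Set M} {lam : ι → ℝ}
  {w w' : VolumeChoice D U lam} {S S' : UnitaryFamily D U lam}

omit [TopologicalSpace M] in
lemma mem_of_mem_iInter {p : ℕ} {s : Fin p → ι} (x : ↥(⋂ a, U (s a))) (a : Fin p) :
    (x : M) ∈ U (s a) := Set.mem_iInter.1 x.2 a

lemma cechDelta_apply {p : ℕ} (f : CechCochain U p) (s : Fin (p + 2) → ι) (x : ↥(⋂ a, U (s a))) :
    cechDelta U p f s x = ∏ a : Fin (p + 2),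
      (f (fun b => s (a.succAbove b)) (Set.inclusion (face_subset U s a) x))
        ^ ((-1 : ℤ) ^ (a : ℕ)) := by
  change (∏ a : Fin (p + 2), ((f fun b => s (a.succAbove b)).comp
    (ContinuousMap.inclusion (face_subset U s a))) ^ ((-1 : ℤ) ^ (a : ℕ)) :
      C(↥(⋂ a, U (s a)), Circle)) x = _
  rw [ContinuousMap.prod_apply]
  rfl

/-- The cochain of triple scalars of the family `S`. -/
def IsIntertwinerFamily.cochain (hS : IsIntertwinerFamily w S)
    (hfin : ∀ i j x, lam i ≤ lam j → x ∈ U i → x ∈ U j →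
      FiniteDimensional ℂ (diffSpace D lam i j x)) : CechCochain U 2 := fun s =>
  -- The triple composition is `S_10 S_02 S_21 = c S_12 S_21 = c`, with `c` the phase of the indices
  -- `1, 0, 2`.
  { toFun := fun x => hS.phase (s 1) (s 0) (s 2) x (mem_of_mem_iInter x 1) (mem_of_mem_iInter x 0)
      (mem_of_mem_iInter x 2)
    continuous_toFun := hS.continuous_phase hfin continuous_subtype_val _ _ _ }

variable {hfin : ∀ i j x, lam i ≤ lam j → x ∈ U i → x ∈ U j →
      FiniteDimensional ℂ (diffSpace D lam i j x)}

/-- The order `1, 0, 2` is an odd permutation of `0, 1, 2`, hence the inverse; the natural order is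
the one that suits the coboundary formula. -/
lemma IsIntertwinerFamily.cochain_apply (hS : IsIntertwinerFamily w S) (s : Fin 3 → ι)
    (x : ↥(⋂ a, U (s a))) :
    hS.cochain hfin s x = (hS.phase (s 0) (s 1) (s 2) x (mem_of_mem_iInter x 0)
      (mem_of_mem_iInter x 1) (mem_of_mem_iInter x 2))⁻¹ := by
  rw [← hS.phase_reverse, ← hS.phase_cyclic]
  rfl

lemma IsIntertwinerFamily.isTripleScalar_iff (hS : IsIntertwinerFamily w S)
    (g : CechCochain U 2) : IsTripleScalar S g ↔ g = hS.cochain hfin := by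
  have key : ∀ (s : Fin 3 → ι) (x : ↥(⋂ a, U (s a))) (v : PolFock (polSpace D lam (s 1) x)),
      S (s 1) (s 0) x (Set.mem_iInter.1 x.2 1) (Set.mem_iInter.1 x.2 0)
        (S (s 0) (s 2) x (Set.mem_iInter.1 x.2 0) (Set.mem_iInter.1 x.2 2)
          (S (s 2) (s 1) x (Set.mem_iInter.1 x.2 2) (Set.mem_iInter.1 x.2 1) v))
        = (hS.cochain hfin s x : ℂ) • v := by
    intro s x v
    rw [hS.phase_spec, hS.apply_apply]
    rfl
  constructor
  · intro h
    funext s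
    ext1 x
    exact circle_eq_of_smul_eq (vacuum_ne_zero _) ((h s x (vacuum _)).symm.trans (key s x _))
  · rintro rfl
    exact key

lemma IsIntertwinerFamily.cochain_mem (hS : IsIntertwinerFamily w S) :
    hS.cochain hfin ∈ cechCocycles U 2 := by
  rw [MonoidHom.mem_ker]
  funext s
  ext1 x
  have h := hS.phase_cocycle (s 0) (s 1) (s 2) (s 3) x (mem_of_mem_iInter x 0)
    (mem_of_mem_iInter x 1) (mem_of_mem_iInter x 2) (mem_of_mem_iInter x 3)
  rw [cechDelta_apply, Fin.prod_univ_four]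
  have h0 := hS.cochain_apply (hfin := hfin) (fun b => s ((0 : Fin 4).succAbove b))
    (Set.inclusion (face_subset U s 0) x)
  have h1 := hS.cochain_apply (hfin := hfin) (fun b => s ((1 : Fin 4).succAbove b))
    (Set.inclusion (face_subset U s 1) x)
  have h2 := hS.cochain_apply (hfin := hfin) (fun b => s ((2 : Fin 4).succAbove b))
    (Set.inclusion (face_subset U s 2) x)
  have h3 := hS.cochain_apply (hfin := hfin) (fun b => s ((3 : Fin 4).succAbove b))
    (Set.inclusion (face_subset U s 3) x)
  rw [h0, h1, h2, h3]
  -- The faces `succAbove` evaluate definitionally, so the coboundary is an alternating product of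
  -- four phases, to which associativity applies.
  change (hS.phase (s 1) (s 2) (s 3) x _ _ _)⁻¹ ^ ((-1 : ℤ) ^ 0)
    * (hS.phase (s 0) (s 2) (s 3) x _ _ _)⁻¹ ^ ((-1 : ℤ) ^ 1)
    * (hS.phase (s 0) (s 1) (s 3) x _ _ _)⁻¹ ^ ((-1 : ℤ) ^ 2)
    * (hS.phase (s 0) (s 1) (s 2) x _ _ _)⁻¹ ^ ((-1 : ℤ) ^ 3) = 1
  generalize hS.phase (s 1) (s 2) (s 3) x _ _ _ = a at h ⊢
  generalize hS.phase (s 0) (s 2) (s 3) x _ _ _ = b at h ⊢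
  generalize hS.phase (s 0) (s 1) (s 3) x _ _ _ = c at h ⊢
  generalize hS.phase (s 0) (s 1) (s 2) x _ _ _ = d at h ⊢
  norm_num
  calc a⁻¹ * b * c⁻¹ * d = (d * b) * (a⁻¹ * c⁻¹) := by ac_rfl
    _ = 1 := by rw [h, ← mul_inv, mul_inv_cancel]

/-- Two families of intertwining operators differ by a phase. -/
lemma exists_relPhase (hS : IsIntertwinerFamily w S) (hS' : IsIntertwinerFamily w' S') (i j : ι)
    (x : M) (hi : x ∈ U i) (hj : x ∈ U j) :
    ∃ c : Circle, ∀ v, S' i j x hi hj v = (c : ℂ) • S i j x hi hj v :=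
  CARRep.exists_phase (R := quasiFree (polSpace D lam i x)) (hS'.intertwines i j x hi hj)
    (hS.intertwines i j x hi hj)

/-- For `lam i ≤ lam j`, comparing images of the vacuum shows that the relative phase is `⟪ω_ij,
ω'_ij⟫`, which is continuous. For the opposite order it is the inverse phase. -/
theorem exists_cochain_relPhase (hS : IsIntertwinerFamily w S) (hS' : IsIntertwinerFamily w' S') :
    ∃ b : CechCochain U 1, ∀ (s : Fin 2 → ι) (x : ↥(⋂ a, U (s a))) v,
      S' (s 0) (s 1) x (mem_of_mem_iInter x 0) (mem_of_mem_iInter x 1) v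
        = (b s x : ℂ) • S (s 0) (s 1) x (mem_of_mem_iInter x 0) (mem_of_mem_iInter x 1) v := by
  choose c hc using exists_relPhase hS hS'
  have hsymm : ∀ i j x hi hj, c i j x hi hj = (c j i x hj hi)⁻¹ := by
    intro i j x hi hj
    refine circle_eq_of_smul_eq ((map_ne_zero_iff _ (S i j x hi hj).injective).2
      (vacuum_ne_zero _)) ?_
    rw [← hc]
    have h := hc j i x hj hi (S i j x hi hj (vacuum _))
    rw [hS.apply_apply] at h
    have h2 := congrArg (S' i j x hi hj) h
    rw [map_smul, hS'.apply_apply] at h2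
    rw [h2, smul_smul, Circle.coe_inv, inv_mul_cancel₀ (Circle.coe_ne_zero _), one_smul]
  have hle : ∀ i j (h : lam i ≤ lam j) x hi hj,
      (c i j x hi hj : ℂ) = inner ℂ (w.ambient i j h x hi hj) (w'.ambient i j h x hi hj) := by
    intro i j h x hi hj
    have h1 := hc i j x hi hj (vacuum _)
    rw [hS.map_vacuum h, hS'.map_vacuum h] at h1
    have h2 := congrArg (fun v => inner ℂ (volVec (polSpace D lam i x) (polSpace D lam j x)
      (w.vol i j h x hi hj)) v) h1
    rw [inner_smul_right] at h2
    conv at h2 => lhs; rw [volVec_apply (τ := w'.vol i j h x hi hj)]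
    simp only [inner_volVec, inner_self_eq_norm_sq_to_K] at h2
    rw [norm_volVec, w.norm_vol, map_subtype_map_inclusion] at h2
    simpa using! h2.symm
  have hcle : ∀ i j (h : lam i ≤ lam j) (Y : Set M) (hi : ∀ y : Y, (y : M) ∈ U i)
      (hj : ∀ y : Y, (y : M) ∈ U j), Continuous fun y : Y => c i j y (hi y) (hj y) := by
    intro i j h Y hi hj
    refine continuous_induced_rng.2 ?_
    change Continuous fun y : Y => (c i j y (hi y) (hj y) : ℂ)
    simp only [hle i j h]
    exact Continuous.inner (w.continuous_ambient continuous_subtype_val h hi hj)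
      (w'.continuous_ambient continuous_subtype_val h hi hj)
  refine ⟨fun s => ⟨fun x => c (s 0) (s 1) x (mem_of_mem_iInter x 0) (mem_of_mem_iInter x 1), ?_⟩,
    fun s x v => hc _ _ _ _ _ v⟩
  rcases le_total (lam (s 0)) (lam (s 1)) with h | h
  · exact hcle _ _ h _ _ _
  · simp only [hsymm (s 0) (s 1)]
    exact (hcle _ _ h _ _ _).inv

theorem mk_cochain_eq (hS : IsIntertwinerFamily w S) (hS' : IsIntertwinerFamily w' S') :
    (QuotientGroup.mk ⟨hS.cochain hfin, hS.cochain_mem⟩ : CechCohomology U 1)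
      = QuotientGroup.mk ⟨hS'.cochain hfin, hS'.cochain_mem⟩ := by
  obtain ⟨b, hb⟩ := exists_cochain_relPhase hS hS'
  rw [QuotientGroup.eq, Subgroup.mem_subgroupOf]
  -- If `p` and `q` are the phases of `S` and `S'`, substituting `S' = b S` gives `q b_02 = b_12
  -- b_01 p`. The cochains are `p⁻¹` and `q⁻¹`, so their quotient `p q⁻¹` is the coboundary of
  -- `b⁻¹`.
  refine ⟨b⁻¹, ?_⟩
  funext s
  ext1 x
  have h := hS.phase_spec (s 0) (s 1) (s 2) x (mem_of_mem_iInter x 0) (mem_of_mem_iInter x 1)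
    (mem_of_mem_iInter x 2) (vacuum _)
  have h' := hS'.phase_spec (s 0) (s 1) (s 2) x (mem_of_mem_iInter x 0) (mem_of_mem_iInter x 1)
    (mem_of_mem_iInter x 2) (vacuum _)
  have h0 := hb (fun b => s ((0 : Fin 3).succAbove b)) (Set.inclusion (face_subset U s 0) x)
  have h1 := hb (fun b => s ((1 : Fin 3).succAbove b)) (Set.inclusion (face_subset U s 1) x)
  have h2 := hb (fun b => s ((2 : Fin 3).succAbove b)) (Set.inclusion (face_subset U s 2) x)
  rw [cechDelta_apply, Fin.prod_univ_three]
  change (b (fun b => s ((0 : Fin 3).succAbove b)) (Set.inclusion (face_subset U s 0) x))⁻¹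
      ^ ((-1 : ℤ) ^ 0)
    * (b (fun b => s ((1 : Fin 3).succAbove b)) (Set.inclusion (face_subset U s 1) x))⁻¹
      ^ ((-1 : ℤ) ^ 1)
    * (b (fun b => s ((2 : Fin 3).succAbove b)) (Set.inclusion (face_subset U s 2) x))⁻¹
      ^ ((-1 : ℤ) ^ 2) = (hS.cochain hfin s x)⁻¹ * hS'.cochain hfin s x
  generalize b (fun b => s ((0 : Fin 3).succAbove b)) _ = b₀ at h0 ⊢
  generalize b (fun b => s ((1 : Fin 3).succAbove b)) _ = b₁ at h1 ⊢
  generalize b (fun b => s ((2 : Fin 3).succAbove b)) _ = b₂ at h2 ⊢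
  change ∀ v, S' (s 1) (s 2) x (mem_of_mem_iInter x 1) (mem_of_mem_iInter x 2) v
    = (b₀ : ℂ) • S (s 1) (s 2) x _ _ v at h0
  change ∀ v, S' (s 0) (s 2) x (mem_of_mem_iInter x 0) (mem_of_mem_iInter x 2) v
    = (b₁ : ℂ) • S (s 0) (s 2) x _ _ v at h1
  change ∀ v, S' (s 0) (s 1) x (mem_of_mem_iInter x 0) (mem_of_mem_iInter x 1) v
    = (b₂ : ℂ) • S (s 0) (s 1) x _ _ v at h2
  rw [h0, h1, map_smul, h2, h, smul_smul, smul_smul, smul_smul, ← Circle.coe_mul,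
    ← Circle.coe_mul, ← Circle.coe_mul] at h'
  have h3 := circle_eq_of_smul_eq ((map_ne_zero_iff _ (S (s 0) (s 2) x _ _).injective).2
    (vacuum_ne_zero _)) h'
  rw [hS.cochain_apply, hS'.cochain_apply]
  generalize hS.phase (s 0) (s 1) (s 2) x _ _ _ = p at h3 ⊢
  generalize hS'.phase (s 0) (s 1) (s 2) x _ _ _ = q at h3 ⊢
  norm_num
  rw [← mul_inv_eq_one]
  calc b₀⁻¹ * b₁ * b₂⁻¹ * (p * q⁻¹)⁻¹ = (q * b₁) * (b₀⁻¹ * b₂⁻¹ * p⁻¹) := by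
        rw [mul_inv, inv_inv]; ac_rfl
    _ = 1 := by rw [← h3, ← mul_inv, ← mul_inv, mul_inv_cancel]

end Cocycle

end IndexGerbe

end

/-! ### Assembly of the theorem -/

theorem mainTheorem7
    {H : Type*} [NormedAddCommGroup H] [InnerProductSpace ℂ H] [CompleteSpace H]
    {n : ℕ} {M : Type*} [TopologicalSpace M] [T2Space M] [CompactSpace M]
    [ChartedSpace (EuclideanSpace ℝ (Fin n)) M] [IsManifold (𝓡 n) ∞ M]
    (D : M → H →ₗ.[ℂ] H)
    (hself : ∀ x, IsSelfAdjoint (D x))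
    (hcomp : ∀ x, HasCompactResolvent (D x))
    (hcont : NormResolventContinuous D)
    {ι : Type*} [Finite ι] (U : ι → Set M) (lam : ι → ℝ)
    (hopen : ∀ i, IsOpen (U i))
    (hcover : ⋃ i, U i = Set.univ)
    (hcontr : ∀ s : Finset ι, s.Nonempty → (⋂ i ∈ s, U i).Nonempty →
      ContractibleSpace ↥(⋂ i ∈ s, U i))
    (hlam : ∀ i, ∀ x ∈ U i, (lam i : ℂ) ∉ opSpectrum (D x)) :
    Nonempty (VolumeChoice D U lam) ∧
    (∀ w : VolumeChoice D U lam, ∃! S : UnitaryFamily D U lam, IsIntertwinerFamily w S) ∧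
    ∃! c : CechCohomology U 1,
      ∀ (w : VolumeChoice D U lam) (S : UnitaryFamily D U lam), IsIntertwinerFamily w S →
        ∃ g : cechCocycles U 2,
          (∀ g' : CechCochain U 2, IsTripleScalar S g' ↔ g' = g) ∧ QuotientGroup.mk g = c := by
  obtain ⟨R, -, hR⟩ := id hcont
  have hfin : ∀ i j x, lam i ≤ lam j → x ∈ U i → x ∈ U j →
      FiniteDimensional ℂ (diffSpace D lam i j x) := fun i j x h hi hj =>
    finiteDimensional_gapSpace (hself x) (hcomp x) ⟨R x, hR x⟩ h (hlam i x hi) (hlam j x hj)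
  have : LocallyCompactSpace M := inferInstance
  -- Compactness and the Euclidean charts give second countability, which paracompactness of the
  -- overlaps relies on.
  have : SecondCountableTopology M :=
    ChartedSpace.secondCountable_of_sigmaCompact (EuclideanSpace ℝ (Fin n)) M
  have hvol : Nonempty (VolumeChoice D U lam) :=
    nonempty_volumeChoice hself hcomp hcont hopen hcontr hlam
  have hS := existsUnique_intertwinerFamily hfin
  refine ⟨hvol, hS, ?_⟩
  obtain ⟨w₀⟩ := hvol
  obtain ⟨S₀, hS₀, -⟩ := hS w₀
  -- One choice of volume elements supplies the class and, by its existence, also forces uniqueness;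
  -- `mk_cochain_eq` covers all other choices.
  refine ⟨QuotientGroup.mk ⟨hS₀.cochain hfin, hS₀.cochain_mem⟩, fun w S hS => ?_, fun c hc => ?_⟩
  · exact ⟨⟨hS.cochain hfin, hS.cochain_mem⟩, hS.isTripleScalar_iff (hfin := hfin), mk_cochain_eq hS hS₀⟩
  · obtain ⟨g, hg, rfl⟩ := hc w₀ S₀ hS₀
    congr 1
    exact Subtype.ext ((hg _).1 ((hS₀.isTripleScalar_iff (hfin := hfin) _).2 rfl)).symm
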